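/- Let $k$ be a field, $n\ge 0$, and let $S$ be a finitely generated commutative monoid with an injective monoid morphism $\iota\colon S\to\mathbb Z^{n+1}$ such that $\iota(S)\subseteq\mathbb N^{n+1}$. Let $\alpha\colon S\times S\to k^*$ be a normalized 2-cocycle, i.e. $\alpha(s,t)\alpha(s+t,u)=\alpha(t,u)\alpha(s,t+u)$ for all $s,t,u\in S$ and $\alpha(0,0)=1$. Let $k^\alpha[S]$ be the $k$-algebra with basis $\{X^s\mid s\in S\}$ and product $X^sX^t=\alpha(s,t)X^{s+t}$, and let $k[S]$ be the semigroup algebra (the case $\alpha=1$). Both algebras are $\mathbb Z^{n+1}$-graded, with $X^s$ in degree $\iota(s)$, and $\mathbb Z$-graded, with $X^s$ in degree $|\iota(s)|$, where $|(a_0,\dots,a_n)|=a_0+\dots+a_n$. For an algebra $A$ graded by $G=\mathbb Z^{n+1}$ or $G=\mathbb Z$ as above, let $\mathfrak m$ be the ideal generated by the homogeneous elements of nonzero degree and $k=A/\mathfrak m$ the trivial module, in degree $0$. Write $M[\ell]_g=M_{g+\ell}$ for $\ell\in G$, let $H^i_{\mathfrak m}$ be the right derived functors of $\Gamma_{\mathfrak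 m}(M)=\{x\in M\mid \mathfrak m^N x=0 \text{ for } N\gg 0\}$ on $G$-graded $A$-modules, and let $\underline{\mathrm{Ext}}^i_A$ be the right derived functors of $\underline{\mathrm{Hom}}_A(M,N)=\bigoplus_{g\in G}\mathrm{Hom}(M,N[g])$, where $\mathrm{Hom}$ denotes $A$-linear maps preserving degrees. * $A$ is *AS-Cohen–Macaulay* if there is $d\in\mathbb N$ such that $H^i_{\mathfrak m}(A)=0$ and $H^i_{\mathfrak m^{\rm opp}}(A)=0$ for all $i\neq d$, the latter being computed over $A^{\rm opp}$. * $A$ is *left AS-Gorenstein* if $A$ has finite graded injective dimension $d$ as a left $A$-module and there is $\ell\in G$ such that, as graded $A^{\rm opp}$-modules, $\underline{\mathrm{Ext}}^d_A(k,A)\cong k[\ell]$ and $\underline{\mathrm{Ext}}^i_A(k,A)=0$ for $i\ne d$. It is *AS-Gorenstein* if $A$ and $A^{\rm opp}$ are both left AS-Gorenstein with the same $d$ and the same $\ell$. * $A$ is *AS-regular* if it is AS-Gorenstein and its left and right graded global dimensions are finite and equal. Then, for the $\mathbb Z^{n+1}$-gradings and also for the $\mathbb Z$-gradings: 1. $k^\alpha[S]$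 is AS-Cohen–Macaulay if and only if $k[S]$ is AS-Cohen–Macaulay; 2. $k^\alpha[S]$ is AS-Gorenstein if and only if $k[S]$ is AS-Gorenstein; 3. $k^\alpha[S]$ is AS-regular if and only if $k[S]$ is AS-regular. -/

import Mathlib

open DirectSum

noncomputable section

/-! ### Graded modules over a `G`-graded algebra -/

universe u v w

section Graded

variable {G : Type u} [AddCommGroup G] [DecidableEq G]
variable {k : Type v} [Field k] {A : Type w} [Ring A] [Algebra k A]

/-- A `G`-graded left module over the `G`-graded `k`-algebra `(A, 𝒜)`: a left `A`-module `M` with a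
direct sum decomposition `M = ⨁ M_g` such that `A_g M_h ⊆ M_{g+h}`.
(As `k · 1 ⊆ A_0`, the components `M_g` are automatically `k`-subspaces of `M`.) -/
structure GrMod (𝒜 : G → Submodule k A) where
  carrier : Type w
  [addCommGroup : AddCommGroup carrier]
  [module : Module A carrier]
  deg : G → AddSubgroup carrier
  isInternal : DirectSum.IsInternal deg
  smul_mem : ∀ {g h : G} {a : A} {m : carrier}, a ∈ 𝒜 g → m ∈ deg h → a • m ∈ deg (g + h)

namespace GrMod

attribute [instance] GrMod.addCommGroup GrMod.module

instance (𝒜 : G → Submodule k A) : CoeSort (GrMod 𝒜) (Type w) := ⟨GrMod.carrier⟩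

variable {𝒜 : G → Submodule k A}

/-- Homogeneous maps of degree `0`, i.e. the morphisms of the category of graded modules. -/
def IsHom {M N : GrMod 𝒜} (f : M →ₗ[A] N) : Prop :=
  ∀ h : G, ∀ m ∈ M.deg h, f m ∈ N.deg h

/-- Injective objects of the category of graded modules. -/
def IsInjective (I : GrMod 𝒜) : Prop :=
  ∀ (X Y : GrMod 𝒜) (i : X →ₗ[A] Y) (f : X →ₗ[A] I), IsHom i → IsHom f →
    Function.Injective i → ∃ h : Y →ₗ[A] I, IsHom h ∧ h ∘ₗ i = f

/-- Projective objects of the category of graded modules. -/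
def IsProjective (P : GrMod 𝒜) : Prop :=
  ∀ (X Y : GrMod 𝒜) (p : X →ₗ[A] Y) (f : P →ₗ[A] Y), IsHom p → IsHom f →
    Function.Surjective p → ∃ h : P →ₗ[A] X, IsHom h ∧ p ∘ₗ h = f

theorem isInternal_shift {M : Type*} [AddCommGroup M] {D : G → AddSubgroup M}
    (hD : DirectSum.IsInternal D) (l : G) : DirectSum.IsInternal fun h => D (h + l) := by
  let T : (⨁ h, D (h + l)) →+ ⨁ g, D g :=
    DirectSum.toAddMonoid fun h => DirectSum.of (fun g => D g) (h + l)
  let T' : (⨁ g, D g) →+ ⨁ h, D (h + l) :=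
    DirectSum.toAddMonoid fun g => (DirectSum.of (fun h => D (h + l)) (g - l)).comp
      (AddSubgroup.inclusion (le_of_eq (congrArg D (sub_add_cancel g l).symm)))
  have hT : (DirectSum.coeAddMonoidHom D).comp T = DirectSum.coeAddMonoidHom fun h => D (h + l) := by
    ext h x
    simp [T]
  have hT' : (DirectSum.coeAddMonoidHom fun h => D (h + l)).comp T' =
      DirectSum.coeAddMonoidHom D := by
    ext g x
    simp [T']
  have hTx : ∀ (x : ⨁ h, D (h + l)) (j : G), T x (j + l) = x j := by
    intro x j
    induction x using DirectSum.induction_on with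
    | zero => simp
    | add x y hx hy => simp [hx, hy]
    | of i x =>
      simp only [T, DirectSum.toAddMonoid_of]
      by_cases h : j = i
      · subst h
        simp [DirectSum.of_eq_same]
      · rw [DirectSum.of_eq_of_ne _ _ _ h, DirectSum.of_eq_of_ne]
        simpa using h
  constructor
  · intro x y hxy
    rw [← hT] at hxy
    have := hD.1 hxy
    ext j
    rw [← hTx x j, ← hTx y j, this]
  · intro m
    obtain ⟨x, hx⟩ := hD.2 m
    exact ⟨T' x, by rw [← hx, ← hT', AddMonoidHom.comp_apply]⟩

/-- The shifted module `M[l]`, with `M[l]_h = M_{h+l}`. -/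
def shift (M : GrMod 𝒜) (l : G) : GrMod 𝒜 where
  carrier := M.carrier
  deg h := M.deg (h + l)
  isInternal := isInternal_shift M.isInternal l
  smul_mem ha hm := by
    rw [add_assoc]
    exact M.smul_mem ha hm

end GrMod

/-- The graded algebra `A` as a graded left module over itself. -/
def selfModule (𝒜 : G → Submodule k A) [GradedAlgebra 𝒜] : GrMod 𝒜 where
  carrier := A
  deg g := (𝒜 g).toAddSubgroup
  isInternal := DirectSum.Decomposition.isInternal 𝒜
  smul_mem ha hm := SetLike.GradedMul.mul_mem ha hm

/-- The two-sided ideal `𝔪` generated by the homogeneous elements of nonzero degree. -/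
def augIdeal (𝒜 : G → Submodule k A) : Ideal A :=
  TwoSidedIdeal.asIdeal (TwoSidedIdeal.span {a : A | ∃ g : G, g ≠ 0 ∧ a ∈ 𝒜 g})

instance (𝒜 : G → Submodule k A) : (augIdeal 𝒜).IsTwoSided := by
  unfold augIdeal
  infer_instance

theorem isInternal_concentrated (M : Type*) [AddCommGroup M] :
    DirectSum.IsInternal fun g : G => if g = 0 then (⊤ : AddSubgroup M) else ⊥ := by
  set D : G → AddSubgroup M := fun g => if g = 0 then ⊤ else ⊥ with hD
  have h0 : D 0 = ⊤ := by simp [hD]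
  have hne : ∀ g, g ≠ 0 → ∀ y : D g, y = 0 := by
    rintro g hg ⟨y, hy⟩
    have : D g = ⊥ := by simp [hD, hg]
    rw [this] at hy
    exact Subtype.ext hy
  have hx : ∀ x : ⨁ g, D g, x = DirectSum.of (fun g => D g) 0 (x 0) := by
    intro x
    ext j
    by_cases hj : j = 0
    · subst hj
      rw [DirectSum.of_eq_same]
    · rw [hne j hj (x j), hne j hj (DirectSum.of (fun g => D g) 0 (x 0) j)]
  constructor
  · intro x y hxy
    rw [hx x, hx y] at hxy ⊢
    rw [DirectSum.coeAddMonoidHom_of, DirectSum.coeAddMonoidHom_of] at hxy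
    rw [Subtype.ext hxy]
  · intro m
    exact ⟨DirectSum.of (fun g => D g) 0 ⟨m, h0 ▸ AddSubgroup.mem_top m⟩,
      DirectSum.coeAddMonoidHom_of _ _ _⟩

/-- The trivial graded module `A ⧸ 𝔪`, concentrated in degree `0`; for a connected graded algebra
this is the module `k = A_0`. -/
def trivialModule (𝒜 : G → Submodule k A) : GrMod 𝒜 where
  carrier := A ⧸ augIdeal 𝒜
  deg g := if g = 0 then ⊤ else ⊥
  isInternal := isInternal_concentrated _
  smul_mem {g h a m} ha hm := by
    by_cases hg : g = 0
    · by_cases hh : h = 0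
      · simp [hg, hh]
      · rw [if_neg hh, AddSubgroup.mem_bot] at hm
        rw [hm, smul_zero]
        exact zero_mem _
    · obtain ⟨b, rfl⟩ := Submodule.Quotient.mk_surjective _ m
      have hmem : a * b ∈ augIdeal 𝒜 :=
        Ideal.IsTwoSided.mul_mem_of_left b
          (TwoSidedIdeal.mem_asIdeal.2 (TwoSidedIdeal.subset_span ⟨g, hg, ha⟩))
      have : a • (Submodule.Quotient.mk b : A ⧸ augIdeal 𝒜) = 0 :=
        (Submodule.Quotient.mk_eq_zero _).2 hmem
      rw [this]
      exact zero_mem _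

/-- The induced grading of the opposite algebra. -/
def opGrading (𝒜 : G → Submodule k A) (g : G) : Submodule k Aᵐᵒᵖ :=
  (𝒜 g).comap (MulOpposite.opLinearEquiv k : A ≃ₗ[k] Aᵐᵒᵖ).symm.toLinearMap

instance opGrading.gradedAlgebra (𝒜 : G → Submodule k A) [GradedAlgebra 𝒜] :
    GradedAlgebra (opGrading 𝒜) where
  one_mem := SetLike.GradedOne.one_mem (A := 𝒜)
  mul_mem {i j a b} ha hb := by
    have : b.unop * a.unop ∈ 𝒜 (j + i) := SetLike.GradedMul.mul_mem hb ha
    rw [add_comm] at this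
    exact this
  decompose' x := DirectSum.map
    (fun g => (⟨⟨fun a => (⟨MulOpposite.op a.1, a.2⟩ : opGrading 𝒜 g), rfl⟩, fun _ _ => rfl⟩ :
      𝒜 g →+ opGrading 𝒜 g)) (DirectSum.decompose 𝒜 x.unop)
  left_inv x := by
    induction x using MulOpposite.rec' with
    | h x =>
      induction x using DirectSum.Decomposition.inductionOn 𝒜 with
      | zero => simp
      | homogeneous a =>
        simp only [MulOpposite.unop_op, DirectSum.decompose_coe, DirectSum.map_of]
        rw [DirectSum.coeAddMonoidHom_of]
        rfl
      | add a b ha hb =>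
        simp only [MulOpposite.unop_op, MulOpposite.op_add, MulOpposite.unop_add,
          DirectSum.decompose_add, map_add] at ha hb ⊢
        rw [ha, hb]
  right_inv x := by
    induction x using DirectSum.induction_on with
    | zero => simp
    | of i a =>
      rw [DirectSum.coeAddMonoidHom_of]
      have : DirectSum.decompose 𝒜 (a : Aᵐᵒᵖ).unop =
          DirectSum.of (fun g => 𝒜 g) i ⟨(a : Aᵐᵒᵖ).unop, a.2⟩ :=
        DirectSum.decompose_of_mem 𝒜 a.2
      refine (congrArg _ this).trans ?_
      rw [DirectSum.map_of]
      rfl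
    | add a b ha hb =>
      simp only [MulOpposite.unop_add, DirectSum.decompose_add, map_add] at ha hb ⊢
      rw [ha, hb]

/-! ### Resolutions and graded dimensions -/

/-- Injective resolutions `0 → M → I 0 → I 1 → ⋯` in the category of graded modules. -/
structure InjRes {𝒜 : G → Submodule k A} (M : GrMod 𝒜) where
  I : ℕ → GrMod 𝒜
  injective : ∀ i, (I i).IsInjective
  η : M →ₗ[A] I 0
  d : ∀ i, I i →ₗ[A] I (i + 1)
  η_hom : GrMod.IsHom η
  d_hom : ∀ i, GrMod.IsHom (d i)
  η_injective : Function.Injective η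
  exact_zero : Function.Exact η (d 0)
  exact_succ : ∀ i, Function.Exact (d i) (d (i + 1))

/-- Projective resolutions `⋯ → P 1 → P 0 → M → 0` in the category of graded modules. -/
structure ProjRes {𝒜 : G → Submodule k A} (M : GrMod 𝒜) where
  P : ℕ → GrMod 𝒜
  projective : ∀ i, (P i).IsProjective
  ε : P 0 →ₗ[A] M
  d : ∀ i, P (i + 1) →ₗ[A] P i
  ε_hom : GrMod.IsHom ε
  d_hom : ∀ i, GrMod.IsHom (d i)
  ε_surjective : Function.Surjective ε
  exact_zero : Function.Exact (d 0) ε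
  exact_succ : ∀ i, Function.Exact (d (i + 1)) (d i)

/-- Graded injective dimension: the least length of a graded injective resolution, `⊤` if there is
no finite one. -/
def grInjDim {𝒜 : G → Submodule k A} (M : GrMod 𝒜) : ℕ∞ :=
  sInf {n : ℕ∞ | ∃ m : ℕ, n = m ∧ ∃ R : InjRes M, ∀ i, m < i → Subsingleton (R.I i)}

/-- Graded projective dimension: the least length of a graded projective resolution, `⊤` if there
is no finite one. -/
def grProjDim {𝒜 : G → Submodule k A} (M : GrMod 𝒜) : ℕ∞ :=
  sInf {n : ℕ∞ | ∃ m : ℕ, n = m ∧ ∃ R : ProjRes M, ∀ i, m < i → Subsingleton (R.P i)}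

/-- The (left) graded global dimension of `A`. -/
def grGlobalDim (𝒜 : G → Submodule k A) : ℕ∞ :=
  ⨆ M : GrMod 𝒜, grProjDim M

/-! ### Local cohomology -/

/-- The torsion submodule `Γ_𝔪(M) = {x ∈ M | 𝔪ⁿ x = 0 for n ≫ 0}`. -/
def torsion {𝒜 : G → Submodule k A} (M : GrMod 𝒜) : Submodule A M where
  carrier := {x | ∃ N : ℕ, ∀ n, N ≤ n → ∀ a ∈ augIdeal 𝒜 ^ n, a • x = 0}
  zero_mem' := ⟨0, fun _ _ a _ => smul_zero a⟩
  add_mem' := by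
    rintro x y ⟨p, hp⟩ ⟨q, hq⟩
    refine ⟨max p q, fun n hn a ha => ?_⟩
    rw [smul_add, hp n (le_trans (le_max_left _ _) hn) a ha,
      hq n (le_trans (le_max_right _ _) hn) a ha, add_zero]
  smul_mem' := by
    rintro r x ⟨p, hp⟩
    refine ⟨p, fun n hn a ha => ?_⟩
    rw [← mul_smul]
    exact hp n hn _ (Ideal.IsTwoSided.mul_mem_of_left r ha)

namespace InjRes

variable {𝒜 : G → Submodule k A} {M : GrMod 𝒜} (R : InjRes M)

/-- The `i`-cocycles of the complex `Γ_𝔪(I)`. -/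
def cocycles (i : ℕ) : Submodule A (R.I i) := torsion (R.I i) ⊓ LinearMap.ker (R.d i)

/-- The `i`-coboundaries of the complex `Γ_𝔪(I)`. -/
def coboundaries : (i : ℕ) → Submodule A (R.I i)
  | 0 => ⊥
  | i + 1 => (torsion (R.I i)).map (R.d i)

/-- Local cohomology `H^i_𝔪(M)`, the cohomology of `Γ_𝔪(I)`. -/
abbrev localCohomology (i : ℕ) : Type w :=
  R.cocycles i ⧸ (R.coboundaries i).submoduleOf (R.cocycles i)

end InjRes

/-- `H^i_𝔪(M) = 0` (this does not depend on the injective resolution). -/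
def LocalCohomologyVanishes {𝒜 : G → Submodule k A} (M : GrMod 𝒜) (i : ℕ) : Prop :=
  ∃ R : InjRes M, Subsingleton (R.localCohomology i)

/-! ### `Ext` into the algebra -/

section Dual

variable {𝒜 : G → Submodule k A}

/-- The `A`-linear maps `M → A` that are homogeneous of degree `g`. -/
def dualDeg (M : GrMod 𝒜) (g : G) : AddSubgroup (M →ₗ[A] A) where
  carrier := {f | ∀ h : G, ∀ m ∈ M.deg h, f m ∈ 𝒜 (h + g)}
  zero_mem' _ _ _ := zero_mem _
  add_mem' hf hf' h m hm := add_mem (hf h m hm) (hf' h m hm)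
  neg_mem' hf h m hm := neg_mem (hf h m hm)

/-- The graded dual `⨁_g Hom(M, A[g]) ⊆ Hom_A(M, A)`, a right `A`-module through the right action
of `A` on itself. -/
def gradedDual [GradedAlgebra 𝒜] (M : GrMod 𝒜) : Submodule Aᵐᵒᵖ (M →ₗ[A] A) where
  __ := (⨆ g : G, dualDeg M g : AddSubgroup (M →ₗ[A] A))
  smul_mem' := by
    intro b f hf
    change f ∈ (⨆ g : G, dualDeg M g : AddSubgroup (M →ₗ[A] A)) at hf
    change b • f ∈ (⨆ g : G, dualDeg M g : AddSubgroup (M →ₗ[A] A))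
    induction hf using AddSubgroup.iSup_induction' with
    | h1 =>
      rw [smul_zero]
      exact zero_mem _
    | hadd x y _ _ hx hy =>
      rw [smul_add]
      exact add_mem hx hy
    | hp g f hf =>
      induction b using MulOpposite.rec' with
      | h b =>
        induction b using DirectSum.Decomposition.inductionOn 𝒜 with
        | zero =>
          rw [MulOpposite.op_zero, zero_smul]
          exact zero_mem _
        | add a b ha hb =>
          rw [MulOpposite.op_add, add_smul]
          exact add_mem ha hb
        | @homogeneous j a =>
          refine AddSubgroup.mem_iSup_of_mem (g + j) ?_
          intro h m hm
          rw [← add_assoc]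
          exact SetLike.GradedMul.mul_mem (hf h m hm) a.2

/-- Precomposition with `f`, as a map of right `A`-modules. -/
def dualMap {M N : GrMod 𝒜} (f : M →ₗ[A] N) : (N →ₗ[A] A) →ₗ[Aᵐᵒᵖ] (M →ₗ[A] A) where
  toFun φ := φ ∘ₗ f
  map_add' _ _ := rfl
  map_smul' _ _ := rfl

end Dual

namespace ProjRes

variable {𝒜 : G → Submodule k A} [GradedAlgebra 𝒜] {M : GrMod 𝒜} (R : ProjRes M)

/-- The `i`-cocycles of the complex of graded duals of `P`. -/
def cocycles (i : ℕ) : Submodule Aᵐᵒᵖ (R.P i →ₗ[A] A) :=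
  gradedDual (R.P i) ⊓ LinearMap.ker (dualMap (R.d i))

/-- The `i`-coboundaries of the complex of graded duals of `P`. -/
def coboundaries : (i : ℕ) → Submodule Aᵐᵒᵖ (R.P i →ₗ[A] A)
  | 0 => ⊥
  | i + 1 => (gradedDual (R.P i)).map (dualMap (R.d i))

/-- The right `A`-module `Ext^i(M, A)`, computed in the category of graded modules: cocycles modulo
coboundaries, realized inside the quotient of all maps by the coboundaries. -/
abbrev ext (i : ℕ) : Type w :=
  ↥((R.cocycles i).map (R.coboundaries i).mkQ)

/-- The homogeneous component of degree `g` of `Ext^i(M, A)`: the classes of the cocycles that are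
homogeneous of degree `g`. -/
def extDeg (i : ℕ) (g : G) : Set (R.ext i) :=
  {x | ∃ φ ∈ R.cocycles i, φ ∈ dualDeg (R.P i) g ∧ (R.coboundaries i).mkQ φ = x}

end ProjRes

/-! ### Regularity conditions -/

/-- `A` is `G`-AS-Cohen–Macaulay: there is `n` such that the local cohomology of `A`, both as a left
and as a right module over itself, vanishes outside degree `n`. -/
def IsASCohenMacaulay (𝒜 : G → Submodule k A) [GradedAlgebra 𝒜] : Prop :=
  ∃ n : ℕ, ∀ i : ℕ, i ≠ n →
    LocalCohomologyVanishes (selfModule 𝒜) i ∧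
      LocalCohomologyVanishes (selfModule (opGrading 𝒜)) i

/-- `A` is left `G`-AS-Gorenstein of graded injective dimension `n` and Gorenstein shift `l`:
`Ext^n(k, A) ≅ k[l]` as graded right `A`-modules, and `Ext^i(k, A) = 0` for `i ≠ n`. -/
def IsLeftASGorensteinWith (𝒜 : G → Submodule k A) [GradedAlgebra 𝒜] (n : ℕ) (l : G) : Prop :=
  grInjDim (selfModule 𝒜) = n ∧
    ∃ R : ProjRes (trivialModule 𝒜),
      (∃ e : R.ext n ≃ₗ[Aᵐᵒᵖ] (trivialModule (opGrading 𝒜)).shift l,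
        ∀ (g : G) (x : R.ext n),
          x ∈ R.extDeg n g ↔ e x ∈ ((trivialModule (opGrading 𝒜)).shift l).deg g) ∧
      ∀ i : ℕ, i ≠ n → Subsingleton (R.ext i)

/-- `A` is `G`-AS-Gorenstein: `A` and its opposite algebra are left `G`-AS-Gorenstein with the same
injective dimension and the same Gorenstein shift. -/
def IsASGorenstein (𝒜 : G → Submodule k A) [GradedAlgebra 𝒜] : Prop :=
  ∃ (n : ℕ) (l : G), IsLeftASGorensteinWith 𝒜 n l ∧ IsLeftASGorensteinWith (opGrading 𝒜) n l

/-- `A` is `G`-AS-regular: it is `G`-AS-Gorenstein, and its left and right graded global dimensions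
are finite and coincide. -/
def IsASRegular (𝒜 : G → Submodule k A) [GradedAlgebra 𝒜] : Prop :=
  IsASGorenstein 𝒜 ∧ grGlobalDim 𝒜 ≠ ⊤ ∧ grGlobalDim (opGrading 𝒜) ≠ ⊤ ∧
    grGlobalDim 𝒜 = grGlobalDim (opGrading 𝒜)

end Graded

/-! ### Twisted semigroup algebras -/

section Twisted

/-- Normalized `2`-cocycles on a commutative monoid `S` with values in `kˣ`. -/
structure NormalizedCocycle (S : Type u) (k : Type v) [AddCommMonoid S] [Field k] where
  toFun : S → S → kˣ
  cocycle : ∀ s t r : S, toFun s t * toFun (s + t) r = toFun t r * toFun s (t + r)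
  normalized : toFun 0 0 = 1

variable {S : Type u} {k : Type v} [AddCommMonoid S] [Field k]

/-- The underlying vector space of the twisted semigroup algebra `k^α[S]`, with basis
`X^s = single s 1` for `s : S`. -/
def TwistedSemigroupAlgebra (_α : NormalizedCocycle S k) : Type (max u v) := S →₀ k

namespace TwistedSemigroupAlgebra

variable (α : NormalizedCocycle S k)

instance : AddCommGroup (TwistedSemigroupAlgebra α) := inferInstanceAs (AddCommGroup (S →₀ k))

instance : Module k (TwistedSemigroupAlgebra α) := inferInstanceAs (Module k (S →₀ k))

/-- The basis element `X^s`. -/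
def X (s : S) : TwistedSemigroupAlgebra α := (Finsupp.single s 1 : S →₀ k)

/-- The bilinear product with `X^s * X^t = α(s,t) X^{s+t}`. -/
def mulLin : TwistedSemigroupAlgebra α →ₗ[k]
    TwistedSemigroupAlgebra α →ₗ[k] TwistedSemigroupAlgebra α :=
  Finsupp.linearCombination k fun s : S =>
    (Finsupp.linearCombination k fun t : S => (α.toFun s t : k) • X α (s + t) :
      (S →₀ k) →ₗ[k] TwistedSemigroupAlgebra α)

variable {α}

theorem hom_ext {N : Type*} [AddCommMonoid N] [Module k N]
    {f g : TwistedSemigroupAlgebra α →ₗ[k] N} (h : ∀ s, f (X α s) = g (X α s)) : f = g :=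
  Finsupp.lhom_ext' fun s => LinearMap.ext_ring (h s)

theorem mulLin_X (s t : S) : mulLin α (X α s) (X α t) = (α.toFun s t : k) • X α (s + t) := by
  have h1 : mulLin α (X α s) = (Finsupp.linearCombination k fun t : S =>
      (α.toFun s t : k) • X α (s + t) : (S →₀ k) →ₗ[k] TwistedSemigroupAlgebra α) :=
    (Finsupp.linearCombination_single k (1 : k) s).trans (one_smul k _)
  rw [h1]
  exact (Finsupp.linearCombination_single k (1 : k) t).trans (one_smul k _)

theorem mulLin_assoc (a b c : TwistedSemigroupAlgebra α) :
    mulLin α (mulLin α a b) c = mulLin α a (mulLin α b c) := by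
  have key : (LinearMap.llcomp k _ _ _ ∘ₗ mulLin α).compl₂ (mulLin α) =
      (LinearMap.llcomp k _ _ _ (mulLin α)) ∘ₗ mulLin α := by
    refine hom_ext fun s => hom_ext fun t => hom_ext fun r => ?_
    simp only [LinearMap.compl₂_apply, LinearMap.comp_apply, LinearMap.llcomp_apply, mulLin_X,
      map_smul, LinearMap.smul_apply, smul_smul, add_assoc]
    congr 1
    exact_mod_cast (α.cocycle s t r).symm
  have := LinearMap.congr_fun (LinearMap.congr_fun (LinearMap.congr_fun key a) b) c
  simpa using this.symm

theorem cocycle_zero_left (s : S) : α.toFun 0 s = 1 := by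
  have := α.cocycle 0 0 s
  simpa [α.normalized] using this

theorem cocycle_zero_right (s : S) : α.toFun s 0 = 1 := by
  have := α.cocycle s 0 0
  simpa [α.normalized] using this

theorem one_mulLin (a : TwistedSemigroupAlgebra α) : mulLin α (X α 0) a = a := by
  have : mulLin α (X α 0) = LinearMap.id :=
    hom_ext fun s => by simp [mulLin_X, cocycle_zero_left]
  rw [this, LinearMap.id_apply]

theorem mulLin_one (a : TwistedSemigroupAlgebra α) : mulLin α a (X α 0) = a := by
  have : (mulLin α).flip (X α 0) = LinearMap.id :=
    hom_ext fun s => by simp [mulLin_X, cocycle_zero_right]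
  exact LinearMap.congr_fun this a

instance : Ring (TwistedSemigroupAlgebra α) :=
  { (inferInstance : AddCommGroup (TwistedSemigroupAlgebra α)) with
    mul := fun a b => mulLin α a b
    one := X α 0
    left_distrib := fun a b c => map_add (mulLin α a) b c
    right_distrib := fun a b c => LinearMap.map_add₂ (mulLin α) a b c
    zero_mul := fun a => LinearMap.map_zero₂ (mulLin α) a
    mul_zero := fun a => map_zero (mulLin α a)
    mul_assoc := mulLin_assoc
    one_mul := one_mulLin
    mul_one := mulLin_one }

theorem mul_def (a b : TwistedSemigroupAlgebra α) : a * b = mulLin α a b := rfl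

instance : Algebra k (TwistedSemigroupAlgebra α) :=
  Algebra.ofModule (fun r a b => LinearMap.map_smul₂ (mulLin α) r a b)
    (fun r a b => map_smul (mulLin α a) r b)

/-- The grading of `k^α[S]` induced by a monoid morphism `ψ : S → G`: the component of degree `g` is
spanned by the `X^s` with `ψ s = g`. -/
def gradeBy {G : Type*} [AddCommGroup G] (α : NormalizedCocycle S k) (ψ : S →+ G) (g : G) :
    Submodule k (TwistedSemigroupAlgebra α) :=
  Submodule.span k {x | ∃ s : S, ψ s = g ∧ x = X α s}

theorem X_mem_gradeBy {G : Type*} [AddCommGroup G] (ψ : S →+ G) (s : S) :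
    X α s ∈ gradeBy α ψ (ψ s) :=
  Submodule.subset_span ⟨s, rfl, rfl⟩

/-- The decomposition of an element of `k^α[S]` into its homogeneous components. -/
def decomposeLin {G : Type*} [AddCommGroup G] [DecidableEq G] (ψ : S →+ G) :
    TwistedSemigroupAlgebra α →ₗ[k] ⨁ g, gradeBy α ψ g :=
  Finsupp.linearCombination k fun s : S =>
    DirectSum.lof k G (fun g => gradeBy α ψ g) (ψ s) ⟨X α s, X_mem_gradeBy ψ s⟩

theorem decomposeLin_X {G : Type*} [AddCommGroup G] [DecidableEq G] (ψ : S →+ G) (s : S) :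
    decomposeLin (α := α) ψ (X α s) =
      DirectSum.lof k G (fun g => gradeBy α ψ g) (ψ s) ⟨X α s, X_mem_gradeBy ψ s⟩ :=
  (Finsupp.linearCombination_single k (1 : k) s).trans (one_smul k _)

instance gradeBy.gradedAlgebra {G : Type*} [AddCommGroup G] [DecidableEq G] (ψ : S →+ G) :
    GradedAlgebra (gradeBy α ψ) where
  one_mem := by
    have := X_mem_gradeBy (α := α) ψ 0
    rwa [map_zero] at this
  mul_mem {i j a b} ha hb := by
    induction ha using Submodule.span_induction with
    | zero =>
      rw [zero_mul]
      exact zero_mem _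
    | add x y _ _ hx hy =>
      rw [add_mul]
      exact add_mem hx hy
    | smul r x _ hx =>
      rw [smul_mul_assoc]
      exact Submodule.smul_mem _ _ hx
    | mem x hx =>
      obtain ⟨s, rfl, rfl⟩ := hx
      induction hb using Submodule.span_induction with
      | zero =>
        rw [mul_zero]
        exact zero_mem _
      | add x y _ _ hx hy =>
        rw [mul_add]
        exact add_mem hx hy
      | smul r x _ hx =>
        rw [mul_smul_comm]
        exact Submodule.smul_mem _ _ hx
      | mem x hx =>
        obtain ⟨t, rfl, rfl⟩ := hx
        rw [mul_def, mulLin_X, ← map_add]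
        exact Submodule.smul_mem _ _ (X_mem_gradeBy ψ _)
  decompose' := decomposeLin ψ
  left_inv x := by
    have : (DirectSum.coeLinearMap (gradeBy α ψ)) ∘ₗ decomposeLin ψ = LinearMap.id :=
      hom_ext fun s => by
        rw [LinearMap.comp_apply, decomposeLin_X, DirectSum.coeLinearMap_lof]
        rfl
    exact LinearMap.congr_fun this x
  right_inv x := by
    have : decomposeLin ψ ∘ₗ (DirectSum.coeLinearMap (gradeBy α ψ)) = LinearMap.id := by
      refine DirectSum.linearMap_ext k fun g => LinearMap.ext ?_
      rintro ⟨x, hx⟩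
      rw [LinearMap.comp_apply, LinearMap.comp_apply, DirectSum.coeLinearMap_lof,
        LinearMap.id_comp]
      induction hx using Submodule.span_induction with
      | zero =>
        exact (map_zero _).trans (map_zero _).symm
      | add x y hx hy h1 h2 =>
        refine (map_add _ _ _).trans ?_
        rw [h1, h2, ← map_add]
        rfl
      | smul r x hx h1 =>
        refine (map_smul _ _ _).trans ?_
        rw [h1, ← map_smul]
        rfl
      | mem x hx =>
        obtain ⟨s, rfl, rfl⟩ := hx
        exact decomposeLin_X ψ s
    exact LinearMap.congr_fun this x

end TwistedSemigroupAlgebra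

/-- The morphism `ℤ^{n+1} → ℤ`, `(a_0, …, a_n) ↦ a_0 + ⋯ + a_n`. -/
def totalDegree (n : ℕ) : (Fin (n + 1) → ℤ) →+ ℤ where
  toFun a := ∑ i, a i
  map_zero' := by simp
  map_add' a b := by simp [Finset.sum_add_distrib]

end Twisted

end

/-! For the fine grading by `ι` the two algebras have equivalent categories of graded modules. As
`ι` is injective, the cocycle becomes a coboundary once `S` is allowed to act on the whole degree
group: there are scalars with `c s (ψ t + g) * c t g = α s t * c (s + t) g`
(`exists_trivialization`). Multiplying the action of X^s on degree g by `c s g` turns graded modules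
over one algebra into graded modules over the other, and the inverse scalars lead back
(`TwistEquiv`). This generalised Zhang twist keeps the underlying graded spaces, the maps of degree
zero, injectives, projectives and torsion, and it matches the shifts of the trivial modules and of
the algebras themselves. Hence the vanishing of local cohomology, the dimensions of Ext^i(k, A[g])
and the projective dimension of k agree on both sides.

The scalars depend on the fine degree, so the grading by total degree is compared with the fine
grading over the same algebra. Leading exponents and Dickson's lemma show that the algebras are
Noetherian (`TwistedBasis.isNoetherianRing`). Therefore k and A/𝔪^n have resolutions by finitely
generated free modules, on which every linear map is a finite sum of homogeneous ones. Total Ext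
thus does not see the grading (`isGorensteinExt_regrade_iff`), and local cohomology is compared
through Ext^i(A/𝔪^n, -) (`localCohomologyVanishes_regrade_iff`).

Injective and global dimension are reduced to the trivial module by a theorem of Bass type
(`isExtSmall_of_finite`): if N is bounded below and Ext^i(k[g], N) vanishes for all i > d and all g,
then so does Ext^i(M, N) for every finitely generated M. Each X^s commutes with the other basis
elements up to a character of `S`, so multiplication by it is a morphism into a twisted shift, and
Noetherian induction on quotients applies; boundedness below plays the role of Nakayama's lemma.

The homological algebra is done by hand. Maps between two augmented resolutions form a double
complex (`homGrid`), and zigzags along its antidiagonals (`ExactGrid.exists_link`) give both the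
balance of Ext and its independence of resolutions. -/

set_option linter.unusedSectionVars false
set_option linter.style.haveILetI false
set_option linter.unusedVariables false

noncomputable section

/-! ### Homogeneous components, and graded submodules, quotients, products and shifts. -/

section Components

variable {G : Type u} [AddCommGroup G] [DecidableEq G]
variable {k : Type v} [Field k] {A : Type w} [Ring A] [Algebra k A]

namespace GrMod

variable {𝒜 : G → Submodule k A}

instance instModuleBase (M : GrMod 𝒜) : Module k M := Module.compHom M.carrier (algebraMap k A)

theorem base_smul_def (M : GrMod 𝒜) (c : k) (m : M) : c • m = algebraMap k A c • m := rfl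

instance instIsScalarTowerBase (M : GrMod 𝒜) : IsScalarTower k A M :=
  ⟨fun c a m => by rw [base_smul_def, Algebra.smul_def, mul_smul]⟩

instance instSMulCommClassBase (M : GrMod 𝒜) : SMulCommClass A k M :=
  ⟨fun a c m => by rw [base_smul_def, base_smul_def, ← mul_smul, ← mul_smul, Algebra.commutes]⟩

/-- The homogeneous component of degree `g` of an element of a graded module. -/
def component (M : GrMod 𝒜) (g : G) : M →+ M :=
  letI := M.isInternal.chooseDecomposition
  { toFun := fun m => (DirectSum.decompose M.deg m g : M)
    map_zero' := by simp
    map_add' := fun x y => by simp }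

variable (M N : GrMod 𝒜)

theorem component_mem (g : G) (m : M) : M.component g m ∈ M.deg g :=
  letI := M.isInternal.chooseDecomposition
  (DirectSum.decompose M.deg m g).2

variable {M N}

theorem component_of_mem {g : G} {m : M} (hm : m ∈ M.deg g) : M.component g m = m :=
  letI := M.isInternal.chooseDecomposition
  DirectSum.decompose_of_mem_same M.deg hm

theorem component_of_mem_ne {g h : G} (hgh : g ≠ h) {m : M} (hm : m ∈ M.deg g) :
    M.component h m = 0 :=
  letI := M.isInternal.chooseDecomposition
  DirectSum.decompose_of_mem_ne M.deg hm hgh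

theorem component_of_mem_eq_ite {g h : G} {m : M} (hm : m ∈ M.deg g) :
    M.component h m = if g = h then m else 0 := by
  split_ifs with hgh
  · subst hgh
    exact component_of_mem hm
  · exact component_of_mem_ne hgh hm

@[elab_as_elim]
theorem homogeneous_induction {motive : M → Prop} (zero : motive 0)
    (homogeneous : ∀ g, ∀ m ∈ M.deg g, motive m)
    (add : ∀ m m', motive m → motive m' → motive (m + m')) (m : M) : motive m :=
  letI := M.isInternal.chooseDecomposition
  DirectSum.Decomposition.inductionOn M.deg zero (fun m => homogeneous _ _ m.2) add m

theorem finite_component_support (m : M) : {g | M.component g m ≠ 0}.Finite := by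
  induction m using homogeneous_induction with
  | zero => simp
  | homogeneous g m hm =>
    refine (Set.finite_singleton g).subset fun h hh => ?_
    by_contra hne
    exact hh (component_of_mem_ne (fun e => hne e.symm) hm)
  | add m m' h h' =>
    refine (h.union h').subset fun g hg => ?_
    by_contra hne
    simp only [Set.mem_union, Set.mem_ofPred_eq, not_or, not_not] at hne
    exact hg (by rw [map_add, hne.1, hne.2, add_zero])

theorem sum_component (m : M) (s : Finset G) (hs : ∀ g, M.component g m ≠ 0 → g ∈ s) :
    ∑ g ∈ s, M.component g m = m := by
  have key : ∀ m : M, ∑ᶠ g, M.component g m = m := by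
    intro m
    induction m using homogeneous_induction with
    | zero => simp
    | homogeneous g m hm =>
      rw [finsum_eq_single _ g fun h hh => component_of_mem_ne hh.symm hm, component_of_mem hm]
    | add m m' h h' =>
      simp only [map_add]
      rw [finsum_add_distrib (finite_component_support m) (finite_component_support m'), h, h']
  rw [← finsum_eq_sum_of_support_subset _ (s := s) (fun g hg => hs g hg), key]

theorem component_ext {m m' : M} (h : ∀ g, M.component g m = M.component g m') : m = m' := by
  -- All components of `m - m'` vanish, so even the empty set contains its support.
  have := sum_component (m - m') ∅ fun g hg => (hg (by rw [map_sub, h, sub_self])).elim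
  rw [Finset.sum_empty] at this
  exact (sub_eq_zero.1 this.symm)

theorem component_smul {g : G} {a : A} (ha : a ∈ 𝒜 g) (h : G) (m : M) :
    M.component (g + h) (a • m) = a • M.component h m := by
  induction m using homogeneous_induction with
  | zero => simp
  | homogeneous h' m hm =>
    rw [component_of_mem_eq_ite (M.smul_mem ha hm), component_of_mem_eq_ite hm]
    simp only [add_right_inj]
    split_ifs <;> simp
  | add m m' h h' => simp only [map_add, smul_add, h, h']

theorem component_smul' {g : G} {a : A} (ha : a ∈ 𝒜 g) (h : G) (m : M) :
    M.component h (a • m) = a • M.component (h - g) m := by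
  rw [← component_smul ha, add_sub_cancel]

theorem component_base_smul [GradedAlgebra 𝒜] (g : G) (c : k) (m : M) :
    M.component g (c • m) = c • M.component g m := by
  have := component_smul (M := M) (SetLike.algebraMap_mem_graded 𝒜 c) g m
  rwa [zero_add] at this

theorem base_smul_mem [GradedAlgebra 𝒜] {g : G} (c : k) {m : M} (hm : m ∈ M.deg g) :
    c • m ∈ M.deg g := by
  have := M.smul_mem (SetLike.algebraMap_mem_graded 𝒜 c) hm
  rwa [zero_add] at this

/-- The homogeneous component of degree `g`, as a linear map over the base field. -/
def componentLin [GradedAlgebra 𝒜] (M : GrMod 𝒜) (g : G) : M →ₗ[k] M :=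
  { M.component g with map_smul' := fun c m => component_base_smul g c m }

theorem IsHom.component {f : M →ₗ[A] N} (hf : IsHom f) (g : G) (m : M) :
    N.component g (f m) = f (M.component g m) := by
  induction m using homogeneous_induction with
  | zero => simp
  | homogeneous h m hm =>
    rw [component_of_mem_eq_ite (hf h m hm), component_of_mem_eq_ite hm]
    split_ifs <;> simp
  | add m m' h h' => simp only [map_add, h, h']

theorem isHom_iff_component {f : M →ₗ[A] N} :
    IsHom f ↔ ∀ g m, N.component g (f m) = f (M.component g m) := by
  refine ⟨fun hf => hf.component, fun H g m hm => ?_⟩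
  have := H g m
  rw [component_of_mem hm] at this
  rw [← this]
  exact component_mem _ _ _

theorem IsHom.id : IsHom (LinearMap.id : M →ₗ[A] M) := fun _ _ hm => hm

theorem IsHom.zero : IsHom (0 : M →ₗ[A] N) := fun _ _ _ => zero_mem _

theorem IsHom.comp {P : GrMod 𝒜} {g : N →ₗ[A] P} {f : M →ₗ[A] N} (hg : IsHom g) (hf : IsHom f) :
    IsHom (g ∘ₗ f) := fun h m hm => hg h _ (hf h m hm)

theorem IsHom.add {f g : M →ₗ[A] N} (hf : IsHom f) (hg : IsHom g) : IsHom (f + g) :=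
  fun h m hm => add_mem (hf h m hm) (hg h m hm)

theorem IsHom.sub {f g : M →ₗ[A] N} (hf : IsHom f) (hg : IsHom g) : IsHom (f - g) :=
  fun h m hm => sub_mem (hf h m hm) (hg h m hm)

theorem IsHom.smul [GradedAlgebra 𝒜] (c : k) {f : M →ₗ[A] N} (hf : IsHom f) : IsHom (c • f) :=
  fun h m hm => base_smul_mem c (hf h m hm)

/-- The maps `π g` read off the coordinates of a sum of homogeneous elements, which gives
uniqueness; spanning gives existence. The gradings on submodules, quotients, products, free,
coinduced and regraded modules are all checked in this way. -/
theorem isInternal_of_projections {W : Type*} [AddCommGroup W] {D : G → AddSubgroup W}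
    (π : G → W →+ W) (hπ : ∀ g h, ∀ w ∈ D g, π h w = if g = h then w else 0)
    (top : ∀ w, w ∈ ⨆ g, D g) : DirectSum.IsInternal D := by
  have key : ∀ (x : ⨁ g, D g) (g : G), π g (DirectSum.coeAddMonoidHom D x) = x g := by
    intro x g
    induction x using DirectSum.induction_on with
    | zero => simp
    | of h x =>
      rw [DirectSum.coeAddMonoidHom_of, hπ h g _ x.2, DirectSum.coe_of_apply]
      split_ifs <;> rfl
    | add x y hx hy => simp only [map_add, hx, hy, DirectSum.add_apply, AddSubgroup.coe_add]
  constructor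
  · intro x y hxy
    ext g
    rw [← key, ← key, hxy]
  · intro w
    refine AddSubgroup.iSup_induction D (C := fun w => ∃ x, DirectSum.coeAddMonoidHom D x = w)
      (top w) (fun g w hw => ⟨DirectSum.of _ g ⟨w, hw⟩, DirectSum.coeAddMonoidHom_of _ _ _⟩)
      ⟨0, map_zero _⟩ ?_
    rintro _ _ ⟨x, rfl⟩ ⟨y, rfl⟩
    exact ⟨x + y, map_add _ _ _⟩

/-- A homogeneous submodule, as a graded module. -/
def IsHomogeneous (U : Submodule A M) : Prop := ∀ u ∈ U, ∀ g, M.component g u ∈ U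

theorem mem_iSup_of_forall {W : Type*} [AddCommGroup W] {D : G → AddSubgroup W} {w : W}
    (s : Finset G) (f : G → W) (hf : ∀ g, f g ∈ D g) (hw : ∑ g ∈ s, f g = w) : w ∈ ⨆ g, D g := by
  rw [← hw]
  exact sum_mem fun g _ => AddSubgroup.mem_iSup_of_mem g (hf g)

/-- The graded submodule given by a homogeneous submodule. -/
def sub (M : GrMod 𝒜) (U : Submodule A M) (hU : IsHomogeneous U) : GrMod 𝒜 where
  carrier := U
  deg g := (M.deg g).comap U.subtype.toAddMonoidHom
  isInternal := by
    refine isInternal_of_projections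
      (fun g => ((M.component g).comp U.subtype.toAddMonoidHom).codRestrict U.toAddSubgroup
        fun u => hU u u.2 g) ?_ ?_
    · intro g h w hw
      refine Subtype.ext ?_
      refine (component_of_mem_eq_ite (h := h) (show (w : M) ∈ M.deg g from hw)).trans ?_
      split_ifs <;> rfl
    · intro w
      refine mem_iSup_of_forall (finite_component_support (w : M)).toFinset
        (fun g => ⟨M.component g w, hU w w.2 g⟩) (fun g => component_mem M g _) ?_
      refine Subtype.ext ?_
      rw [AddSubmonoidClass.coe_finsetSum]
      exact sum_component (w : M) _ fun g hg => by simpa using hg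
  smul_mem ha hm := M.smul_mem ha hm

/-- The inclusion of a graded submodule. -/
def subι (M : GrMod 𝒜) (U : Submodule A M) (hU : IsHomogeneous U) : M.sub U hU →ₗ[A] M :=
  U.subtype

theorem subι_isHom {U : Submodule A M} (hU : IsHomogeneous U) : IsHom (M.subι U hU) :=
  fun _ _ hm => hm

theorem subι_injective {U : Submodule A M} (hU : IsHomogeneous U) :
    Function.Injective (M.subι U hU) := Subtype.coe_injective

/-- The graded quotient by a homogeneous submodule. -/
def quot (M : GrMod 𝒜) (U : Submodule A M) (hU : IsHomogeneous U) : GrMod 𝒜 where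
  carrier := M ⧸ U
  deg g := (M.deg g).map U.mkQ.toAddMonoidHom
  isInternal := by
    refine isInternal_of_projections
      (fun g => QuotientAddGroup.map U.toAddSubgroup U.toAddSubgroup (M.component g)
        fun u hu => hU u hu g) ?_ ?_
    · rintro g h _ ⟨w, hw, rfl⟩
      refine (congrArg U.mkQ (component_of_mem_eq_ite (h := h) hw)).trans ?_
      split_ifs
      · rfl
      · exact map_zero _
    · intro w
      obtain ⟨w, rfl⟩ := U.mkQ_surjective w
      refine mem_iSup_of_forall (finite_component_support w).toFinset
        (fun g => U.mkQ (M.component g w)) (fun g => ⟨_, component_mem M g _, rfl⟩) ?_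
      rw [← map_sum]
      exact congrArg _ (sum_component w _ fun g hg => by simpa using hg)
  smul_mem := by
    rintro g h a _ ha ⟨m, hm, rfl⟩
    exact ⟨a • m, M.smul_mem ha hm, map_smul U.mkQ a m⟩

/-- The projection to a graded quotient. -/
def quotπ (M : GrMod 𝒜) (U : Submodule A M) (hU : IsHomogeneous U) : M →ₗ[A] M.quot U hU :=
  U.mkQ

theorem quotπ_isHom {U : Submodule A M} (hU : IsHomogeneous U) : IsHom (M.quotπ U hU) :=
  fun _ _ hm => ⟨_, hm, rfl⟩

theorem quotπ_surjective {U : Submodule A M} (hU : IsHomogeneous U) :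
    Function.Surjective (M.quotπ U hU) := U.mkQ_surjective

theorem quotπ_eq_zero {U : Submodule A M} (hU : IsHomogeneous U) {m : M} :
    M.quotπ U hU m = 0 ↔ m ∈ U := Submodule.Quotient.mk_eq_zero U

theorem IsHom.ker_isHomogeneous {f : M →ₗ[A] N} (hf : IsHom f) :
    IsHomogeneous (LinearMap.ker f) := fun m hm g => by
  rw [LinearMap.mem_ker, ← hf.component, LinearMap.mem_ker.1 hm, map_zero]

theorem IsHom.range_isHomogeneous {f : M →ₗ[A] N} (hf : IsHom f) :
    IsHomogeneous (LinearMap.range f) := by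
  rintro _ ⟨m, rfl⟩ g
  exact ⟨M.component g m, (hf.component g m).symm⟩

theorem IsHomogeneous.sup {U V : Submodule A M} (hU : IsHomogeneous U) (hV : IsHomogeneous V) :
    IsHomogeneous (U ⊔ V) := by
  intro m hm g
  obtain ⟨u, hu, v, hv, rfl⟩ := Submodule.mem_sup.1 hm
  rw [map_add]
  exact Submodule.add_mem_sup (hU u hu g) (hV v hv g)

/-- The degree `g` is generalized in the induction because a homogeneous scalar moves components
from one degree to another. -/
theorem isHomogeneous_span {T : Set M} (hT : ∀ t ∈ T, ∃ g, t ∈ M.deg g) [GradedAlgebra 𝒜] :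
    IsHomogeneous (Submodule.span A T) := by
  intro m hm g
  induction hm using Submodule.span_induction generalizing g with
  | mem t ht =>
    obtain ⟨h, hh⟩ := hT t ht
    rw [component_of_mem_eq_ite hh]
    split_ifs
    · exact Submodule.subset_span ht
    · exact zero_mem _
  | zero => simp
  | add x y _ _ hx hy =>
    rw [map_add]
    exact add_mem (hx g) (hy g)
  | smul a x _ hx =>
    induction a using DirectSum.Decomposition.inductionOn 𝒜 with
    | zero => simp
    | homogeneous a =>
      rw [component_smul' a.2]
      exact Submodule.smul_mem _ _ (hx _)
    | add a b ha hb =>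
      rw [add_smul, map_add]
      exact add_mem ha hb

/-- The product of two graded modules. -/
def prod (M N : GrMod 𝒜) : GrMod 𝒜 where
  carrier := M × N
  deg g := (M.deg g).prod (N.deg g)
  isInternal := by
    refine isInternal_of_projections (fun g => (M.component g).prodMap (N.component g)) ?_ ?_
    · rintro g h ⟨x, y⟩ ⟨hx, hy⟩
      refine (congrArg₂ Prod.mk (component_of_mem_eq_ite (h := h) hx)
        (component_of_mem_eq_ite (h := h) hy)).trans ?_
      split_ifs <;> rfl
    · rintro ⟨x, y⟩
      let s := (finite_component_support x).toFinset ∪ (finite_component_support y).toFinset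
      refine mem_iSup_of_forall s (fun g => (M.component g x, N.component g y))
        (fun g => ⟨component_mem M g _, component_mem N g _⟩) ?_
      refine Prod.ext (Prod.fst_sum.trans (sum_component x _ fun g hg => ?_))
        (Prod.snd_sum.trans (sum_component y _ fun g hg => ?_))
      · exact Finset.mem_union_left _ (by simpa using hg)
      · exact Finset.mem_union_right _ (by simpa using hg)
  smul_mem ha hm := ⟨M.smul_mem ha hm.1, N.smul_mem ha hm.2⟩

theorem mem_shift_deg {l h : G} {m : M} : m ∈ (M.shift l).deg h ↔ m ∈ M.deg (h + l) := Iff.rfl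

theorem shift_isHom {f : M →ₗ[A] N} (hf : IsHom f) (l : G) :
    IsHom (M := M.shift l) (N := N.shift l) f := fun h m hm => hf (h + l) m hm

theorem component_shift (l g : G) (m : M) : (M.shift l).component g m = M.component (g + l) m := by
  induction m using homogeneous_induction with
  | zero => exact (map_zero _).trans (map_zero _).symm
  | homogeneous h m hm =>
    have : m ∈ (M.shift l).deg (h - l) := by rwa [mem_shift_deg, sub_add_cancel]
    rw [component_of_mem_eq_ite hm]
    refine (component_of_mem_eq_ite this).trans ?_
    simp only [sub_eq_iff_eq_add]
    rfl
  | add m m' h h' =>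
    refine (map_add _ _ _).trans ?_
    rw [map_add, h, h']
    rfl

end GrMod

end Components

section Resolutions

variable {G : Type u} [AddCommGroup G] [DecidableEq G]
variable {k : Type v} [Field k] {A : Type w} [Ring A] [Algebra k A]
variable {𝒜 : G → Submodule k A} [GradedAlgebra 𝒜]

namespace GrMod

/-! ### Free modules and projective resolutions -/

variable (𝒜) in
/-- The graded free module on generators `i : I` in degrees `d i`. -/
def free (I : Type w) (d : I → G) : GrMod 𝒜 where
  carrier := I →₀ A
  deg g := { carrier := {f | ∀ i, f i ∈ 𝒜 (g - d i)}
             zero_mem' := fun i => zero_mem _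
             add_mem' := fun hf hg i => add_mem (hf i) (hg i)
             neg_mem' := fun hf i => neg_mem (hf i) }
  isInternal := by
    refine isInternal_of_projections
      (fun g => { toFun := fun f => Finsupp.onFinset f.support
                      (fun i => (selfModule 𝒜).component (g - d i) (f i)) fun i hi => by
                        rw [Finsupp.mem_support_iff]
                        rintro h
                        exact hi ((congrArg _ h).trans (map_zero ((selfModule 𝒜).component (g - d i))))
                  map_zero' := by
                    ext i
                    exact map_zero ((selfModule 𝒜).component (g - d i))
                  map_add' := fun f f' => by
                    ext i
                    exact map_add ((selfModule 𝒜).component (g - d i)) (f i) (f' i) }) ?_ ?_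
    · intro g h f hf
      ext i
      by_cases hgh : g = h
      · subst hgh
        rw [if_pos rfl]
        exact component_of_mem (M := selfModule 𝒜) (hf i)
      · rw [if_neg hgh]
        exact component_of_mem_ne (M := selfModule 𝒜) (fun e => hgh (sub_left_inj.1 e)) (hf i)
    · intro f
      induction f using Finsupp.induction_linear with
      | zero => exact zero_mem _
      | add f f' hf hf' => exact add_mem hf hf'
      | single i a =>
        induction a using DirectSum.Decomposition.inductionOn 𝒜 with
        | zero =>
          rw [Finsupp.single_zero]
          exact zero_mem _
        | @homogeneous g a =>
          refine AddSubgroup.mem_iSup_of_mem (g + d i) fun j => ?_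
          classical
          rw [Finsupp.single_apply]
          split_ifs with hij
          · subst hij
            rw [add_sub_cancel_right]
            exact a.2
          · exact zero_mem _
        | add a b ha hb =>
          rw [Finsupp.single_add]
          exact add_mem ha hb
  smul_mem ha hm i := by
    rw [add_sub_assoc]
    exact SetLike.GradedMul.mul_mem ha (hm i)

/-- The basis elements of a graded free module. -/
def freeBasis {I : Type w} (d : I → G) (i : I) : free 𝒜 I d := (Finsupp.single i 1 : I →₀ A)

theorem freeBasis_mem {I : Type w} (d : I → G) (i : I) : freeBasis (𝒜 := 𝒜) d i ∈ (free 𝒜 I d).deg (d i) := by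
  intro j
  classical
  change (Finsupp.single i 1 : I →₀ A) j ∈ _
  rw [Finsupp.single_apply]
  split_ifs with hij
  · subst hij
    rw [sub_self]
    exact SetLike.GradedOne.one_mem
  · exact zero_mem _

/-- The graded map from a free module given by the images of the basis elements. -/
def freeLift {I : Type w} (d : I → G) {M : GrMod 𝒜} (m : I → M) : free 𝒜 I d →ₗ[A] M :=
  (Finsupp.linearCombination A m : (I →₀ A) →ₗ[A] M)

theorem freeLift_freeBasis {I : Type w} (d : I → G) {M : GrMod 𝒜} (m : I → M) (i : I) :
    freeLift d m (freeBasis d i) = m i := by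
  refine (Finsupp.linearCombination_single A (1 : A) i).trans (one_smul _ _)

theorem free_hom_ext {I : Type w} {d : I → G} {N : Type*} [AddCommGroup N] [Module A N]
    {f f' : free 𝒜 I d →ₗ[A] N} (h : ∀ i, f (freeBasis d i) = f' (freeBasis d i)) : f = f' :=
  Finsupp.lhom_ext' fun i => LinearMap.ext_ring (h i)

theorem freeLift_isHom {I : Type w} (d : I → G) {M : GrMod 𝒜} (m : I → M)
    (hm : ∀ i, m i ∈ M.deg (d i)) : IsHom (freeLift (𝒜 := 𝒜) d m) := by
  intro g f hf
  refine sum_mem fun i _ => ?_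
  have := M.smul_mem (hf i) (hm i)
  rwa [sub_add_cancel] at this

theorem free_isProjective (I : Type w) (d : I → G) : (free 𝒜 I d).IsProjective := by
  intro X Y p f hp hf hsurj
  have : ∀ i, ∃ x ∈ X.deg (d i), p x = f (freeBasis d i) := by
    intro i
    obtain ⟨x, hx⟩ := hsurj (f (freeBasis d i))
    refine ⟨X.component (d i) x, component_mem _ _ _, ?_⟩
    rw [← hp.component, hx, component_of_mem (hf _ _ (freeBasis_mem d i))]
  choose x hx hpx using this
  refine ⟨freeLift d x, freeLift_isHom d x hx, free_hom_ext fun i => ?_⟩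
  rw [LinearMap.comp_apply, freeLift_freeBasis, hpx]

theorem free_finite (I : Type w) [Finite I] (d : I → G) : Module.Finite A (free 𝒜 I d) :=
  inferInstanceAs (Module.Finite A (I →₀ A))

/-- In the finite case each generator is replaced by its finitely many nonzero components.
Finiteness is an implication inside the statement so that one choice of generators, and hence one
chosen resolution, serves arbitrary and finitely generated modules alike. -/
theorem exists_homogeneous_generators (M : GrMod 𝒜) :
    ∃ T : Set M, (∀ t ∈ T, ∃ g, t ∈ M.deg g) ∧ Submodule.span A T = ⊤ ∧
      (Module.Finite A M → T.Finite) := by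
  by_cases hM : Module.Finite A M
  · obtain ⟨s, hs⟩ := hM.fg_top
    let T : Set M := ⋃ m ∈ s, (fun g => M.component g m) '' {g | M.component g m ≠ 0}
    refine ⟨T, ?_, ?_, fun _ => ?_⟩
    · intro t ht
      simp only [T, Set.mem_iUnion, Set.mem_image] at ht
      obtain ⟨m, -, g, -, rfl⟩ := ht
      exact ⟨g, component_mem _ _ _⟩
    · rw [eq_top_iff, ← hs, Submodule.span_le]
      intro m hm
      rw [← sum_component m (finite_component_support m).toFinset fun g hg => by simpa using hg]
      refine sum_mem fun g hg => Submodule.subset_span ?_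
      simp only [T, Set.mem_iUnion, Set.mem_image]
      exact ⟨m, hm, g, by simpa using hg, rfl⟩
    · exact Set.Finite.biUnion s.finite_toSet fun m _ => (finite_component_support m).image _
  · refine ⟨{m | ∃ g, m ∈ M.deg g}, fun t ht => ht, ?_, fun h => (hM h).elim⟩
    rw [Submodule.eq_top_iff']
    intro m
    induction m using homogeneous_induction with
    | zero => exact zero_mem _
    | homogeneous g m hm => exact Submodule.subset_span ⟨g, hm⟩
    | add m m' h h' => exact add_mem h h'

theorem exists_cover (M : GrMod 𝒜) : ∃ (I : Type w) (d : I → G) (p : free 𝒜 I d →ₗ[A] M),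
    IsHom p ∧ Function.Surjective p ∧ (Module.Finite A M → Finite I) := by
  obtain ⟨T, hT, hspan, hfin⟩ := exists_homogeneous_generators M
  choose! d hd using hT
  refine ⟨T, fun t => d t, freeLift _ fun t => (t : M), freeLift_isHom _ _ fun t => hd t t.2, ?_,
    fun h => (hfin h).to_subtype⟩
  rw [← LinearMap.range_eq_top, eq_top_iff, ← hspan, Submodule.span_le]
  intro t ht
  exact ⟨freeBasis _ ⟨t, ht⟩, freeLift_freeBasis _ _ _⟩

/-- The index set of a chosen free cover. -/
def CoverIndex (M : GrMod 𝒜) : Type w := (exists_cover M).choose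

/-- A chosen free cover. -/
def cover (M : GrMod 𝒜) : GrMod 𝒜 := free 𝒜 M.CoverIndex (exists_cover M).choose_spec.choose

/-- The projection of a chosen free cover. -/
def coverπ (M : GrMod 𝒜) : M.cover →ₗ[A] M := (exists_cover M).choose_spec.choose_spec.choose

theorem coverπ_spec (M : GrMod 𝒜) : IsHom M.coverπ ∧ Function.Surjective M.coverπ ∧
    (Module.Finite A M → Finite M.CoverIndex) :=
  (exists_cover M).choose_spec.choose_spec.choose_spec

theorem cover_isProjective (M : GrMod 𝒜) : M.cover.IsProjective := free_isProjective _ _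

theorem cover_finite (M : GrMod 𝒜) [h : Module.Finite A M] : Module.Finite A M.cover :=
  have := (coverπ_spec M).2.2 h
  free_finite _ _

/-- The kernel of the chosen free cover. -/
def syzygy (M : GrMod 𝒜) : GrMod 𝒜 :=
  M.cover.sub (LinearMap.ker M.coverπ) (coverπ_spec M).1.ker_isHomogeneous

/-- The inclusion of the syzygy module. -/
def syzygyι (M : GrMod 𝒜) : M.syzygy →ₗ[A] M.cover := M.cover.subι _ _

theorem syzygyι_isHom (M : GrMod 𝒜) : IsHom M.syzygyι := subι_isHom _

theorem syzygyι_injective (M : GrMod 𝒜) : Function.Injective M.syzygyι := subι_injective _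

theorem exact_syzygy (M : GrMod 𝒜) : Function.Exact M.syzygyι M.coverπ :=
  fun x => ⟨fun hx => ⟨⟨x, hx⟩, rfl⟩, by rintro ⟨y, rfl⟩; exact y.2⟩

theorem syzygy_finite [IsNoetherianRing A] (M : GrMod 𝒜) [Module.Finite A M] :
    Module.Finite A M.syzygy := by
  have := cover_finite M
  have : IsNoetherian A M.cover := isNoetherian_of_isNoetherianRing_of_finite A _
  exact inferInstanceAs (Module.Finite A (LinearMap.ker M.coverπ))

/-- Iterated syzygies. -/
def syzygies (M : GrMod 𝒜) : ℕ → GrMod 𝒜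
  | 0 => M
  | n + 1 => (syzygies M n).syzygy

theorem syzygies_finite [IsNoetherianRing A] (M : GrMod 𝒜) [Module.Finite A M] :
    ∀ n, Module.Finite A (M.syzygies n)
  | 0 => ‹_›
  | n + 1 => by
    have := syzygies_finite M n
    exact syzygy_finite _

theorem exact_cover_zero (M : GrMod 𝒜) :
    Function.Exact (M.syzygyι ∘ₗ M.syzygy.coverπ) M.coverπ := by
  intro x
  rw [exact_syzygy M x]
  constructor
  · rintro ⟨y, rfl⟩
    obtain ⟨z, rfl⟩ := (coverπ_spec M.syzygy).2.1 y
    exact ⟨z, rfl⟩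
  · rintro ⟨z, rfl⟩
    exact ⟨_, rfl⟩

/-- Composing with the injective `syzygyι` does not change the kernel, so this is `exact_cover_zero`
for the syzygy. -/
theorem exact_cover_succ (M : GrMod 𝒜) :
    Function.Exact (M.syzygy.syzygyι ∘ₗ M.syzygy.syzygy.coverπ)
      (M.syzygyι ∘ₗ M.syzygy.coverπ) := by
  intro x
  rw [LinearMap.comp_apply, map_eq_zero_iff _ (syzygyι_injective _)]
  exact exact_cover_zero M.syzygy x

/-- A chosen graded free resolution. -/
def projRes (M : GrMod 𝒜) : ProjRes M where
  P n := (M.syzygies n).cover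
  projective _ := cover_isProjective _
  ε := M.coverπ
  d n := (M.syzygies n).syzygyι ∘ₗ (M.syzygies n).syzygy.coverπ
  ε_hom := (coverπ_spec M).1
  d_hom n := (syzygyι_isHom _).comp (coverπ_spec _).1
  ε_surjective := (coverπ_spec M).2.1
  exact_zero := exact_cover_zero M
  exact_succ n := exact_cover_succ (M.syzygies n)

theorem projRes_finite [IsNoetherianRing A] (M : GrMod 𝒜) [Module.Finite A M] (n : ℕ) :
    Module.Finite A (M.projRes.P n) := by
  have := syzygies_finite M n
  exact cover_finite _

/-! ### Coinduced modules and injective resolutions -/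

/-- The `k`-linear maps `A → M`, with `A` acting through right multiplication on the source. -/
def Coind (M : GrMod 𝒜) : Type w := A →ₗ[k] M

namespace Coind

variable (M : GrMod 𝒜)

instance : AddCommGroup (Coind M) := inferInstanceAs (AddCommGroup (A →ₗ[k] M))

instance : FunLike (Coind M) A M := inferInstanceAs (FunLike (A →ₗ[k] M) A M)

instance : LinearMapClass (Coind M) k A M := inferInstanceAs (LinearMapClass (A →ₗ[k] M) k A M)

instance : Module A (Coind M) where
  smul a f := (f : A →ₗ[k] M) ∘ₗ LinearMap.mulRight k a
  one_smul f := LinearMap.ext fun b => congrArg f (mul_one b)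
  mul_smul a a' f := LinearMap.ext fun b => congrArg f (mul_assoc b a a').symm
  smul_zero a := rfl
  smul_add a f f' := rfl
  zero_smul f := LinearMap.ext fun b => (congrArg f (mul_zero b)).trans (map_zero f)
  add_smul a a' f := LinearMap.ext fun b => (congrArg f (mul_add b a a')).trans (map_add f _ _)

variable {M}

theorem smul_apply (a : A) (f : Coind M) (b : A) : (a • f) b = f (b * a) := rfl

theorem ext {f f' : Coind M} (h : ∀ a, f a = f' a) : f = f' := LinearMap.ext h

theorem ext_homogeneous {f f' : Coind M} (h : ∀ g, ∀ a ∈ 𝒜 g, f a = f' a) : f = f' := by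
  refine ext fun a => ?_
  induction a using DirectSum.Decomposition.inductionOn 𝒜 with
  | zero => rw [map_zero, map_zero]
  | homogeneous a => exact h _ _ a.2
  | add a b ha hb => rw [map_add, map_add, ha, hb]

/-- The homogeneous elements of degree `g`. -/
def deg (M : GrMod 𝒜) (g : G) : AddSubgroup (Coind M) where
  carrier := {f | ∀ h, ∀ a ∈ 𝒜 h, f a ∈ M.deg (h + g)}
  zero_mem' _ _ _ := zero_mem _
  add_mem' hf hf' h a ha := add_mem (hf h a ha) (hf' h a ha)
  neg_mem' hf h a ha := neg_mem (hf h a ha)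

theorem smul_mem_deg {g h : G} {a : A} (ha : a ∈ 𝒜 g) {f : Coind M} (hf : f ∈ deg M h) :
    a • f ∈ deg M (g + h) := fun i b hb => by
  rw [smul_apply, ← add_assoc]
  exact hf _ _ (SetLike.GradedMul.mul_mem hb ha)

variable (M) in
/-- The span of the homogeneous elements. -/
def graded : Submodule A (Coind M) where
  __ := (⨆ g, deg M g : AddSubgroup (Coind M))
  smul_mem' a f hf := by
    change f ∈ (⨆ g, deg M g : AddSubgroup (Coind M)) at hf
    change a • f ∈ (⨆ g, deg M g : AddSubgroup (Coind M))
    refine AddSubgroup.iSup_induction (deg M)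
      (C := fun f => a • f ∈ (⨆ g, deg M g : AddSubgroup (Coind M))) hf ?_ ?_ ?_
    · intro h f hf
      induction a using DirectSum.Decomposition.inductionOn 𝒜 with
      | zero =>
        rw [zero_smul]
        exact zero_mem _
      | homogeneous a => exact AddSubgroup.mem_iSup_of_mem _ (smul_mem_deg a.2 hf)
      | add a b ha hb =>
        rw [add_smul]
        exact add_mem ha hb
    · rw [smul_zero]
      exact zero_mem _
    · intro x y hx hy
      rw [smul_add]
      exact add_mem hx hy

/-- The component of degree `g` of an arbitrary linear map. -/
def proj (M : GrMod 𝒜) (g : G) : Coind M →+ Coind M where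
  toFun f := (DirectSum.toModule k G M fun h =>
    (M.componentLin (h + g) ∘ₗ (f : A →ₗ[k] M) ∘ₗ (𝒜 h).subtype)) ∘ₗ
      (DirectSum.decomposeLinearEquiv 𝒜).toLinearMap
  map_zero' := ext_homogeneous fun h a ha => by
    refine (congrArg (DirectSum.toModule k G M _) (DirectSum.decompose_of_mem 𝒜 ha)).trans ?_
    refine (DirectSum.toModule_lof k h _).trans ?_
    exact map_zero (M.componentLin (h + g))
  map_add' f f' := ext_homogeneous fun h a ha => by
    refine (congrArg (DirectSum.toModule k G M _) (DirectSum.decompose_of_mem 𝒜 ha)).trans ?_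
    refine (DirectSum.toModule_lof k h _).trans ?_
    refine (map_add (M.componentLin (h + g)) (f a) (f' a)).trans ?_
    refine (congrArg₂ (· + ·) ?_ ?_)
    · refine Eq.trans ?_ (congrArg (DirectSum.toModule k G M _)
        (DirectSum.decompose_of_mem 𝒜 ha)).symm
      exact (DirectSum.toModule_lof k (φ := fun h =>
        (M.componentLin (h + g) ∘ₗ (f : A →ₗ[k] M) ∘ₗ (𝒜 h).subtype)) h ⟨a, ha⟩).symm
    · refine Eq.trans ?_ (congrArg (DirectSum.toModule k G M _)
        (DirectSum.decompose_of_mem 𝒜 ha)).symm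
      exact (DirectSum.toModule_lof k (φ := fun h =>
        (M.componentLin (h + g) ∘ₗ (f' : A →ₗ[k] M) ∘ₗ (𝒜 h).subtype)) h ⟨a, ha⟩).symm

theorem proj_apply (f : Coind M) (g : G) {h : G} {a : A} (ha : a ∈ 𝒜 h) :
    proj M g f a = M.component (h + g) (f a) := by
  refine (congrArg (DirectSum.toModule k G M _) (DirectSum.decompose_of_mem 𝒜 ha)).trans ?_
  exact DirectSum.toModule_lof k (φ := fun h =>
        (M.componentLin (h + g) ∘ₗ (f : A →ₗ[k] M) ∘ₗ (𝒜 h).subtype)) h ⟨a, ha⟩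

theorem proj_of_mem {f : Coind M} {g : G} (hf : f ∈ deg M g) (h : G) :
    proj M h f = if g = h then f else 0 := by
  refine ext_homogeneous fun i a ha => ?_
  rw [proj_apply f h ha, component_of_mem_eq_ite (hf i a ha)]
  simp only [add_right_inj]
  split_ifs <;> rfl

theorem proj_mem (f : Coind M) (g : G) : proj M g f ∈ deg M g := fun h a ha => by
  rw [proj_apply f g ha]
  exact component_mem _ _ _

theorem proj_mem_graded (f : Coind M) (g : G) : proj M g f ∈ graded M :=
  AddSubgroup.mem_iSup_of_mem g (proj_mem f g)

end Coind

/-- The graded module coinduced from the graded vector space underlying `M`. -/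
def coind (M : GrMod 𝒜) : GrMod 𝒜 where
  carrier := Coind.graded M
  deg g := (Coind.deg M g).comap (Coind.graded M).subtype.toAddMonoidHom
  isInternal := by
    refine isInternal_of_projections
      (fun g => ((Coind.proj M g).comp (Coind.graded M).subtype.toAddMonoidHom).codRestrict
        (Coind.graded M).toAddSubgroup fun f => Coind.proj_mem_graded _ g) ?_ ?_
    · intro g h f hf
      refine Subtype.ext ?_
      refine (Coind.proj_of_mem (h := h) (show (f : Coind M) ∈ Coind.deg M g from hf)).trans ?_
      split_ifs <;> rfl
    · rintro ⟨f, hf⟩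
      let D : G → AddSubgroup (Coind.graded M) := fun g =>
        (Coind.deg M g).comap (Coind.graded M).subtype.toAddMonoidHom
      suffices h : ∃ hf : f ∈ Coind.graded M, (⟨f, hf⟩ : Coind.graded M) ∈ ⨆ g, D g from h.2
      refine AddSubgroup.iSup_induction (Coind.deg M)
        (C := fun f => ∃ hf : f ∈ Coind.graded M, (⟨f, hf⟩ : Coind.graded M) ∈ ⨆ g, D g)
        hf ?_ ?_ ?_
      · intro g f hf
        exact ⟨AddSubgroup.mem_iSup_of_mem g hf, AddSubgroup.mem_iSup_of_mem g hf⟩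
      · exact ⟨zero_mem _, zero_mem _⟩
      · rintro x y ⟨hx, hx'⟩ ⟨hy, hy'⟩
        exact ⟨add_mem hx hy, add_mem hx' hy'⟩
  smul_mem ha hf := Coind.smul_mem_deg ha hf

theorem coind_ext {M : GrMod 𝒜} {f f' : M.coind} (h : ∀ a, f.1 a = f'.1 a) : f = f' :=
  Subtype.ext (Coind.ext h)

/-- The map to all `k`-linear maps `A → M` induced by a `k`-linear map to `M`. -/
def coindLiftAux {M Y : GrMod 𝒜} (e : Y →ₗ[k] M) : Y →+ Coind M where
  toFun y := (show A →ₗ[k] M from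
    { toFun := fun a => e (a • y)
      map_add' := fun a b => by rw [add_smul, map_add]
      map_smul' := fun c a => by rw [smul_assoc, map_smul, RingHom.id_apply] })
  map_zero' := Coind.ext fun a => (congrArg e (smul_zero a)).trans (map_zero e)
  map_add' y y' := Coind.ext fun a => (congrArg e (smul_add a y y')).trans (map_add e _ _)

/-- The maps to a coinduced module given by `k`-linear maps preserving degrees. -/
def coindLift {M Y : GrMod 𝒜} (e : Y →ₗ[k] M) (he : ∀ g, ∀ y ∈ Y.deg g, e y ∈ M.deg g) :
    Y →ₗ[A] M.coind where
  toFun y := ⟨coindLiftAux e y, by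
    induction y using homogeneous_induction with
    | zero =>
      rw [map_zero]
      exact zero_mem _
    | homogeneous g y hy =>
      exact AddSubgroup.mem_iSup_of_mem g fun h a ha => he _ _ (Y.smul_mem ha hy)
    | add y y' h h' =>
      rw [map_add]
      exact add_mem h h'⟩
  map_add' y y' := coind_ext fun a => (congrArg e (smul_add a y y')).trans (map_add e _ _)
  map_smul' b y := coind_ext fun a => congrArg e (mul_smul a b y).symm

theorem coindLift_isHom {M Y : GrMod 𝒜} (e : Y →ₗ[k] M)
    (he : ∀ g, ∀ y ∈ Y.deg g, e y ∈ M.deg g) : IsHom (coindLift e he) :=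
  fun g y hy h a ha => he _ _ (Y.smul_mem ha hy)

/-- The `k`-linear map underlying an `A`-linear map. -/
def baseLin {M : GrMod 𝒜} {N : GrMod 𝒜} (f : M →ₗ[A] N) : M →ₗ[k] N where
  toFun := f
  map_add' := map_add f
  map_smul' c m := map_smul f (algebraMap k A c) m

/-- The part of degree `0` of a `k`-linear map. -/
theorem exists_degree_zero_part {M Y : GrMod 𝒜} (e : Y →ₗ[k] M) :
    ∃ e' : Y →ₗ[k] M, ∀ g, ∀ y ∈ Y.deg g, e' y = M.component g (e y) := by
  have key : ∀ y : Y, (Function.support fun g => M.component g (e (Y.component g y))).Finite := by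
    intro y
    refine (finite_component_support y).subset fun g hg h => hg ?_
    simp only [h, map_zero]
  refine ⟨{ toFun := fun y => ∑ᶠ g, M.component g (e (Y.component g y))
            map_add' := fun y y' => ?_
            map_smul' := fun c y => ?_ }, fun g y hy => ?_⟩
  · simp only [map_add]
    exact finsum_add_distrib (key y) (key y')
  · simp only [component_base_smul, map_smul, RingHom.id_apply]
    exact (smul_finsum' c (key y)).symm
  · change ∑ᶠ h, M.component h (e (Y.component h y)) = _
    rw [finsum_eq_single _ g fun h hh => ?_, component_of_mem hy]
    rw [component_of_mem_ne hh.symm hy, map_zero, map_zero]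

/-- Evaluation at `1` identifies graded maps into `M.coind` with degree-preserving `k`-linear maps
into `M`, and over a field the latter extend along injections. -/
theorem coind_isInjective (M : GrMod 𝒜) : M.coind.IsInjective := by
  intro X Y i f hi hf hinj
  let ev : X →ₗ[k] M :=
    { toFun := fun x => (f x).1 1
      map_add' := fun x y => by rw [map_add]; rfl
      map_smul' := fun c x => by
        change (f (algebraMap k A c • x)).1 1 = _
        rw [map_smul]
        refine (Coind.smul_apply _ _ _).trans ?_
        rw [one_mul, RingHom.id_apply, ← map_smul, Algebra.algebraMap_eq_smul_one] }
  -- The `k`-linear retraction `r` need not respect degrees; passing to the part of degree zero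
  -- repairs this and leaves the values on the image of `i` unchanged.
  obtain ⟨r, hr⟩ := (baseLin i).exists_leftInverse_of_injective
    (LinearMap.ker_eq_bot.2 hinj)
  obtain ⟨e, he⟩ := exists_degree_zero_part (ev ∘ₗ r)
  have hri : ∀ x, r (i x) = x := fun x => LinearMap.congr_fun hr x
  have hev : ∀ g, ∀ x ∈ X.deg g, ev x ∈ M.deg g := by
    intro g x hx
    have := hf g x hx 0 1 SetLike.GradedOne.one_mem
    rwa [zero_add] at this
  have hei : ∀ x, e (i x) = ev x := by
    intro x
    induction x using homogeneous_induction with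
    | zero => simp
    | homogeneous g x hx =>
      rw [he g _ (hi g x hx), LinearMap.comp_apply, hri, component_of_mem (hev g x hx)]
    | add x y hx hy => simp only [map_add, hx, hy]
  refine ⟨coindLift e fun g y hy => ?_, coindLift_isHom e _, LinearMap.ext fun x => ?_⟩
  · rw [he g y hy]
    exact component_mem _ _ _
  · refine coind_ext fun a => ?_
    change e (a • i x) = _
    rw [← map_smul, hei]
    change (f (a • x)).1 1 = _
    rw [map_smul]
    refine (Coind.smul_apply _ _ _).trans ?_
    rw [one_mul]

/-- The unit embedding of a module into the coinduced module. -/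
def coindι (M : GrMod 𝒜) : M →ₗ[A] M.coind := coindLift LinearMap.id fun _ _ h => h

theorem coindι_isHom (M : GrMod 𝒜) : IsHom M.coindι := coindLift_isHom _ _

theorem coindι_injective (M : GrMod 𝒜) : Function.Injective M.coindι := by
  intro x y h
  have : (1 : A) • x = (1 : A) • y := congrArg (fun f : M.coind => f.1 1) h
  rwa [one_smul, one_smul] at this

/-- The cokernel of the embedding into the coinduced module. -/
def cosyzygy (M : GrMod 𝒜) : GrMod 𝒜 :=
  M.coind.quot (LinearMap.range M.coindι) M.coindι_isHom.range_isHomogeneous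

/-- The projection to the cosyzygy module. -/
def cosyzygyπ (M : GrMod 𝒜) : M.coind →ₗ[A] M.cosyzygy := M.coind.quotπ _ _

theorem cosyzygyπ_isHom (M : GrMod 𝒜) : IsHom M.cosyzygyπ := quotπ_isHom _

theorem cosyzygyπ_surjective (M : GrMod 𝒜) : Function.Surjective M.cosyzygyπ :=
  quotπ_surjective _

theorem exact_cosyzygy (M : GrMod 𝒜) : Function.Exact M.coindι M.cosyzygyπ :=
  fun _ => quotπ_eq_zero _

/-- Iterated cosyzygies. -/
def cosyzygies (M : GrMod 𝒜) : ℕ → GrMod 𝒜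
  | 0 => M
  | n + 1 => (cosyzygies M n).cosyzygy

theorem exact_coind_zero (M : GrMod 𝒜) :
    Function.Exact M.coindι (M.cosyzygy.coindι ∘ₗ M.cosyzygyπ) := by
  intro x
  rw [LinearMap.comp_apply, map_eq_zero_iff _ (coindι_injective _)]
  exact exact_cosyzygy M x

theorem exact_coind_succ (M : GrMod 𝒜) :
    Function.Exact (M.cosyzygy.coindι ∘ₗ M.cosyzygyπ)
      (M.cosyzygy.cosyzygy.coindι ∘ₗ M.cosyzygy.cosyzygyπ) := by
  intro x
  rw [exact_coind_zero M.cosyzygy x]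
  constructor
  · rintro ⟨y, rfl⟩
    obtain ⟨z, rfl⟩ := cosyzygyπ_surjective M y
    exact ⟨z, rfl⟩
  · rintro ⟨z, rfl⟩
    exact ⟨_, rfl⟩

/-- A chosen graded injective resolution. -/
def injRes (M : GrMod 𝒜) : InjRes M where
  I n := (M.cosyzygies n).coind
  injective _ := coind_isInjective _
  η := M.coindι
  d n := (M.cosyzygies n).cosyzygy.coindι ∘ₗ (M.cosyzygies n).cosyzygyπ
  η_hom := M.coindι_isHom
  d_hom n := (coindι_isHom _).comp (cosyzygyπ_isHom _)
  η_injective := M.coindι_injective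
  exact_zero := exact_coind_zero M
  exact_succ n := exact_coind_succ (M.cosyzygies n)

end GrMod

end Resolutions

section Grids

variable {k : Type v} [Field k]

/-! ### Linear relations between subquotients -/

section Link

variable {V W U : Type*} [AddCommGroup V] [Module k V] [AddCommGroup W] [Module k W]
  [AddCommGroup U] [Module k U]

/-- A linear relation inducing an isomorphism between the subquotients `ZV / BV` and `ZW / BW`. -/
structure IsLink (ZV BV : Submodule k V) (ZW BW : Submodule k W) (r : Submodule k (V × W)) :
    Prop where
  mem : ∀ x y, (x, y) ∈ r → x ∈ ZV ∧ y ∈ ZW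
  left : ∀ x ∈ ZV, ∃ y, (x, y) ∈ r
  right : ∀ y ∈ ZW, ∃ x, (x, y) ∈ r
  cob : ∀ x y, (x, y) ∈ r → (x ∈ BV ↔ y ∈ BW)

/-- The subquotient `Z / B` is one-dimensional. -/
def IsOneDim (Z B : Submodule k V) : Prop :=
  ∃ z ∈ Z, z ∉ B ∧ ∀ y ∈ Z, ∃ c : k, y - c • z ∈ B

theorem IsLink.le_of_le {ZV BV : Submodule k V} {ZW BW : Submodule k W} {r : Submodule k (V × W)}
    (h : IsLink ZV BV ZW BW r) : ZV ≤ BV ↔ ZW ≤ BW := by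
  constructor
  · intro H y hy
    obtain ⟨x, hx⟩ := h.right y hy
    exact (h.cob x y hx).1 (H (h.mem x y hx).1)
  · intro H x hx
    obtain ⟨y, hy⟩ := h.left x hx
    exact (h.cob x y hy).2 (H (h.mem x y hy).2)

theorem IsLink.isOneDim_iff {ZV BV : Submodule k V} {ZW BW : Submodule k W}
    {r : Submodule k (V × W)} (h : IsLink ZV BV ZW BW r) : IsOneDim ZV BV ↔ IsOneDim ZW BW := by
  constructor
  · rintro ⟨z, hz, hzB, H⟩
    obtain ⟨w, hw⟩ := h.left z hz
    refine ⟨w, (h.mem _ _ hw).2, fun h' => hzB ((h.cob _ _ hw).2 h'), fun y hy => ?_⟩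
    obtain ⟨x, hx⟩ := h.right y hy
    obtain ⟨c, hc⟩ := H x (h.mem _ _ hx).1
    exact ⟨c, (h.cob _ _ (r.sub_mem hx (r.smul_mem c hw))).1 hc⟩
  · rintro ⟨z, hz, hzB, H⟩
    obtain ⟨w, hw⟩ := h.right z hz
    refine ⟨w, (h.mem _ _ hw).1, fun h' => hzB ((h.cob _ _ hw).1 h'), fun y hy => ?_⟩
    obtain ⟨x, hx⟩ := h.left y hy
    obtain ⟨c, hc⟩ := H x (h.mem _ _ hx).2
    exact ⟨c, (h.cob _ _ (r.sub_mem hx (r.smul_mem c hw))).2 hc⟩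

/-- Composition of linear relations. -/
def relComp (r : Submodule k (V × W)) (s : Submodule k (W × U)) : Submodule k (V × U) where
  carrier := {p | ∃ w, (p.1, w) ∈ r ∧ (w, p.2) ∈ s}
  zero_mem' := ⟨0, r.zero_mem, s.zero_mem⟩
  add_mem' := by
    rintro _ _ ⟨w, h1, h2⟩ ⟨w', h1', h2'⟩
    exact ⟨w + w', r.add_mem h1 h1', s.add_mem h2 h2'⟩
  smul_mem' := by
    rintro c _ ⟨w, h1, h2⟩
    exact ⟨c • w, r.smul_mem c h1, s.smul_mem c h2⟩

theorem IsLink.comp {ZV BV : Submodule k V} {ZW BW : Submodule k W} {ZU BU : Submodule k U}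
    {r : Submodule k (V × W)} {s : Submodule k (W × U)} (hr : IsLink ZV BV ZW BW r)
    (hs : IsLink ZW BW ZU BU s) : IsLink ZV BV ZU BU (relComp r s) where
  mem := by
    rintro x y ⟨w, h1, h2⟩
    exact ⟨(hr.mem _ _ h1).1, (hs.mem _ _ h2).2⟩
  left x hx := by
    obtain ⟨w, hw⟩ := hr.left x hx
    obtain ⟨y, hy⟩ := hs.left w (hr.mem _ _ hw).2
    exact ⟨y, w, hw, hy⟩
  right y hy := by
    obtain ⟨w, hw⟩ := hs.right y hy
    obtain ⟨x, hx⟩ := hr.right w (hs.mem _ _ hw).1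
    exact ⟨x, w, hx, hw⟩
  cob := by
    rintro x y ⟨w, h1, h2⟩
    exact (hr.cob _ _ h1).trans (hs.cob _ _ h2)

theorem isLink_diagonal (Z B : Submodule k V) :
    IsLink Z B Z B (Z.map (LinearMap.prod LinearMap.id LinearMap.id)) where
  mem := by
    rintro x y ⟨z, hz, h⟩
    obtain ⟨rfl, rfl⟩ := Prod.mk.inj h
    exact ⟨hz, hz⟩
  left x hx := ⟨x, x, hx, rfl⟩
  right x hx := ⟨x, x, hx, rfl⟩
  cob := by
    rintro x y ⟨z, hz, h⟩
    obtain ⟨rfl, rfl⟩ := Prod.mk.inj h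
    exact Iff.rfl

end Link

/-! ### Augmented double complexes -/

/-- A double complex with augmentations in row and column `0`, whose other rows and columns are
exact. -/
structure ExactGrid (k : Type v) [Field k] where
  obj : ℕ → ℕ → Type w
  [addCommGroup : ∀ a b, AddCommGroup (obj a b)]
  [module : ∀ a b, Module k (obj a b)]
  dh : ∀ a b, obj a b →ₗ[k] obj (a + 1) b
  dv : ∀ a b, obj a b →ₗ[k] obj a (b + 1)
  comm : ∀ a b x, dv (a + 1) b (dh a b x) = dh a (b + 1) (dv a b x)
  dh_injective : ∀ b, Function.Injective (dh 0 (b + 1))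
  dh_exact : ∀ a b, Function.Exact (dh a (b + 1)) (dh (a + 1) (b + 1))
  dv_injective : ∀ a, Function.Injective (dv (a + 1) 0)
  dv_exact : ∀ a b, Function.Exact (dv (a + 1) b) (dv (a + 1) (b + 1))

namespace ExactGrid

attribute [instance] ExactGrid.addCommGroup ExactGrid.module

variable (D D' : ExactGrid.{v, w} k)

/-- Maps of double complexes. -/
structure Hom where
  app : ∀ a b, D.obj a b →ₗ[k] D'.obj a b
  app_dh : ∀ a b x, app (a + 1) b (D.dh a b x) = D'.dh a b (app a b x)
  app_dv : ∀ a b x, app a (b + 1) (D.dv a b x) = D'.dv a b (app a b x)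

variable {D D'}

theorem dh_dh (a b : ℕ) (x : D.obj a (b + 1)) : D.dh (a + 1) (b + 1) (D.dh a (b + 1) x) = 0 :=
  (D.dh_exact a b).apply_apply_eq_zero x

theorem dv_dv (a b : ℕ) (x : D.obj (a + 1) b) : D.dv (a + 1) (b + 1) (D.dv (a + 1) b x) = 0 :=
  (D.dv_exact a b).apply_apply_eq_zero x

variable (D) in
/-- Elements that are cocycles in both directions. -/
def Z (a b : ℕ) : Submodule k (D.obj (a + 1) (b + 1)) :=
  LinearMap.ker (D.dh (a + 1) (b + 1)) ⊓ LinearMap.ker (D.dv (a + 1) (b + 1))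

variable (D) in
/-- The images of the composite of the two differentials. -/
def B (a b : ℕ) : Submodule k (D.obj (a + 1) (b + 1)) :=
  LinearMap.range (D.dh a (b + 1) ∘ₗ D.dv a b)

variable (D) in
/-- The relation between cocycles in neighbouring places on an antidiagonal. -/
def stepRel (a b : ℕ) :
    Submodule k (D.obj (a + 2) (b + 1) × D.obj (a + 1) (b + 2)) where
  carrier := {p | ∃ w, D.dh (a + 1) (b + 1) w = p.1 ∧ D.dv (a + 1) (b + 1) w = p.2 ∧
    p.1 ∈ D.Z (a + 1) b ∧ p.2 ∈ D.Z a (b + 1)}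
  zero_mem' := ⟨0, map_zero _, map_zero _, zero_mem _, zero_mem _⟩
  add_mem' := by
    rintro x y ⟨w, h1, h2, h3, h4⟩ ⟨w', h1', h2', h3', h4'⟩
    refine ⟨w + w', ?_, ?_, add_mem h3 h3', add_mem h4 h4'⟩
    · rw [map_add, h1, h1']
      rfl
    · rw [map_add, h2, h2']
      rfl
  smul_mem' := by
    rintro c x ⟨w, h1, h2, h3, h4⟩
    refine ⟨c • w, ?_, ?_, Submodule.smul_mem _ c h3, Submodule.smul_mem _ c h4⟩
    · rw [map_smul, h1]
      rfl
    · rw [map_smul, h2]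
      rfl

theorem mem_stepRel (a b : ℕ) (w : D.obj (a + 1) (b + 1))
    (h : D.dv (a + 2) (b + 1) (D.dh (a + 1) (b + 1) w) = 0) :
    (D.dh (a + 1) (b + 1) w, D.dv (a + 1) (b + 1) w) ∈ D.stepRel a b :=
  ⟨w, rfl, rfl, ⟨dh_dh _ _ _, h⟩, by
    exact (D.comm _ _ w).symm.trans h, dv_dv _ _ _⟩

/-- One step of the zigzag. A cocycle on one side is the differential of some `w`, and the other
differential of `w` is its partner. Changing `w` by an element of one kernel, which is an image by
exactness, moves the partner only within the images of the composite differential. -/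
theorem isLink_stepRel (a b : ℕ) :
    IsLink (D.Z (a + 1) b) (D.B (a + 1) b) (D.Z a (b + 1)) (D.B a (b + 1)) (D.stepRel a b) where
  mem := by
    rintro x y ⟨w, -, -, h1, h2⟩
    exact ⟨h1, h2⟩
  left x hx := by
    obtain ⟨w, rfl⟩ := (D.dh_exact (a + 1) b x).1 hx.1
    exact ⟨_, mem_stepRel a b w hx.2⟩
  right y hy := by
    obtain ⟨w, rfl⟩ := (D.dv_exact a (b + 1) y).1 hy.2
    refine ⟨_, mem_stepRel a b w ?_⟩
    rw [D.comm]
    exact hy.1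
  cob := by
    rintro x y ⟨w, h1, h2, -, -⟩
    dsimp only at h1 h2
    subst h1 h2
    constructor
    · rintro ⟨v, hv⟩
      rw [LinearMap.comp_apply] at hv
      have h0 : D.dh (a + 1) (b + 1) (w - D.dv (a + 1) b v) = 0 := by rw [map_sub, hv, sub_self]
      obtain ⟨u, hu⟩ := (D.dh_exact a b _).1 h0
      refine ⟨u, ?_⟩
      rw [LinearMap.comp_apply, ← D.comm, hu, map_sub, dv_dv, sub_zero]
    · rintro ⟨v, hv⟩
      rw [LinearMap.comp_apply, ← D.comm] at hv
      have h0 : D.dv (a + 1) (b + 1) (w - D.dh a (b + 1) v) = 0 := by rw [map_sub, hv, sub_self]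
      obtain ⟨u, hu⟩ := (D.dv_exact a b _).1 h0
      refine ⟨u, ?_⟩
      rw [LinearMap.comp_apply, hu, map_sub, dh_dh, sub_zero]

/-- Composes `m` zigzag steps along an antidiagonal. The links in `D` and `D'` are built together so
that `F` carries one into the other. The indices are tied by equations, which avoids casts between
equal sums. -/
theorem exists_link_interior (F : Hom D D') : ∀ m a b c d : ℕ, c = a + m → d = b + m →
    ∃ (r : Submodule k (D.obj (c + 1) (b + 1) × D.obj (a + 1) (d + 1)))
      (r' : Submodule k (D'.obj (c + 1) (b + 1) × D'.obj (a + 1) (d + 1))),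
      IsLink (D.Z c b) (D.B c b) (D.Z a d) (D.B a d) r ∧
      IsLink (D'.Z c b) (D'.B c b) (D'.Z a d) (D'.B a d) r' ∧
      ∀ x y, (x, y) ∈ r → (F.app _ _ x, F.app _ _ y) ∈ r' := by
  have hZ : ∀ a b x, x ∈ D.Z a b → F.app _ _ x ∈ D'.Z a b := by
    rintro a b x ⟨h1, h2⟩
    refine ⟨?_, ?_⟩
    · change D'.dh _ _ _ = 0
      rw [← F.app_dh, LinearMap.mem_ker.1 h1, map_zero]
    · change D'.dv _ _ _ = 0
      rw [← F.app_dv, LinearMap.mem_ker.1 h2, map_zero]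
  intro m
  induction m with
  | zero =>
    rintro a b _ _ rfl rfl
    refine ⟨_, _, isLink_diagonal _ _, isLink_diagonal _ _, ?_⟩
    rintro x y ⟨z, hz, h⟩
    obtain ⟨rfl, rfl⟩ := Prod.mk.inj h
    exact ⟨_, hZ _ _ _ hz, rfl⟩
  | succ m ih =>
    rintro a b c _ hc rfl
    obtain ⟨r, r', hr, hr', hF⟩ := ih (a + 1) b c (b + m) (by omega) rfl
    refine ⟨relComp r (D.stepRel a (b + m)), relComp r' (D'.stepRel a (b + m)),
      hr.comp (isLink_stepRel _ _), hr'.comp (isLink_stepRel _ _), ?_⟩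
    rintro x y ⟨w, h1, v, h2, h3, h4, h5⟩
    dsimp only at h2 h3 h4 h5
    refine ⟨_, hF _ _ h1, F.app _ _ v, ?_, ?_, hZ _ _ _ h4, hZ _ _ _ h5⟩
    · rw [← F.app_dh, h2]
    · rw [← F.app_dv, h3]
      rfl

/-- The cohomology of the augmentation row agrees with that of the augmentation column, naturally
in the double complex. -/
theorem exists_link (F : Hom D D') (i : ℕ) :
    ∃ (r : Submodule k (D.obj (i + 1) 0 × D.obj 0 (i + 1)))
      (r' : Submodule k (D'.obj (i + 1) 0 × D'.obj 0 (i + 1))),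
      IsLink (LinearMap.ker (D.dh (i + 1) 0)) (LinearMap.range (D.dh i 0))
        (LinearMap.ker (D.dv 0 (i + 1))) (LinearMap.range (D.dv 0 i)) r ∧
      IsLink (LinearMap.ker (D'.dh (i + 1) 0)) (LinearMap.range (D'.dh i 0))
        (LinearMap.ker (D'.dv 0 (i + 1))) (LinearMap.range (D'.dv 0 i)) r' ∧
      ∀ x y, (x, y) ∈ r → (F.app _ _ x, F.app _ _ y) ∈ r' := by
  obtain ⟨r, r', hr, hr', hF⟩ := exists_link_interior F i 0 0 i i (by omega) (by omega)
  -- Both ends of the antidiagonal are entered through the injective augmentation maps, which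
  -- identify the cohomology of row and column zero with the subquotients `Z / B` next to them.
  have key : ∀ (E : ExactGrid.{v, w} k) (r : Submodule k (E.obj (i + 1) 1 × E.obj 1 (i + 1))),
      IsLink (E.Z i 0) (E.B i 0) (E.Z 0 i) (E.B 0 i) r →
      IsLink (LinearMap.ker (E.dh (i + 1) 0)) (LinearMap.range (E.dh i 0))
        (LinearMap.ker (E.dv 0 (i + 1))) (LinearMap.range (E.dv 0 i))
        (r.comap ((E.dv (i + 1) 0).prodMap (E.dh 0 (i + 1)))) := by
    intro E r hr
    have memh : ∀ x, x ∈ LinearMap.ker (E.dh (i + 1) 0) ↔ E.dv (i + 1) 0 x ∈ E.Z i 0 := by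
      intro x
      rw [LinearMap.mem_ker, ← map_eq_zero_iff _ (E.dv_injective (i + 1)), E.comm]
      exact ⟨fun h => ⟨h, dv_dv _ _ _⟩, fun h => h.1⟩
    have memv : ∀ y, y ∈ LinearMap.ker (E.dv 0 (i + 1)) ↔ E.dh 0 (i + 1) y ∈ E.Z 0 i := by
      intro y
      rw [LinearMap.mem_ker, ← map_eq_zero_iff _ (E.dh_injective (i + 1)), ← E.comm]
      exact ⟨fun h => ⟨dh_dh _ _ _, h⟩, fun h => h.2⟩
    refine ⟨fun x y h => ?_, fun x hx => ?_, fun y hy => ?_, fun x y h => ?_⟩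
    · have := hr.mem _ _ h
      exact ⟨(memh x).2 this.1, (memv y).2 this.2⟩
    · obtain ⟨y, hy⟩ := hr.left _ ((memh x).1 hx)
      obtain ⟨z, rfl⟩ := (E.dh_exact 0 i y).1 (hr.mem _ _ hy).2.1
      exact ⟨z, hy⟩
    · obtain ⟨x, hx⟩ := hr.right _ ((memv y).1 hy)
      obtain ⟨z, rfl⟩ := (E.dv_exact i 0 x).1 (hr.mem _ _ hx).1.2
      exact ⟨z, hx⟩
    · have := hr.cob _ _ h
      refine Iff.trans ?_ (this.trans ?_)
      · constructor
        · rintro ⟨z, rfl⟩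
          exact ⟨z, (E.comm _ _ z).symm⟩
        · rintro ⟨z, hz⟩
          refine ⟨z, E.dv_injective i ?_⟩
          exact (E.comm _ _ z).trans hz
      · constructor
        · rintro ⟨z, hz⟩
          exact ⟨z, E.dh_injective i hz⟩
        · rintro ⟨z, rfl⟩
          exact ⟨z, rfl⟩
  refine ⟨_, _, key D r hr, key D' r' hr', fun x y h => ?_⟩
  change (D'.dv _ _ (F.app _ _ x), D'.dh _ _ (F.app _ _ y)) ∈ r'
  rw [← F.app_dv, ← F.app_dh]
  exact hF _ _ h

variable (D) in
/-- The identity map of a double complex. -/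
def Hom.id : Hom D D where
  app _ _ := LinearMap.id
  app_dh _ _ _ := rfl
  app_dv _ _ _ := rfl

theorem le_range_iff (i : ℕ) :
    LinearMap.ker (D.dh (i + 1) 0) ≤ LinearMap.range (D.dh i 0) ↔
      LinearMap.ker (D.dv 0 (i + 1)) ≤ LinearMap.range (D.dv 0 i) := by
  obtain ⟨r, -, hr, -⟩ := exists_link (Hom.id D) i
  exact hr.le_of_le

theorem isOneDim_iff (i : ℕ) :
    IsOneDim (LinearMap.ker (D.dh (i + 1) 0)) (LinearMap.range (D.dh i 0)) ↔
      IsOneDim (LinearMap.ker (D.dv 0 (i + 1))) (LinearMap.range (D.dv 0 i)) := by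
  obtain ⟨r, -, hr, -⟩ := exists_link (Hom.id D) i
  exact hr.isOneDim_iff

/-- A map of double complexes that is an isomorphism on one augmentation induces an isomorphism on
the cohomology of the other one. -/
theorem Hom.bijective_on_cohomology (F : Hom D D') (h0 : ∀ a, Function.Bijective (F.app a 0))
    (i : ℕ) :
    (∀ y ∈ LinearMap.ker (D.dv 0 (i + 1)), F.app _ _ y ∈ LinearMap.range (D'.dv 0 i) →
      y ∈ LinearMap.range (D.dv 0 i)) ∧
    (∀ y' ∈ LinearMap.ker (D'.dv 0 (i + 1)), ∃ y ∈ LinearMap.ker (D.dv 0 (i + 1)),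
      y' - F.app _ _ y ∈ LinearMap.range (D'.dv 0 i)) := by
  obtain ⟨r, r', hr, hr', hF⟩ := exists_link F i
  constructor
  · intro y hy hFy
    obtain ⟨x, hx⟩ := hr.right y hy
    obtain ⟨z, hz⟩ := (hr'.cob _ _ (hF _ _ hx)).2 hFy
    obtain ⟨z, rfl⟩ := (h0 _).2 z
    rw [← F.app_dh] at hz
    exact (hr.cob _ _ hx).1 ⟨z, (h0 _).1 hz⟩
  · intro y' hy'
    obtain ⟨x', hx'⟩ := hr'.right y' hy'
    obtain ⟨x, rfl⟩ := (h0 _).2 x'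
    have hx : x ∈ LinearMap.ker (D.dh (i + 1) 0) := by
      rw [LinearMap.mem_ker, ← map_eq_zero_iff _ (h0 _).1, F.app_dh]
      exact (hr'.mem _ _ hx').1
    obtain ⟨y, hy⟩ := hr.left x hx
    refine ⟨y, (hr.mem _ _ hy).2, ?_⟩
    -- Both `y'` and the image of `y` are linked to the image of `x`, so their difference is linked
    -- to zero and is a coboundary.
    refine (hr'.cob 0 _ ?_).1 (zero_mem _)
    have := r'.sub_mem hx' (hF _ _ hy)
    rwa [Prod.mk_sub_mk, sub_self] at this

end ExactGrid

end Grids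

section HomGrids

variable {G : Type u} [AddCommGroup G] [DecidableEq G]
variable {k : Type v} [Field k] {A : Type w} [Ring A] [Algebra k A]
variable {𝒜 : G → Submodule k A} [GradedAlgebra 𝒜]

open GrMod

/-! ### Factorizations through injective and projective modules -/

namespace GrMod

/-- The map `f` descends to the quotient by `ker p`, which embeds into `Y`. -/
theorem IsInjective.exists_factor {I : GrMod 𝒜} (hI : I.IsInjective) {X Y : GrMod 𝒜}
    (p : X →ₗ[A] Y) (f : X →ₗ[A] I) (hp : IsHom p) (hf : IsHom f)
    (hker : LinearMap.ker p ≤ LinearMap.ker f) : ∃ h : Y →ₗ[A] I, IsHom h ∧ h ∘ₗ p = f := by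
  let Q := X.quot (LinearMap.ker p) hp.ker_isHomogeneous
  let p' : Q →ₗ[A] Y := (LinearMap.ker p).liftQ p le_rfl
  let f' : Q →ₗ[A] I := (LinearMap.ker p).liftQ f hker
  have hp' : IsHom p' := by
    rintro g _ ⟨x, hx, rfl⟩
    exact hp g x hx
  have hf' : IsHom f' := by
    rintro g _ ⟨x, hx, rfl⟩
    exact hf g x hx
  have inj : Function.Injective p' := LinearMap.ker_eq_bot.1 (Submodule.ker_liftQ_eq_bot _ _ _ le_rfl)
  obtain ⟨h, hh, e⟩ := hI Q Y p' f' hp' hf' inj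
  refine ⟨h, hh, LinearMap.ext fun x => ?_⟩
  exact LinearMap.congr_fun e (X.quotπ (LinearMap.ker p) hp.ker_isHomogeneous x)

theorem IsProjective.exists_factor {P : GrMod 𝒜} (hP : P.IsProjective) {X Y : GrMod 𝒜}
    (e : X →ₗ[A] Y) (f : P →ₗ[A] Y) (he : IsHom e) (hf : IsHom f)
    (hrange : LinearMap.range f ≤ LinearMap.range e) :
    ∃ h : P →ₗ[A] X, IsHom h ∧ e ∘ₗ h = f := by
  let Q := Y.sub (LinearMap.range e) he.range_isHomogeneous
  let e' : X →ₗ[A] Q := e.rangeRestrict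
  let f' : P →ₗ[A] Q := f.codRestrict (LinearMap.range e) fun x => hrange ⟨x, rfl⟩
  obtain ⟨h, hh, eq⟩ := hP X Q e' f' (fun g x hx => he g x hx) (fun g x hx => hf g x hx)
    e.surjective_rangeRestrict
  exact ⟨h, hh, LinearMap.ext fun x => congrArg Subtype.val (LinearMap.congr_fun eq x)⟩

end GrMod

/-! ### Augmented resolutions -/

variable (𝒜) in
/-- An exact sequence `⋯ → X 2 → X 1 → X 0 → 0`. -/
structure LeftRes where
  X : ℕ → GrMod 𝒜
  δ : ∀ n, X (n + 1) →ₗ[A] X n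
  δ_hom : ∀ n, IsHom (δ n)
  surjective : Function.Surjective (δ 0)
  exact : ∀ n, Function.Exact (δ (n + 1)) (δ n)

variable (𝒜) in
/-- An exact sequence `0 → Y 0 → Y 1 → Y 2 → ⋯`. -/
structure RightRes where
  Y : ℕ → GrMod 𝒜
  δ : ∀ n, Y n →ₗ[A] Y (n + 1)
  δ_hom : ∀ n, IsHom (δ n)
  injective : Function.Injective (δ 0)
  exact : ∀ n, Function.Exact (δ n) (δ (n + 1))

namespace ProjRes

variable {M : GrMod 𝒜} (R : ProjRes M)

/-- The modules of the augmented resolution. -/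
def X : ℕ → GrMod 𝒜
  | 0 => M
  | n + 1 => R.P n

/-- The maps of the augmented resolution. -/
def δ : ∀ n, R.X (n + 1) →ₗ[A] R.X n
  | 0 => R.ε
  | n + 1 => R.d n

/-- The augmented resolution. -/
def toLeftRes : LeftRes 𝒜 where
  X := R.X
  δ := R.δ
  δ_hom
    | 0 => R.ε_hom
    | n + 1 => R.d_hom n
  surjective := R.ε_surjective
  exact
    | 0 => R.exact_zero
    | n + 1 => R.exact_succ n

end ProjRes

namespace InjRes

variable {N : GrMod 𝒜} (Q : InjRes N)

/-- The modules of the augmented resolution. -/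
def Y : ℕ → GrMod 𝒜
  | 0 => N
  | n + 1 => Q.I n

/-- The maps of the augmented resolution. -/
def δ : ∀ n, Q.Y n →ₗ[A] Q.Y (n + 1)
  | 0 => Q.η
  | n + 1 => Q.d n

/-- The augmented resolution. -/
def toRightRes : RightRes 𝒜 where
  Y := Q.Y
  δ := Q.δ
  δ_hom
    | 0 => Q.η_hom
    | n + 1 => Q.d_hom n
  injective := Q.η_injective
  exact
    | 0 => Q.exact_zero
    | n + 1 => Q.exact_succ n

end InjRes

namespace LeftRes

variable (L : LeftRes 𝒜)

/-- Cocycles of degree `i` of the complex of maps to `N`. -/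
def Cocycle (i : ℕ) {N : GrMod 𝒜} (f : L.X (i + 1) →ₗ[A] N) : Prop :=
  IsHom f ∧ f ∘ₗ L.δ (i + 1) = 0

/-- Coboundaries of degree `i` of the complex of maps to `N`. -/
def Coboundary (i : ℕ) {N : GrMod 𝒜} (f : L.X (i + 1) →ₗ[A] N) : Prop :=
  -- Index `0` of the augmented resolution is the resolved module, which does not belong to the
  -- complex computing Ext; the clause for `i = 0` leaves only the zero coboundary there.
  ∃ h : L.X i →ₗ[A] N, IsHom h ∧ (i = 0 → h = 0) ∧ h ∘ₗ L.δ i = f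

/-- The vanishing of `Ext^i(-, N)`. -/
def ExtZero (i : ℕ) (N : GrMod 𝒜) : Prop :=
  ∀ f : L.X (i + 1) →ₗ[A] N, L.Cocycle i f → L.Coboundary i f

/-- One-dimensionality of `Ext^i(-, N)`. -/
def ExtOneDim (i : ℕ) (N : GrMod 𝒜) : Prop :=
  ∃ z : L.X (i + 1) →ₗ[A] N, L.Cocycle i z ∧ ¬ L.Coboundary i z ∧
    ∀ f : L.X (i + 1) →ₗ[A] N, L.Cocycle i f → ∃ c : k, L.Coboundary i (f - c • z)

theorem δ_δ (n : ℕ) (x : L.X (n + 2)) : L.δ n (L.δ (n + 1) x) = 0 :=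
  (L.exact n).apply_apply_eq_zero x

end LeftRes

namespace RightRes

variable (E : RightRes 𝒜)

/-- Cocycles of degree `i` of the complex of maps from `M`. -/
def Cocycle (i : ℕ) {M : GrMod 𝒜} (f : M →ₗ[A] E.Y (i + 1)) : Prop :=
  IsHom f ∧ E.δ (i + 1) ∘ₗ f = 0

/-- Coboundaries of degree `i` of the complex of maps from `M`. -/
def Coboundary (i : ℕ) {M : GrMod 𝒜} (f : M →ₗ[A] E.Y (i + 1)) : Prop :=
  ∃ h : M →ₗ[A] E.Y i, IsHom h ∧ (i = 0 → h = 0) ∧ E.δ i ∘ₗ h = f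

/-- The vanishing of `Ext^i(M, -)`. -/
def ExtZero (i : ℕ) (M : GrMod 𝒜) : Prop :=
  ∀ f : M →ₗ[A] E.Y (i + 1), E.Cocycle i f → E.Coboundary i f

/-- One-dimensionality of `Ext^i(M, -)`. -/
def ExtOneDim (i : ℕ) (M : GrMod 𝒜) : Prop :=
  ∃ z : M →ₗ[A] E.Y (i + 1), E.Cocycle i z ∧ ¬ E.Coboundary i z ∧
    ∀ f : M →ₗ[A] E.Y (i + 1), E.Cocycle i f → ∃ c : k, E.Coboundary i (f - c • z)

theorem δ_δ (n : ℕ) (x : E.Y n) : E.δ (n + 1) (E.δ n x) = 0 :=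
  (E.exact n).apply_apply_eq_zero x

/-- Maps from the modules of a left resolution into the terms of `E` extend as if these terms were
injective. -/
def IsAcyclicFor (E : RightRes 𝒜) (L : LeftRes 𝒜) : Prop :=
  ∀ a b, ∀ f : L.X (a + 1) →ₗ[A] E.Y (b + 1), IsHom f → f ∘ₗ L.δ (a + 1) = 0 →
    ∃ h : L.X a →ₗ[A] E.Y (b + 1), IsHom h ∧ h ∘ₗ L.δ a = f

end RightRes

/-- Acyclicity rather than injectivity is what the double complex needs, so that regraded injective
resolutions can be used in it as well. -/
theorem InjRes.isAcyclicFor {N : GrMod 𝒜} (Q : InjRes N) (L : LeftRes 𝒜) :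
    Q.toRightRes.IsAcyclicFor L := by
  intro a b f hf h
  refine (Q.injective b).exists_factor (L.δ a) f (L.δ_hom a) hf fun x hx => ?_
  obtain ⟨y, rfl⟩ := (L.exact a x).1 hx
  exact LinearMap.congr_fun h y

/-- The homogeneous maps of degree zero between the terms of two resolutions, where the maps between
the resolved modules are replaced by zero. -/
def gridHom (L : LeftRes 𝒜) (E : RightRes 𝒜) (a b : ℕ) : Submodule k (L.X a →ₗ[A] E.Y b) where
  carrier := {f | IsHom f ∧ (a = 0 → b = 0 → f = 0)}
  zero_mem' := ⟨IsHom.zero, fun _ _ => rfl⟩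
  add_mem' hf hg := ⟨hf.1.add hg.1, fun ha hb => by rw [hf.2 ha hb, hg.2 ha hb, add_zero]⟩
  smul_mem' c f hf := ⟨hf.1.smul c, fun ha hb => by rw [hf.2 ha hb, smul_zero]⟩

/-- The double complex of maps between two resolutions. -/
def homGrid (L : LeftRes 𝒜) (E : RightRes 𝒜) (hL : ∀ n, (L.X (n + 1)).IsProjective)
    (hE : E.IsAcyclicFor L) : ExactGrid.{v, w} k where
  obj a b := gridHom L E a b
  dh a b :=
    { toFun := fun f => ⟨f.1 ∘ₗ L.δ a, f.2.1.comp (L.δ_hom a), fun h => by omega⟩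
      map_add' := fun f g => rfl
      map_smul' := fun c f => rfl }
  dv a b :=
    { toFun := fun f => ⟨E.δ b ∘ₗ f.1, (E.δ_hom b).comp f.2.1, fun _ h => by omega⟩
      map_add' := fun f g => Subtype.ext (LinearMap.comp_add _ _ _)
      map_smul' := fun c f => Subtype.ext (LinearMap.ext fun x =>
        map_smul (E.δ b) (algebraMap k A c) (f.1 x)) }
  comm a b f := rfl
  dh_injective b f g h := by
    refine Subtype.ext (LinearMap.ext fun x => ?_)
    obtain ⟨y, rfl⟩ := L.surjective x
    exact LinearMap.congr_fun (congrArg Subtype.val h) y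
  dh_exact a b f := by
    constructor
    · intro h
      obtain ⟨g, hg, e⟩ := hE a b f.1 f.2.1 (congrArg Subtype.val h)
      exact ⟨⟨g, hg, fun _ h => by omega⟩, Subtype.ext e⟩
    · rintro ⟨g, rfl⟩
      refine Subtype.ext (LinearMap.ext fun x => ?_)
      exact (congrArg g.1 (L.δ_δ a x)).trans (map_zero _)
  dv_injective a f g h := by
    refine Subtype.ext (LinearMap.ext fun x => E.injective ?_)
    exact LinearMap.congr_fun (congrArg Subtype.val h) x
  dv_exact a b f := by
    constructor
    · intro h
      obtain ⟨g, hg, e⟩ := (hL a).exists_factor (E.δ b) f.1 (E.δ_hom b) f.2.1 (by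
        rintro _ ⟨x, rfl⟩
        exact (E.exact b _).1 (LinearMap.congr_fun (congrArg Subtype.val h) x))
      exact ⟨⟨g, hg, fun h => by omega⟩, Subtype.ext e⟩
    · rintro ⟨g, rfl⟩
      exact Subtype.ext (LinearMap.ext fun x => E.δ_δ b _)

section Balance

variable (L : LeftRes 𝒜) (E : RightRes 𝒜) (hL : ∀ n, (L.X (n + 1)).IsProjective)
    (hE : E.IsAcyclicFor L)

theorem homGrid_mem_ker_dh (i : ℕ) (f : gridHom L E (i + 1) 0) :
    f ∈ LinearMap.ker ((homGrid L E hL hE).dh (i + 1) 0) ↔ L.Cocycle i f.1 :=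
  ⟨fun h => ⟨f.2.1, congrArg Subtype.val h⟩, fun h => Subtype.ext h.2⟩

theorem homGrid_mem_range_dh (i : ℕ) (f : gridHom L E (i + 1) 0) :
    f ∈ LinearMap.range ((homGrid L E hL hE).dh i 0) ↔ L.Coboundary i f.1 :=
  ⟨fun ⟨h, e⟩ => ⟨h.1, h.2.1, fun hi => h.2.2 hi rfl, congrArg Subtype.val e⟩,
    fun ⟨h, hh, h0, e⟩ => ⟨⟨h, hh, fun hi _ => h0 hi⟩, Subtype.ext e⟩⟩

theorem homGrid_mem_ker_dv (i : ℕ) (f : gridHom L E 0 (i + 1)) :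
    f ∈ LinearMap.ker ((homGrid L E hL hE).dv 0 (i + 1)) ↔ E.Cocycle i f.1 :=
  ⟨fun h => ⟨f.2.1, congrArg Subtype.val h⟩, fun h => Subtype.ext h.2⟩

theorem homGrid_mem_range_dv (i : ℕ) (f : gridHom L E 0 (i + 1)) :
    f ∈ LinearMap.range ((homGrid L E hL hE).dv 0 i) ↔ E.Coboundary i f.1 :=
  ⟨fun ⟨h, e⟩ => ⟨h.1, h.2.1, fun hi => h.2.2 rfl hi, congrArg Subtype.val e⟩,
    fun ⟨h, hh, h0, e⟩ => ⟨⟨h, hh, fun _ hi => h0 hi⟩, Subtype.ext e⟩⟩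

include hL hE

/-- Balance of Ext: row zero of `homGrid` is the complex of maps from the resolution `L` into `E.Y
0`, column zero the complex of maps from `L.X 0` into `E`, and the grid links their cohomology. -/
theorem extZero_balance (i : ℕ) : L.ExtZero i (E.Y 0) ↔ E.ExtZero i (L.X 0) := by
  have := (homGrid L E hL hE).le_range_iff i
  constructor
  · intro H f hf
    refine (homGrid_mem_range_dv L E hL hE i ⟨f, hf.1, fun _ h => by omega⟩).1
      (this.1 (fun g hg => ?_) ((homGrid_mem_ker_dv L E hL hE i _).2 hf))
    exact (homGrid_mem_range_dh L E hL hE i g).2 (H _ ((homGrid_mem_ker_dh L E hL hE i g).1 hg))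
  · intro H f hf
    refine (homGrid_mem_range_dh L E hL hE i ⟨f, hf.1, fun h => by omega⟩).1
      (this.2 (fun g hg => ?_) ((homGrid_mem_ker_dh L E hL hE i _).2 hf))
    exact (homGrid_mem_range_dv L E hL hE i g).2 (H _ ((homGrid_mem_ker_dv L E hL hE i g).1 hg))

theorem extOneDim_balance (i : ℕ) : L.ExtOneDim i (E.Y 0) ↔ E.ExtOneDim i (L.X 0) := by
  have h1 : L.ExtOneDim i (E.Y 0) ↔ IsOneDim (LinearMap.ker ((homGrid L E hL hE).dh (i + 1) 0))
      (LinearMap.range ((homGrid L E hL hE).dh i 0)) := by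
    constructor
    · rintro ⟨z, hz, hz', H⟩
      refine ⟨⟨z, hz.1, fun h => by omega⟩, (homGrid_mem_ker_dh L E hL hE i _).2 hz,
        fun h => hz' ((homGrid_mem_range_dh L E hL hE i _).1 h), fun f hf => ?_⟩
      obtain ⟨c, hc⟩ := H _ ((homGrid_mem_ker_dh L E hL hE i f).1 hf)
      exact ⟨c, (homGrid_mem_range_dh L E hL hE i _).2 hc⟩
    · rintro ⟨z, hz, hz', H⟩
      refine ⟨z.1, (homGrid_mem_ker_dh L E hL hE i _).1 hz,
        fun h => hz' ((homGrid_mem_range_dh L E hL hE i _).2 h), fun f hf => ?_⟩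
      obtain ⟨c, hc⟩ := H ⟨f, hf.1, fun h => by omega⟩
        ((homGrid_mem_ker_dh L E hL hE i _).2 hf)
      exact ⟨c, (homGrid_mem_range_dh L E hL hE i _).1 hc⟩
  have h2 : E.ExtOneDim i (L.X 0) ↔ IsOneDim (LinearMap.ker ((homGrid L E hL hE).dv 0 (i + 1)))
      (LinearMap.range ((homGrid L E hL hE).dv 0 i)) := by
    constructor
    · rintro ⟨z, hz, hz', H⟩
      refine ⟨⟨z, hz.1, fun _ h => by omega⟩, (homGrid_mem_ker_dv L E hL hE i _).2 hz,
        fun h => hz' ((homGrid_mem_range_dv L E hL hE i _).1 h), fun f hf => ?_⟩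
      obtain ⟨c, hc⟩ := H _ ((homGrid_mem_ker_dv L E hL hE i f).1 hf)
      exact ⟨c, (homGrid_mem_range_dv L E hL hE i _).2 hc⟩
    · rintro ⟨z, hz, hz', H⟩
      refine ⟨z.1, (homGrid_mem_ker_dv L E hL hE i _).1 hz,
        fun h => hz' ((homGrid_mem_range_dv L E hL hE i _).2 h), fun f hf => ?_⟩
      obtain ⟨c, hc⟩ := H ⟨f, hf.1, fun _ h => by omega⟩
        ((homGrid_mem_ker_dv L E hL hE i _).2 hf)
      exact ⟨c, (homGrid_mem_range_dv L E hL hE i _).1 hc⟩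
  rw [h1, h2]
  exact (homGrid L E hL hE).isOneDim_iff i

end Balance

theorem ProjRes.extZero_iff {M N : GrMod 𝒜} (R : ProjRes M) (Q : InjRes N) (i : ℕ) :
    R.toLeftRes.ExtZero i N ↔ Q.toRightRes.ExtZero i M :=
  extZero_balance R.toLeftRes Q.toRightRes R.projective (Q.isAcyclicFor _) i

theorem ProjRes.extOneDim_iff {M N : GrMod 𝒜} (R : ProjRes M) (Q : InjRes N) (i : ℕ) :
    R.toLeftRes.ExtOneDim i N ↔ Q.toRightRes.ExtOneDim i M :=
  extOneDim_balance R.toLeftRes Q.toRightRes R.projective (Q.isAcyclicFor _) i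

namespace GrMod

/-- The vanishing of `Ext^i(M, N)` in the category of graded modules. -/
def ExtZero (i : ℕ) (M N : GrMod 𝒜) : Prop := N.injRes.toRightRes.ExtZero i M

/-- The one-dimensionality of `Ext^i(M, N)` in the category of graded modules. -/
def ExtOneDim (i : ℕ) (M N : GrMod 𝒜) : Prop := N.injRes.toRightRes.ExtOneDim i M

variable {M N : GrMod 𝒜}

theorem extZero_iff_proj (R : ProjRes M) (i : ℕ) : ExtZero i M N ↔ R.toLeftRes.ExtZero i N :=
  (R.extZero_iff _ i).symm

theorem extOneDim_iff_proj (R : ProjRes M) (i : ℕ) :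
    ExtOneDim i M N ↔ R.toLeftRes.ExtOneDim i N :=
  (R.extOneDim_iff _ i).symm

/-- Independence of the injective resolution: both sides are compared with the same projective
resolution of `M`. -/
theorem extZero_iff_inj (Q : InjRes N) (i : ℕ) : ExtZero i M N ↔ Q.toRightRes.ExtZero i M :=
  (M.projRes.extZero_iff _ i).symm.trans (M.projRes.extZero_iff Q i)

theorem extOneDim_iff_inj (Q : InjRes N) (i : ℕ) :
    ExtOneDim i M N ↔ Q.toRightRes.ExtOneDim i M :=
  (M.projRes.extOneDim_iff _ i).symm.trans (M.projRes.extOneDim_iff Q i)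

end GrMod

end HomGrids

section ExtVanishing

variable {G : Type u} [AddCommGroup G] [DecidableEq G]
variable {k : Type v} [Field k] {A : Type w} [Ring A] [Algebra k A]
variable {𝒜 : G → Submodule k A} [GradedAlgebra 𝒜]

namespace GrMod

/-! ### Short exact sequences and the vanishing of `Ext` -/

/-- Short exact sequences of graded modules. -/
structure IsShortExact {M₁ M₂ M₃ : GrMod 𝒜} (i : M₁ →ₗ[A] M₂) (p : M₂ →ₗ[A] M₃) : Prop where
  hom_left : IsHom i
  hom_right : IsHom p
  injective : Function.Injective i
  surjective : Function.Surjective p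
  exact : Function.Exact i p

theorem isShortExact_sub_quot {M : GrMod 𝒜} (U : Submodule A M) (hU : IsHomogeneous U) :
    IsShortExact (M.subι U hU) (M.quotπ U hU) where
  hom_left := subι_isHom hU
  hom_right := quotπ_isHom hU
  injective := subι_injective hU
  surjective := quotπ_surjective hU
  exact x := (quotπ_eq_zero hU).trans ⟨fun h => ⟨⟨x, h⟩, rfl⟩, by rintro ⟨y, rfl⟩; exact y.2⟩

theorem isShortExact_syzygy (M : GrMod 𝒜) : IsShortExact M.syzygyι M.coverπ where
  hom_left := M.syzygyι_isHom
  hom_right := (coverπ_spec M).1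
  injective := M.syzygyι_injective
  surjective := (coverπ_spec M).2.1
  exact := M.exact_syzygy

theorem isShortExact_cosyzygy (M : GrMod 𝒜) : IsShortExact M.coindι M.cosyzygyπ where
  hom_left := M.coindι_isHom
  hom_right := M.cosyzygyπ_isHom
  injective := M.coindι_injective
  surjective := M.cosyzygyπ_surjective
  exact := M.exact_cosyzygy

/-- A map vanishing on the kernel of a graded epimorphism descends. -/
theorem IsShortExact.exists_desc {M₁ M₂ M₃ N : GrMod 𝒜} {i : M₁ →ₗ[A] M₂} {p : M₂ →ₗ[A] M₃}
    (h : IsShortExact i p) (f : M₂ →ₗ[A] N) (hf : IsHom f) (hfi : f ∘ₗ i = 0) :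
    ∃ g : M₃ →ₗ[A] N, IsHom g ∧ g ∘ₗ p = f := by
  have hker : LinearMap.ker p ≤ LinearMap.ker f := by
    intro x hx
    obtain ⟨y, rfl⟩ := (h.exact x).1 hx
    exact LinearMap.congr_fun hfi y
  let e : (M₂ ⧸ LinearMap.ker p) ≃ₗ[A] M₃ := p.quotKerEquivOfSurjective h.surjective
  let g : M₃ →ₗ[A] N := (LinearMap.ker p).liftQ f hker ∘ₗ e.symm.toLinearMap
  have hg : ∀ x, g (p x) = f x := by
    intro x
    have : e.symm (p x) = Submodule.Quotient.mk x := by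
      rw [LinearEquiv.symm_apply_eq]
      rfl
    change (LinearMap.ker p).liftQ f hker (e.symm (p x)) = f x
    rw [this]
    rfl
  refine ⟨g, fun d m hm => ?_, LinearMap.ext hg⟩
  obtain ⟨x, rfl⟩ := h.surjective m
  rw [← component_of_mem hm, h.hom_right.component, hg]
  exact hf _ _ (component_mem _ _ _)

variable {M M₁ M₂ M₃ N : GrMod 𝒜}

theorem injRes_injective (N : GrMod 𝒜) (n : ℕ) : (N.injRes.toRightRes.Y (n + 1)).IsInjective :=
  N.injRes.injective n

theorem IsProjective.extZero (hM : M.IsProjective) {i : ℕ} (hi : i ≠ 0) : ExtZero i M N := by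
  obtain ⟨i, rfl⟩ := Nat.exists_eq_succ_of_ne_zero hi
  rintro f ⟨hf, h0⟩
  let E := N.injRes.toRightRes
  obtain ⟨h, hh, e⟩ := hM.exists_factor (E.δ (i + 1)) f (E.δ_hom _) hf (by
    rintro _ ⟨x, rfl⟩
    exact (E.exact (i + 1) _).1 (LinearMap.congr_fun h0 x))
  exact ⟨h, hh, fun h => by omega, e⟩

/-- A piece of the long exact sequence, on cochains: a primitive of the restriction to `M₁` extends
to `M₂` by injectivity, and after subtracting its coboundary the cocycle descends to `M₃`. -/
theorem IsShortExact.extZero_middle {ι : M₁ →ₗ[A] M₂} {π : M₂ →ₗ[A] M₃} (S : IsShortExact ι π)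
    {i : ℕ} (hi : i ≠ 0) (h1 : ExtZero i M₁ N) (h3 : ExtZero i M₃ N) : ExtZero i M₂ N := by
  obtain ⟨i, rfl⟩ := Nat.exists_eq_succ_of_ne_zero hi
  rintro f ⟨hf, h0⟩
  let E := N.injRes.toRightRes
  obtain ⟨a, ha, -, ea⟩ := h1 (f ∘ₗ ι) ⟨hf.comp S.hom_left, by
    rw [← LinearMap.comp_assoc, h0, LinearMap.zero_comp]⟩
  obtain ⟨b, hb, eb⟩ := N.injRes_injective i M₁ M₂ ι a S.hom_left ha S.injective
  obtain ⟨c, hc, ec⟩ := S.exists_desc (f - E.δ (i + 1) ∘ₗ b) (hf.sub ((E.δ_hom _).comp hb)) (by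
    rw [LinearMap.sub_comp, LinearMap.comp_assoc, eb, sub_eq_zero]
    exact ea.symm)
  obtain ⟨d, hd, -, ed⟩ := h3 c ⟨hc, by
    refine LinearMap.ext fun x => ?_
    obtain ⟨y, rfl⟩ := S.surjective x
    have h1 : E.δ (i + 2) (f y) = 0 := LinearMap.congr_fun h0 y
    have h2 : c (π y) = f y - E.δ (i + 1) (b y) := LinearMap.congr_fun ec y
    refine (congrArg (E.δ (i + 2)) h2).trans ?_
    rw [map_sub, h1, E.δ_δ, sub_zero]
    rfl⟩
  refine ⟨b + d ∘ₗ π, hb.add (hd.comp S.hom_right), fun h => by omega, ?_⟩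
  change E.δ (i + 1) ∘ₗ (b + d ∘ₗ π) = f
  rw [LinearMap.comp_add, ← LinearMap.comp_assoc]
  change E.δ (i + 1) ∘ₗ d = c at ed
  rw [ed, ec, add_sub_cancel]

/-- The connecting map by hand: extend the cocycle to `b` on `M₂`; the coboundary of `b` descends to
a cocycle on `M₃` of degree one higher, and a primitive of it corrects `b` to a cocycle on `M₂`. -/
theorem IsShortExact.extZero_left {ι : M₁ →ₗ[A] M₂} {π : M₂ →ₗ[A] M₃} (S : IsShortExact ι π)
    {i : ℕ} (hi : i ≠ 0) (h2 : ExtZero i M₂ N) (h3 : ExtZero (i + 1) M₃ N) : ExtZero i M₁ N := by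
  rintro f ⟨hf, h0⟩
  let E := N.injRes.toRightRes
  obtain ⟨b, hb, eb⟩ := N.injRes_injective i M₁ M₂ ι f S.hom_left hf S.injective
  obtain ⟨c, hc, ec⟩ := S.exists_desc (E.δ (i + 1) ∘ₗ b) ((E.δ_hom _).comp hb) (by
    rw [LinearMap.comp_assoc, eb]
    exact h0)
  obtain ⟨d, hd, -, ed⟩ := h3 c ⟨hc, by
    refine LinearMap.ext fun x => ?_
    obtain ⟨y, rfl⟩ := S.surjective x
    have h2 : c (π y) = E.δ (i + 1) (b y) := LinearMap.congr_fun ec y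
    refine (congrArg (E.δ (i + 2)) h2).trans ?_
    exact E.δ_δ _ _⟩
  obtain ⟨a, ha, ha0, ea⟩ := h2 (b - d ∘ₗ π) ⟨hb.sub (hd.comp S.hom_right), by
    change E.δ (i + 1) ∘ₗ (b - d ∘ₗ π) = 0
    change E.δ (i + 1) ∘ₗ d = c at ed
    rw [LinearMap.comp_sub, ← LinearMap.comp_assoc, ed, ec, sub_self]⟩
  refine ⟨a ∘ₗ ι, ha.comp S.hom_left, fun h => absurd h hi, ?_⟩
  rw [← LinearMap.comp_assoc, ea, LinearMap.sub_comp, eb, LinearMap.comp_assoc]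
  refine LinearMap.ext fun x => ?_
  simp [S.exact.apply_apply_eq_zero x]

/-- If `Ext^(i+1)(M₃, N) = 0`, maps to the module of cocycles of an injective resolution extend; here
for `i = 0`. -/
theorem IsShortExact.exists_extension {ι : M₁ →ₗ[A] M₂} {π : M₂ →ₗ[A] M₃} (S : IsShortExact ι π)
    (h : ExtZero 1 M₃ N) (f : M₁ →ₗ[A] N) (hf : IsHom f) :
    ∃ g : M₂ →ₗ[A] N, IsHom g ∧ g ∘ₗ ι = f := by
  let Q := N.injRes
  obtain ⟨b, hb, eb⟩ := Q.injective 0 M₁ M₂ ι (Q.η ∘ₗ f) S.hom_left (Q.η_hom.comp hf) S.injective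
  obtain ⟨c, hc, ec⟩ := S.exists_desc (Q.d 0 ∘ₗ b) ((Q.d_hom 0).comp hb) (by
    rw [LinearMap.comp_assoc, eb, ← LinearMap.comp_assoc, Q.exact_zero.linearMap_comp_eq_zero,
      LinearMap.zero_comp])
  obtain ⟨d, hd, ed⟩ : ∃ d : M₃ →ₗ[A] Q.I 0, IsHom d ∧ Q.d 0 ∘ₗ d = c := by
    obtain ⟨d, hd, -, ed⟩ := h c ⟨hc, by
      refine LinearMap.ext fun x => ?_
      obtain ⟨y, rfl⟩ := S.surjective x
      have h2 : c (π y) = Q.d 0 (b y) := LinearMap.congr_fun ec y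
      refine (congrArg (Q.d 1) h2).trans ?_
      exact (Q.exact_succ 0).apply_apply_eq_zero _⟩
    exact ⟨d, hd, ed⟩
  have key : ∀ x, ∃ y, Q.η y = (b - d ∘ₗ π) x := by
    intro x
    refine (Q.exact_zero _).1 ?_
    have e1 : c (π x) = Q.d 0 (b x) := LinearMap.congr_fun ec x
    have e2 : Q.d 0 (d (π x)) = c (π x) := LinearMap.congr_fun ed (π x)
    rw [LinearMap.sub_apply, map_sub, LinearMap.comp_apply, e2, e1, sub_self]
  let e := LinearEquiv.ofInjective Q.η Q.η_injective
  let g : M₂ →ₗ[A] N := e.symm.toLinearMap ∘ₗ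
    (b - d ∘ₗ π).codRestrict (LinearMap.range Q.η) key
  have hg : ∀ x, Q.η (g x) = (b - d ∘ₗ π) x := fun x =>
    congrArg Subtype.val (e.apply_symm_apply ((b - d ∘ₗ π).codRestrict (LinearMap.range Q.η) key x))
  refine ⟨g, ?_, ?_⟩
  · rw [isHom_iff_component]
    intro a x
    apply Q.η_injective
    rw [← Q.η_hom.component, hg, hg, (hb.sub (hd.comp S.hom_right)).component]
  · refine LinearMap.ext fun x => Q.η_injective ?_
    have e1 : b (ι x) = Q.η (f x) := LinearMap.congr_fun eb x
    refine (hg (ι x)).trans ?_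
    rw [LinearMap.sub_apply, LinearMap.comp_apply, S.exact.apply_apply_eq_zero, map_zero, sub_zero,
      e1]

theorem extZero_syzygy {i : ℕ} (hi : i ≠ 0) (h : ExtZero (i + 1) M N) : ExtZero i M.syzygy N :=
  M.isShortExact_syzygy.extZero_left hi (M.cover_isProjective.extZero hi) h

/-- The identity of the syzygy extends to the cover, so the cover splits and `M` is a direct summand
of a free module. -/
theorem isProjective_of_extZero_syzygy (h : ExtZero 1 M M.syzygy) : M.IsProjective := by
  obtain ⟨r, hr, er⟩ := M.isShortExact_syzygy.exists_extension h LinearMap.id IsHom.id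
  obtain ⟨s, hs, es⟩ := M.isShortExact_syzygy.exists_desc (LinearMap.id - M.syzygyι ∘ₗ r)
    (IsHom.id.sub (M.syzygyι_isHom.comp hr)) (by
      rw [LinearMap.sub_comp, LinearMap.comp_assoc, er, LinearMap.comp_id, LinearMap.id_comp,
        sub_self])
  have hs1 : ∀ m, M.coverπ (s m) = m := by
    intro m
    obtain ⟨y, rfl⟩ := (coverπ_spec M).2.1 m
    have : s (M.coverπ y) = y - M.syzygyι (r y) := LinearMap.congr_fun es y
    rw [this, map_sub, M.exact_syzygy.apply_apply_eq_zero, sub_zero]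
  intro X Y p f hp hf hsurj
  obtain ⟨g, hg, eg⟩ := M.cover_isProjective X Y p (f ∘ₗ M.coverπ) hp
    (hf.comp (coverπ_spec M).1) hsurj
  refine ⟨g ∘ₗ s, hg.comp hs, LinearMap.ext fun m => ?_⟩
  have : p (g (s m)) = f (M.coverπ (s m)) := LinearMap.congr_fun eg (s m)
  rw [LinearMap.comp_apply, LinearMap.comp_apply, this, hs1]

/-! ### Baer's criterion -/

/-- The first projection of a product. -/
def prodFst (M N : GrMod 𝒜) : M.prod N →ₗ[A] M := LinearMap.fst A M N

/-- The second projection of a product. -/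
def prodSnd (M N : GrMod 𝒜) : M.prod N →ₗ[A] N := LinearMap.snd A M N

theorem prodFst_isHom (M N : GrMod 𝒜) : IsHom (M.prodFst N) := fun _ _ hx => hx.1

theorem prodSnd_isHom (M N : GrMod 𝒜) : IsHom (M.prodSnd N) := fun _ _ hx => hx.2

/-- The map to a product with given components. -/
def prodLift {X M N : GrMod 𝒜} (f : X →ₗ[A] M) (g : X →ₗ[A] N) : X →ₗ[A] M.prod N := f.prod g

theorem prodLift_isHom {X M N : GrMod 𝒜} {f : X →ₗ[A] M} {g : X →ₗ[A] N} (hf : IsHom f)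
    (hg : IsHom g) : IsHom (prodLift f g) := fun d x hx => ⟨hf d x hx, hg d x hx⟩

/-- The graded form of Baer's criterion. Zorn's lemma is applied to graphs of partial extensions,
taken as submodules of `Y × C`, so that unions of chains need no gluing of maps. A homogeneous ideal
is tested in every shift of the algebra, since the element to be adjoined may have any degree. -/
theorem isInjective_of_baer (C : GrMod 𝒜)
    (h : ∀ (g : G) (U : Submodule A ((selfModule 𝒜).shift g)) (hU : IsHomogeneous U)
      (f : ((selfModule 𝒜).shift g).sub U hU →ₗ[A] C), IsHom f →
      ∃ c ∈ C.deg (-g), ∀ a : U, f a = (show A from a.1) • c) : C.IsInjective := by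
  intro X Y i f hi hf hinj
  let P := Y.prod C
  -- The second condition says that `Γ` is single-valued, the third that it extends `f`.
  let s : Set (Submodule A P) := {Γ | IsHomogeneous Γ ∧ (∀ c : C, ((0, c) : Y × C) ∈ Γ → c = 0) ∧
    ∀ x, ((i x, f x) : Y × C) ∈ Γ}
  have h0 : LinearMap.range (prodLift i f) ∈ s := by
    refine ⟨(prodLift_isHom hi hf).range_isHomogeneous, ?_, fun x => ⟨x, rfl⟩⟩
    rintro c ⟨x, hx⟩
    have h1 : i x = 0 := congrArg Prod.fst hx
    have h2 : f x = c := congrArg Prod.snd hx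
    rw [← h2, (map_eq_zero_iff i hinj).1 h1, map_zero]
  obtain ⟨Γ, -, hΓ⟩ := zorn_le_nonempty₀ s (by
    intro c hcs hc y hy
    have mem : ∀ p, p ∈ sSup c ↔ ∃ Γ ∈ c, p ∈ Γ := fun p =>
      Submodule.mem_sSup_of_directed ⟨y, hy⟩ hc.directedOn
    refine ⟨sSup c, ⟨?_, ?_, ?_⟩, fun z hz => le_sSup hz⟩
    · intro u hu g
      obtain ⟨Γ, hΓ, hu⟩ := (mem u).1 hu
      exact (mem _).2 ⟨Γ, hΓ, (hcs hΓ).1 u hu g⟩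
    · intro e he
      obtain ⟨Γ, hΓ, hu⟩ := (mem _).1 he
      exact (hcs hΓ).2.1 e hu
    · intro x
      exact (mem _).2 ⟨y, hy, (hcs hy).2.2 x⟩) _ h0
  obtain ⟨⟨hom, graph, ext⟩, hmax⟩ := hΓ
  have uniq : ∀ (y : Y) (c c' : C), ((y, c) : Y × C) ∈ Γ → ((y, c') : Y × C) ∈ Γ → c = c' := by
    intro y c c' h1 h2
    have := Γ.sub_mem h1 h2
    refine sub_eq_zero.1 (graph _ ?_)
    have e : ((y, c) : Y × C) - (y, c') = (0, c - c') := Prod.ext (sub_self y) rfl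
    exact e ▸ this
  have comp_mem : ∀ (y : Y) (c : C) (g : G), ((y, c) : Y × C) ∈ Γ →
      ((Y.component g y, C.component g c) : Y × C) ∈ Γ := by
    intro y c g hyc
    have h1 := hom _ hyc g
    have e : P.component g ((y, c) : Y × C) = ((Y.component g y, C.component g c) : Y × C) :=
      Prod.ext ((Y.prodFst_isHom C).component g ((y, c) : Y × C)).symm ((Y.prodSnd_isHom C).component g ((y, c) : Y × C)).symm
    exact e ▸ h1
  let p1 : Γ →ₗ[A] Y := Y.prodFst C ∘ₗ Γ.subtype
  let p2 : Γ →ₗ[A] C := Y.prodSnd C ∘ₗ Γ.subtype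
  have p1inj : Function.Injective p1 := by
    rw [← LinearMap.ker_eq_bot, LinearMap.ker_eq_bot']
    rintro ⟨⟨y, c⟩, hyc⟩ hy
    obtain rfl : y = 0 := hy
    exact Subtype.ext (Prod.ext rfl (graph c hyc))
  let e := LinearEquiv.ofInjective p1 p1inj
  let φ : LinearMap.range p1 →ₗ[A] C := p2 ∘ₗ e.symm.toLinearMap
  have hφ : ∀ y : LinearMap.range p1, ((y.1, φ y) : Y × C) ∈ Γ := by
    intro y
    have h1 : (e.symm y : Γ).1.1 = y.1 := congrArg Subtype.val (e.apply_symm_apply y)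
    have h2 : ((y.1, φ y) : Y × C) = (e.symm y).1 := Prod.ext h1.symm rfl
    rw [h2]
    exact (e.symm y).2
  have hφhom : ∀ g, ∀ y : LinearMap.range p1, y.1 ∈ Y.deg g → φ y ∈ C.deg g := by
    intro g y hy
    have h1 := comp_mem _ _ g (hφ y)
    rw [component_of_mem hy] at h1
    rw [uniq _ _ _ (hφ y) h1]
    exact component_mem _ _ _
  have hrange : ∀ y : Y, y ∈ LinearMap.range p1 := by
    intro y
    induction y using homogeneous_induction with
    | zero => exact zero_mem _
    | add y y' h h' => exact add_mem h h'
    | homogeneous g y hy =>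
      -- The scalars carrying `y` into the domain of the maximal graph form a homogeneous left ideal
      -- `U`. On it the partial map is multiplication by some `c` of degree `g`, and adjoining `(y,
      -- c)` keeps the graph single-valued.
      let τ : A →ₗ[A] Y := LinearMap.toSpanSingleton A Y y
      have hτ : IsHom (M := (selfModule 𝒜).shift (-g)) (N := Y) τ := by
        intro d a ha
        have := Y.smul_mem (show a ∈ 𝒜 (d + -g) from ha) hy
        rwa [neg_add_cancel_right] at this
      have hD : IsHomogeneous (LinearMap.range p1) := by
        rintro _ ⟨⟨⟨z, c⟩, hzc⟩, rfl⟩ d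
        exact ⟨⟨_, comp_mem z c d hzc⟩, rfl⟩
      let U : Submodule A ((selfModule 𝒜).shift (-g)) := (LinearMap.range p1).comap τ
      have hU : IsHomogeneous U := by
        intro a ha d
        have := hD _ ha d
        rw [hτ.component] at this
        exact this
      let ψ : ((selfModule 𝒜).shift (-g)).sub U hU →ₗ[A] C := φ ∘ₗ τ.restrict (p := U)
        (q := LinearMap.range p1) fun a ha => ha
      obtain ⟨c, hc, hψ⟩ := h (-g) U hU ψ fun d a ha => hφhom d _ (hτ d _ ha)
      rw [neg_neg] at hc
      let q : P := ((y, c) : Y × C)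
      let Γ' : Submodule A P := Γ ⊔ Submodule.span A {q}
      have hΓ' : Γ' ∈ s := by
        refine ⟨hom.sup (isHomogeneous_span ?_), ?_, fun x => (le_sup_left : Γ ≤ Γ') (ext x)⟩
        · rintro t rfl
          exact ⟨g, hy, hc⟩
        · intro c' hc'
          obtain ⟨⟨z, c1⟩, hz, b, hb, e1⟩ := (Submodule.mem_sup (M := P)).1 hc'
          obtain ⟨a, rfl⟩ := (Submodule.mem_span_singleton (M := P)).1 hb
          have e2 : z + a • y = 0 := congrArg Prod.fst e1
          have e3 : c1 + a • c = c' := congrArg Prod.snd e1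
          have e4 : z = (-a) • y := by rw [neg_smul]; exact eq_neg_of_add_eq_zero_left e2
          have ha : -a ∈ U := ⟨⟨_, hz⟩, e4⟩
          have h5 := hφ ⟨(-a) • y, ha⟩
          have h6 : φ ⟨(-a) • y, ha⟩ = (-a) • c := hψ ⟨-a, ha⟩
          rw [h6] at h5
          rw [e4] at hz
          rw [← e3, uniq _ _ _ hz h5, neg_smul, neg_add_cancel]
      have hle := hmax hΓ' le_sup_left
      exact ⟨⟨q, hle (Submodule.mem_sup_right (Submodule.mem_span_singleton_self q))⟩, rfl⟩
  refine ⟨φ ∘ₗ (LinearMap.id : Y →ₗ[A] Y).codRestrict (LinearMap.range p1) hrange,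
    fun g y hy => hφhom g _ hy, LinearMap.ext fun x => ?_⟩
  exact uniq _ _ _ (hφ ⟨i x, hrange _⟩) (ext x)

/-! ### Graded injective and projective dimension -/

/-- Baer's criterion only involves the cyclic modules A[g]/U, which are finitely generated. -/
theorem isInjective_of_extZero_cyclic (N : GrMod 𝒜)
    (h : ∀ M : GrMod 𝒜, Module.Finite A M → ExtZero 1 M N) : N.IsInjective := by
  refine isInjective_of_baer N fun g U hU f hf => ?_
  have : Module.Finite A (((selfModule 𝒜).shift g).quot U hU) :=
    inferInstanceAs (Module.Finite A (A ⧸ (show Submodule A A from U)))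
  obtain ⟨f', hf', e⟩ := (isShortExact_sub_quot U hU).exists_extension (h _ this) f hf
  refine ⟨f' (1 : A), hf' (-g) (1 : A) ?_, fun a => ?_⟩
  · change (1 : A) ∈ 𝒜 (-g + g)
    rw [neg_add_cancel]
    exact SetLike.GradedOne.one_mem
  · exact (LinearMap.congr_fun e a).symm.trans
      ((congrArg f' (mul_one (show A from a.1)).symm).trans (map_smul f' (show A from a.1) (1 : A)))

theorem isInjective_of_subsingleton (N : GrMod 𝒜) [Subsingleton N] : N.IsInjective :=
  fun X Y i f _ _ _ => ⟨0, IsHom.zero, LinearMap.ext fun _ => Subsingleton.elim _ _⟩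

theorem isProjective_of_subsingleton (N : GrMod 𝒜) [Subsingleton N] : N.IsProjective :=
  fun X Y p f _ _ _ => ⟨0, IsHom.zero, LinearMap.ext fun x => by
    rw [Subsingleton.elim x 0, map_zero, map_zero]⟩

variable (𝒜) in
/-- The zero module. -/
def zero : GrMod 𝒜 := free 𝒜 PEmpty PEmpty.elim

instance : Subsingleton (zero 𝒜) := inferInstanceAs (Subsingleton (PEmpty →₀ A))

/-- Splicing a short exact sequence and an injective resolution. -/
def spliceInj {ι : M₁ →ₗ[A] M₂} {π : M₂ →ₗ[A] M₃} (S : IsShortExact ι π) (hM₂ : M₂.IsInjective)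
    (Q : InjRes M₃) : InjRes M₁ where
  I | 0 => M₂
    | n + 1 => Q.I n
  injective
    | 0 => hM₂
    | n + 1 => Q.injective n
  η := ι
  d | 0 => Q.η ∘ₗ π
    | n + 1 => Q.d n
  η_hom := S.hom_left
  d_hom
    | 0 => Q.η_hom.comp S.hom_right
    | n + 1 => Q.d_hom n
  η_injective := S.injective
  exact_zero := by
    intro x
    refine Iff.trans ?_ (S.exact x)
    exact map_eq_zero_iff _ Q.η_injective
  exact_succ
    | 0 => by
      intro x
      refine (Q.exact_zero x).trans ?_
      constructor
      · rintro ⟨y, rfl⟩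
        obtain ⟨z, rfl⟩ := S.surjective y
        exact ⟨z, rfl⟩
      · rintro ⟨z, rfl⟩
        exact ⟨_, rfl⟩
    | n + 1 => Q.exact_succ n

/-- Splicing a projective resolution and a short exact sequence. -/
def splicePro {ι : M₁ →ₗ[A] M₂} {π : M₂ →ₗ[A] M₃} (S : IsShortExact ι π) (hM₂ : M₂.IsProjective)
    (R : ProjRes M₁) : ProjRes M₃ where
  P | 0 => M₂
    | n + 1 => R.P n
  projective
    | 0 => hM₂
    | n + 1 => R.projective n
  ε := π
  d | 0 => ι ∘ₗ R.ε
    | n + 1 => R.d n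
  ε_hom := S.hom_right
  d_hom
    | 0 => S.hom_left.comp R.ε_hom
    | n + 1 => R.d_hom n
  ε_surjective := S.surjective
  exact_zero := by
    intro x
    refine (S.exact x).trans ?_
    constructor
    · rintro ⟨y, rfl⟩
      obtain ⟨z, rfl⟩ := R.ε_surjective y
      exact ⟨z, rfl⟩
    · rintro ⟨z, rfl⟩
      exact ⟨_, rfl⟩
  exact_succ
    | 0 => by
      intro x
      refine Iff.trans ?_ (R.exact_zero x)
      exact map_eq_zero_iff _ S.injective
    | n + 1 => R.exact_succ n

theorem isShortExact_id_zero (M : GrMod 𝒜) :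
    IsShortExact (LinearMap.id : M →ₗ[A] M) (0 : M →ₗ[A] zero 𝒜) where
  hom_left := IsHom.id
  hom_right := IsHom.zero
  injective := Function.injective_id
  surjective x := ⟨0, Subsingleton.elim _ _⟩
  exact x := ⟨fun _ => ⟨x, rfl⟩, fun _ => rfl⟩

theorem isShortExact_zero_id (M : GrMod 𝒜) :
    IsShortExact (0 : zero 𝒜 →ₗ[A] M) (LinearMap.id : M →ₗ[A] M) where
  hom_left := IsHom.zero
  hom_right := IsHom.id
  injective := Function.injective_of_subsingleton _
  surjective := Function.surjective_id
  exact x := ⟨fun h => ⟨0, h.symm⟩, by rintro ⟨y, rfl⟩; rfl⟩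

variable (𝒜) in
theorem exact_zero_zero : Function.Exact (0 : zero 𝒜 →ₗ[A] zero 𝒜) (0 : zero 𝒜 →ₗ[A] zero 𝒜) :=
  fun x => ⟨fun _ => ⟨x, Subsingleton.elim _ _⟩, fun _ => rfl⟩

variable (𝒜) in
/-- The zero resolution. -/
def zeroInjRes : InjRes (zero 𝒜) where
  I _ := zero 𝒜
  injective _ := isInjective_of_subsingleton _
  η := 0
  d _ := 0
  η_hom := IsHom.zero
  d_hom _ := IsHom.zero
  η_injective := Function.injective_of_subsingleton _
  exact_zero := exact_zero_zero 𝒜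
  exact_succ _ := exact_zero_zero 𝒜

variable (𝒜) in
/-- The zero resolution. -/
def zeroProjRes : ProjRes (zero 𝒜) where
  P _ := zero 𝒜
  projective _ := isProjective_of_subsingleton _
  ε := 0
  d _ := 0
  ε_hom := IsHom.zero
  d_hom _ := IsHom.zero
  ε_surjective := fun x => ⟨0, Subsingleton.elim _ _⟩
  exact_zero := exact_zero_zero 𝒜
  exact_succ _ := exact_zero_zero 𝒜

theorem extZero_cosyzygy {i : ℕ} (hi : i ≠ 0) (h : ExtZero (i + 1) M N) :
    ExtZero i M N.cosyzygy := by
  obtain ⟨i, rfl⟩ := Nat.exists_eq_succ_of_ne_zero hi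
  rw [extZero_iff_inj (spliceInj N.isShortExact_cosyzygy (coind_isInjective N) N.cosyzygy.injRes)]
    at h
  rintro f ⟨hf, h0⟩
  obtain ⟨a, ha, -, ea⟩ := h f ⟨hf, h0⟩
  exact ⟨a, ha, fun h => by omega, ea⟩

/-- Dimension shifting: after `d` cosyzygies Baer's criterion shows that the remaining module is
injective, so testing against finitely generated modules is enough. -/
theorem exists_injRes_of_extZero (d : ℕ) : ∀ N : GrMod 𝒜,
    (∀ M : GrMod 𝒜, Module.Finite A M → ExtZero (d + 1) M N) →
      ∃ Q : InjRes N, ∀ i, d < i → Subsingleton (Q.I i) := by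
  induction d with
  | zero =>
    intro N h
    refine ⟨spliceInj N.isShortExact_id_zero (isInjective_of_extZero_cyclic N h) (zeroInjRes 𝒜), ?_⟩
    rintro (_ | i) hi
    · omega
    · exact inferInstanceAs (Subsingleton (zero 𝒜))
  | succ d ih =>
    intro N h
    obtain ⟨Q, hQ⟩ := ih N.cosyzygy fun M hM => extZero_cosyzygy (by omega) (h M hM)
    refine ⟨spliceInj N.isShortExact_cosyzygy (coind_isInjective N) Q, ?_⟩
    rintro (_ | i) hi
    · omega
    · exact hQ i (by omega)

/-- Only syzygies ever occur as test modules, so the hypothesis can be restricted to a class `C`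
closed under them; this is used for finitely generated modules and for all modules. -/
theorem exists_projRes_of_extZero {C : GrMod 𝒜 → Prop} (hC : ∀ M, C M → C M.syzygy) (d : ℕ) :
    ∀ M : GrMod 𝒜, C M → (∀ N : GrMod 𝒜, C N → ExtZero (d + 1) M N) →
      ∃ R : ProjRes M, ∀ i, d < i → Subsingleton (R.P i) := by
  induction d with
  | zero =>
    intro M hM h
    refine ⟨splicePro M.isShortExact_zero_id (isProjective_of_extZero_syzygy (h _ (hC M hM)))
      (zeroProjRes 𝒜), ?_⟩
    rintro (_ | i) hi
    · omega
    · exact inferInstanceAs (Subsingleton (zero 𝒜))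
  | succ d ih =>
    intro M hM h
    obtain ⟨R, hR⟩ := ih M.syzygy (hC M hM) fun N hN => extZero_syzygy (by omega) (h N hN)
    refine ⟨splicePro M.isShortExact_syzygy M.cover_isProjective R, ?_⟩
    rintro (_ | i) hi
    · omega
    · exact hR i (by omega)

theorem extZero_of_injRes (Q : InjRes N) {i : ℕ} [Subsingleton (Q.I i)] : ExtZero i M N := by
  rw [extZero_iff_inj Q]
  rintro f -
  refine ⟨0, IsHom.zero, fun _ => rfl, LinearMap.ext fun x => ?_⟩
  exact (Subsingleton.elim (α := Q.I i) _ _)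

theorem extZero_of_projRes (R : ProjRes M) {i : ℕ} [Subsingleton (R.P i)] : ExtZero i M N := by
  rw [extZero_iff_proj R]
  rintro f -
  refine ⟨0, IsHom.zero, fun _ => rfl, LinearMap.ext fun x => ?_⟩
  have : x = 0 := Subsingleton.elim (α := R.P i) _ _
  rw [this, map_zero, map_zero]

end GrMod

end ExtVanishing

universe u' w'

/-! ### Algebras with a twisted monoid basis, and twists of graded modules. -/

section Twisting

variable {G : Type u} [AddCommGroup G] [DecidableEq G]
variable {k : Type v} [Field k]
variable {A : Type w} [Ring A] [Algebra k A] {𝒜 : G → Submodule k A} [GradedAlgebra 𝒜]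
variable {B : Type w} [Ring B] [Algebra k B] {ℬ : G → Submodule k B} [GradedAlgebra ℬ]
variable {S : Type u'} [AddCommMonoid S] {ψ : S →+ G}

open GrMod

/-- A homogeneous basis indexed by `S` that multiplies like the basis of a twisted semigroup
algebra. -/
structure TwistedBasis (𝒜 : G → Submodule k A) (ψ : S →+ G) where
  X : Module.Basis S k A
  α : S → S → kˣ
  mul : ∀ s t, X s * X t = (α s t : k) • X (s + t)
  one : X 0 = 1
  mem : ∀ s, X s ∈ 𝒜 (ψ s)

namespace TwistedBasis

variable (b : TwistedBasis 𝒜 ψ)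

theorem α_zero : b.α 0 0 = 1 := by
  have h := b.mul 0 0
  rw [b.one, mul_one, add_zero, b.one, eq_comm, ← b.one] at h
  have := congrArg (fun x => b.X.repr x 0) h
  simpa using this

/-- The projection to degree `g` keeps or kills each basis element. The grading is therefore
determined by the basis and `ψ`. -/
theorem mem_span_of_mem {g : G} {a : A} (ha : a ∈ 𝒜 g) :
    a ∈ Submodule.span k (b.X '' {s | ψ s = g}) := by
  have key : ∀ a : A, (DirectSum.decompose 𝒜 a g : A) ∈ Submodule.span k (b.X '' {s | ψ s = g}) := by
    intro a
    have h : a ∈ Submodule.span k (Set.range b.X) := b.X.span_eq ▸ Submodule.mem_top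
    induction h using Submodule.span_induction with
    | mem x hx =>
      obtain ⟨s, rfl⟩ := hx
      by_cases hs : ψ s = g
      · rw [← hs, DirectSum.decompose_of_mem_same 𝒜 (b.mem s), hs]
        exact Submodule.subset_span ⟨s, hs, rfl⟩
      · rw [DirectSum.decompose_of_mem_ne 𝒜 (b.mem s) hs]
        exact zero_mem _
    | zero =>
      rw [DirectSum.decompose_zero]
      exact zero_mem _
    | add x y _ _ hx hy =>
      rw [DirectSum.decompose_add]
      exact add_mem hx hy
    | smul c x _ hx =>
      rw [DirectSum.decompose_smul]
      exact Submodule.smul_mem _ c hx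
  have := key a
  rwa [DirectSum.decompose_of_mem_same 𝒜 ha] at this

/-- A `k`-linear map that commutes with the basis elements is linear. -/
def toLin {M N : GrMod 𝒜} (f : M →ₗ[k] N)
    (h : ∀ s g, ∀ m ∈ M.deg g, f (b.X s • m) = b.X s • f m) : M →ₗ[A] N where
  toFun := f
  map_add' := map_add f
  map_smul' a m := by
    have hs : ∀ s, ∀ m : M, f (b.X s • m) = b.X s • f m := by
      intro s m
      induction m using homogeneous_induction with
      | zero => simp
      | homogeneous g m hm => exact h s g m hm
      | add m m' hm hm' => rw [smul_add, map_add, map_add, smul_add, hm, hm']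
    change f (a • m) = a • f m
    have ha : a ∈ Submodule.span k (Set.range b.X) := b.X.span_eq ▸ Submodule.mem_top
    induction ha using Submodule.span_induction with
    | mem x hx =>
      obtain ⟨s, rfl⟩ := hx
      exact hs s m
    | zero => rw [zero_smul, zero_smul, map_zero]
    | add x y _ _ hx hy => rw [add_smul, map_add, add_smul, hx, hy]
    | smul c x _ hx => rw [smul_assoc, map_smul, hx, smul_assoc]

end TwistedBasis

/-! ### Twisting graded modules -/

/-- An isomorphism of graded vector spaces along which the actions of the basis elements agree up to
the scalars `c s g`. -/
structure TwistEquiv (bB : TwistedBasis ℬ ψ) (bA : TwistedBasis 𝒜 ψ) (c : S → G → kˣ)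
    (Y : GrMod ℬ) (M : GrMod 𝒜) where
  e : Y ≃ₗ[k] M
  mem_deg : ∀ g y, e y ∈ M.deg g ↔ y ∈ Y.deg g
  X_smul : ∀ s g, ∀ y ∈ Y.deg g, e (bB.X s • y) = (c s g : k) • bA.X s • e y

/-- The condition on the scalars under which every module can be twisted. -/
def IsTwist (bB : TwistedBasis ℬ ψ) (bA : TwistedBasis 𝒜 ψ) (c : S → G → kˣ) : Prop :=
  ∀ s t g, c s (ψ t + g) * c t g * bA.α s t = bB.α s t * c (s + t) g

variable {bB : TwistedBasis ℬ ψ} {bA : TwistedBasis 𝒜 ψ} {c : S → G → kˣ}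

theorem IsTwist.symm (h : IsTwist bB bA c) : IsTwist bA bB c⁻¹ := by
  intro s t g
  have := h s t g
  have e := eq_mul_inv_of_mul_eq this.symm
  simp only [Pi.inv_apply]
  rw [e, ← mul_inv, mul_assoc (c s (ψ t + g) * c t g), inv_mul_cancel_left]

theorem IsTwist.zero_left (h : IsTwist bB bA c) (g : G) : c 0 g = 1 := by
  have := h 0 0 g
  rw [bA.α_zero, bB.α_zero, map_zero, zero_add, zero_add, mul_one, one_mul] at this
  simpa using this

namespace TwistEquiv

variable {Y Z : GrMod ℬ} {M N : GrMod 𝒜}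

/-- The inverse of a twist. -/
def symm (t : TwistEquiv bB bA c Y M) : TwistEquiv bA bB c⁻¹ M Y where
  e := t.e.symm
  mem_deg g m := by rw [← t.mem_deg, t.e.apply_symm_apply]
  X_smul s g m hm := by
    rw [t.e.symm_apply_eq, map_smul, t.X_smul s g _ (by rwa [← t.mem_deg, t.e.apply_symm_apply]),
      t.e.apply_symm_apply, smul_smul]
    simp

/-- Transport of homogeneous maps. -/
def conj (t : TwistEquiv bB bA c Y M) (t' : TwistEquiv bB bA c Z N) (f : M →ₗ[A] N)
    (hf : IsHom f) : Y →ₗ[B] Z :=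
  bB.toLin (t'.e.symm.toLinearMap ∘ₗ baseLin f ∘ₗ t.e.toLinearMap) fun s g y hy => by
    change t'.e.symm (f (t.e (bB.X s • y))) = bB.X s • t'.e.symm (f (t.e y))
    -- As `f` preserves the degree, both sides acquire the same scalar `c s g`.
    have h1 : f (t.e y) ∈ N.deg g := hf g _ ((t.mem_deg g y).2 hy)
    rw [t'.e.symm_apply_eq, t'.X_smul s g _ (by rwa [← t'.mem_deg, t'.e.apply_symm_apply]),
      t'.e.apply_symm_apply, t.X_smul s g y hy, ← map_smul f (bA.X s)]
    exact map_smul f (algebraMap k A _) _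

theorem conj_apply (t : TwistEquiv bB bA c Y M) (t' : TwistEquiv bB bA c Z N) (f : M →ₗ[A] N)
    (hf : IsHom f) (y : Y) : t.conj t' f hf y = t'.e.symm (f (t.e y)) := rfl

theorem e_conj_apply (t : TwistEquiv bB bA c Y M) (t' : TwistEquiv bB bA c Z N) (f : M →ₗ[A] N)
    (hf : IsHom f) (y : Y) : t'.e (t.conj t' f hf y) = f (t.e y) := t'.e.apply_symm_apply _

theorem conj_isHom (t : TwistEquiv bB bA c Y M) (t' : TwistEquiv bB bA c Z N) (f : M →ₗ[A] N)
    (hf : IsHom f) : IsHom (t.conj t' f hf) := fun g y hy => by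
  rw [← t'.mem_deg, e_conj_apply]
  exact hf g _ ((t.mem_deg g y).2 hy)

theorem conj_injective (t : TwistEquiv bB bA c Y M) (t' : TwistEquiv bB bA c Z N) {f : M →ₗ[A] N}
    (hf : IsHom f) (h : Function.Injective f) : Function.Injective (t.conj t' f hf) :=
  t'.e.symm.injective.comp (h.comp t.e.injective)

theorem conj_surjective (t : TwistEquiv bB bA c Y M) (t' : TwistEquiv bB bA c Z N) {f : M →ₗ[A] N}
    (hf : IsHom f) (h : Function.Surjective f) : Function.Surjective (t.conj t' f hf) :=
  t'.e.symm.surjective.comp (h.comp t.e.surjective)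

theorem conj_exact {P : GrMod ℬ} {Q : GrMod 𝒜} (t : TwistEquiv bB bA c Y M)
    (t' : TwistEquiv bB bA c Z N) (t'' : TwistEquiv bB bA c P Q) {f : M →ₗ[A] N} {g : N →ₗ[A] Q}
    (hf : IsHom f) (hg : IsHom g) (h : Function.Exact f g) :
    Function.Exact (t.conj t' f hf) (t'.conj t'' g hg) := by
  intro z
  rw [← t''.e.map_eq_zero_iff, e_conj_apply, h]
  constructor
  · rintro ⟨m, hm⟩
    refine ⟨t.e.symm m, ?_⟩
    rw [conj_apply, t.e.apply_symm_apply, hm, t'.e.symm_apply_apply]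
  · rintro ⟨y, rfl⟩
    exact ⟨t.e y, (e_conj_apply _ _ _ _ _).symm⟩

end TwistEquiv

/-! ### Existence of twists -/

namespace GrMod

/-- Scaling the homogeneous components. -/
def scale (M : GrMod 𝒜) (χ : G → k) : M →ₗ[k] M where
  toFun m := ∑ᶠ g, χ g • M.component g m
  map_add' m m' := by
    rw [← finsum_add_distrib]
    · simp only [map_add, smul_add]
    · exact (finite_component_support m).subset fun g hg h => hg (by simp [h])
    · exact (finite_component_support m').subset fun g hg h => hg (by simp [h])
  map_smul' r m := by
    rw [RingHom.id_apply, smul_finsum' r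
      ((finite_component_support m).subset fun g hg h => hg (by simp [h]))]
    simp only [component_base_smul, smul_comm r]

theorem scale_of_mem {M : GrMod 𝒜} (χ : G → k) {g : G} {m : M} (hm : m ∈ M.deg g) :
    M.scale χ m = χ g • m := by
  refine (finsum_eq_single _ g fun h hh => ?_).trans ?_
  · rw [component_of_mem_ne hh.symm hm, smul_zero]
  · rw [component_of_mem hm]

end GrMod

variable (bB bA c) in
/-- The action of the twisting algebra on a twisted module. -/
def twistAct (M : GrMod 𝒜) : B →ₗ[k] Module.End k M :=
  bB.X.constr k fun s => Algebra.lsmul k k M (bA.X s) ∘ₗ M.scale fun g => (c s g : k)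

theorem twistAct_X {M : GrMod 𝒜} (s : S) {g : G} {m : M} (hm : m ∈ M.deg g) :
    twistAct bB bA c M (bB.X s) m = (c s g : k) • bA.X s • m := by
  rw [twistAct, Module.Basis.constr_basis, LinearMap.comp_apply, scale_of_mem _ hm, map_smul]
  rfl

theorem twistAct_one (hc : IsTwist bB bA c) (M : GrMod 𝒜) : twistAct bB bA c M 1 = 1 := by
  refine LinearMap.ext fun m => ?_
  induction m using homogeneous_induction with
  | zero => simp
  | homogeneous g m hm =>
    rw [← bB.one, twistAct_X _ hm, hc.zero_left, bA.one, one_smul]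
    exact one_smul _ _
  | add m m' hm hm' => rw [map_add, map_add, hm, hm']

theorem twistAct_mul (hc : IsTwist bB bA c) (M : GrMod 𝒜) (x y : B) :
    twistAct bB bA c M (x * y) = twistAct bB bA c M x * twistAct bB bA c M y := by
  have h2 : (LinearMap.mul k B).compr₂ (twistAct bB bA c M) =
      (LinearMap.mul k (Module.End k M)).compl₁₂ (twistAct bB bA c M) (twistAct bB bA c M) := by
    refine bB.X.ext fun s => bB.X.ext fun t => LinearMap.ext fun m => ?_
    induction m using homogeneous_induction with
    | zero => simp
    | homogeneous g m hm =>
      change twistAct bB bA c M (bB.X s * bB.X t) m =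
        twistAct bB bA c M (bB.X s) (twistAct bB bA c M (bB.X t) m)
      rw [bB.mul, map_smul, LinearMap.smul_apply, twistAct_X _ hm, twistAct_X _ hm,
        map_smul, twistAct_X _ (M.smul_mem (bA.mem t) hm), ← mul_smul (bA.X s), bA.mul, smul_assoc,
        smul_smul, smul_smul, smul_smul]
      congr 1
      -- The condition `IsTwist` is exactly the associativity of the rescaled action.
      have := congrArg Units.val (hc s t g)
      push_cast at this
      rw [← this]
      ring
    | add m m' hm hm' => rw [map_add, map_add, hm, hm']
  exact LinearMap.congr_fun (LinearMap.congr_fun h2 x) y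

/-- The ring homomorphism describing a twisted module. -/
def twistHom (hc : IsTwist bB bA c) (M : GrMod 𝒜) : B →+* Module.End k M where
  toFun := twistAct bB bA c M
  map_one' := twistAct_one hc M
  map_mul' := twistAct_mul hc M
  map_zero' := map_zero _
  map_add' := map_add _

/-- The twist of a graded module. -/
def GrMod.twist (hc : IsTwist bB bA c) (M : GrMod 𝒜) : GrMod ℬ where
  carrier := M.carrier
  module := Module.compHom M.carrier (twistHom hc M)
  deg := M.deg
  isInternal := M.isInternal
  smul_mem {g h a m} ha hm := by
    change twistAct bB bA c M a m ∈ M.deg (g + h)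
    have ha' := bB.mem_span_of_mem ha
    clear ha
    induction ha' using Submodule.span_induction with
    | mem x hx =>
      obtain ⟨s, rfl, rfl⟩ := hx
      rw [twistAct_X s hm]
      exact base_smul_mem _ (M.smul_mem (bA.mem s) hm)
    | zero =>
      rw [map_zero]
      exact zero_mem _
    | add x y _ _ hx hy =>
      rw [map_add]
      exact add_mem hx hy
    | smul r x _ hx =>
      rw [map_smul]
      exact base_smul_mem _ hx

/-- A twisted module and the original one. -/
def GrMod.twistEquiv (hc : IsTwist bB bA c) (M : GrMod 𝒜) :
    TwistEquiv bB bA c (M.twist hc) M where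
  e :=
    { toFun := fun m => m
      invFun := fun m => m
      map_add' := fun _ _ => rfl
      map_smul' := fun r m => by
        change twistAct bB bA c M (algebraMap k B r) m = r • (show M.carrier from m)
        rw [Algebra.algebraMap_eq_smul_one, map_smul, twistAct_one hc]
        rfl
      left_inv := fun _ => rfl
      right_inv := fun _ => rfl }
  mem_deg _ _ := Iff.rfl
  X_smul s g m hm := twistAct_X (M := M) s hm

end Twisting

/-! ### Invariance of resolutions, Ext and projective dimension under twists. -/

section TwistTransfer

variable {G : Type u} [AddCommGroup G] [DecidableEq G]
variable {k : Type v} [Field k]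
variable {A : Type w} [Ring A] [Algebra k A] {𝒜 : G → Submodule k A} [GradedAlgebra 𝒜]
variable {B : Type w} [Ring B] [Algebra k B] {ℬ : G → Submodule k B} [GradedAlgebra ℬ]
variable {S : Type u'} [AddCommMonoid S] {ψ : S →+ G}
variable {bB : TwistedBasis ℬ ψ} {bA : TwistedBasis 𝒜 ψ} {c : S → G → kˣ}

open GrMod

namespace TwistEquiv

variable {Y Z : GrMod ℬ} {M N : GrMod 𝒜}

/-- A module as a twist of its inverse twist. -/
def untwist (hc : IsTwist bB bA c) (Y : GrMod ℬ) : TwistEquiv bB bA c Y (Y.twist hc.symm) :=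
  by simpa only [inv_inv] using (Y.twistEquiv hc.symm).symm

/-- Every graded module over the other algebra is itself a twist (`untwist`), so an extension
problem there can be carried over, solved, and carried back. -/
theorem isInjective (hc : IsTwist bB bA c) (t : TwistEquiv bB bA c Y M) (hM : M.IsInjective) :
    Y.IsInjective := by
  intro X Z i f hi hf hinj
  let tX := untwist hc X
  let tZ := untwist hc Z
  obtain ⟨h, hh, e⟩ := hM _ _ (tX.symm.conj tZ.symm i hi) (tX.symm.conj t.symm f hf)
    (conj_isHom _ _ _ _) (conj_isHom _ _ _ _) (conj_injective _ _ hi hinj)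
  refine ⟨tZ.conj t h hh, conj_isHom _ _ _ _, LinearMap.ext fun x => ?_⟩
  apply t.e.injective
  refine (e_conj_apply tZ t h hh (i x)).trans ?_
  have := LinearMap.congr_fun e (tX.e x)
  refine Eq.trans (congrArg h ?_) (this.trans ?_)
  · change tZ.e (i x) = tZ.e (i (tX.e.symm (tX.e x)))
    rw [tX.e.symm_apply_apply]
  · change t.e (f (tX.e.symm (tX.e x))) = t.e (f x)
    rw [tX.e.symm_apply_apply]

theorem isProjective (hc : IsTwist bB bA c) (t : TwistEquiv bB bA c Y M) (hM : M.IsProjective) :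
    Y.IsProjective := by
  intro X Z p f hp hf hsurj
  let tX := untwist hc X
  let tZ := untwist hc Z
  obtain ⟨h, hh, e⟩ := hM _ _ (tX.symm.conj tZ.symm p hp) (t.symm.conj tZ.symm f hf)
    (conj_isHom _ _ _ _) (conj_isHom _ _ _ _) (conj_surjective _ _ hp hsurj)
  refine ⟨t.conj tX h hh, conj_isHom _ _ _ _, LinearMap.ext fun y => ?_⟩
  apply tZ.e.injective
  have := LinearMap.congr_fun e (t.e y)
  refine Eq.trans ?_ (this.trans ?_)
  · rfl
  · change tZ.e (f (t.e.symm (t.e y))) = tZ.e (f y)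
    rw [t.e.symm_apply_apply]

/-- Twisting an injective resolution. -/
def injRes (hc : IsTwist bB bA c) (t : TwistEquiv bB bA c Y M) (Q : InjRes M) : InjRes Y where
  I n := (Q.I n).twist hc
  injective n := isInjective hc ((Q.I n).twistEquiv hc) (Q.injective n)
  η := t.conj ((Q.I 0).twistEquiv hc) Q.η Q.η_hom
  d n := ((Q.I n).twistEquiv hc).conj ((Q.I (n + 1)).twistEquiv hc) (Q.d n) (Q.d_hom n)
  η_hom := conj_isHom _ _ _ _
  d_hom n := conj_isHom _ _ _ _
  η_injective := conj_injective _ _ _ Q.η_injective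
  exact_zero := conj_exact _ _ _ _ _ Q.exact_zero
  exact_succ n := conj_exact _ _ _ _ _ (Q.exact_succ n)

/-- Twisting a projective resolution. -/
def projRes (hc : IsTwist bB bA c) (t : TwistEquiv bB bA c Y M) (R : ProjRes M) : ProjRes Y where
  P n := (R.P n).twist hc
  projective n := isProjective hc ((R.P n).twistEquiv hc) (R.projective n)
  ε := ((R.P 0).twistEquiv hc).conj t R.ε R.ε_hom
  d n := ((R.P (n + 1)).twistEquiv hc).conj ((R.P n).twistEquiv hc) (R.d n) (R.d_hom n)
  ε_hom := conj_isHom _ _ _ _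
  d_hom n := conj_isHom _ _ _ _
  ε_surjective := conj_surjective _ _ _ R.ε_surjective
  exact_zero := conj_exact _ _ _ _ _ R.exact_zero
  exact_succ n := conj_exact _ _ _ _ _ (R.exact_succ n)

theorem grProjDim_le (hc : IsTwist bB bA c) (t : TwistEquiv bB bA c Y M) :
    grProjDim Y ≤ grProjDim M := by
  refine sInf_le_sInf ?_
  rintro _ ⟨m, rfl, R, hR⟩
  exact ⟨m, rfl, t.projRes hc R, fun i hi =>
    have := hR i hi
    inferInstanceAs (Subsingleton (R.P i))⟩

theorem grProjDim_eq (hc : IsTwist bB bA c) (t : TwistEquiv bB bA c Y M) :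
    grProjDim Y = grProjDim M :=
  le_antisymm (t.grProjDim_le hc) (t.symm.grProjDim_le hc.symm)

section RightRes

variable {E : RightRes 𝒜} {F : RightRes ℬ} (t : ∀ n, TwistEquiv bB bA c (F.Y n) (E.Y n))
  (ht : ∀ n y, (t (n + 1)).e (F.δ n y) = E.δ n ((t n).e y)) (s : TwistEquiv bB bA c Y M)

include ht

theorem cocycle (i : ℕ) (f : Y →ₗ[B] F.Y (i + 1)) (hf : F.Cocycle i f) :
    E.Cocycle i (s.symm.conj (t (i + 1)).symm f hf.1) := by
  refine ⟨conj_isHom _ _ _ _, LinearMap.ext fun m => ?_⟩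
  change E.δ (i + 1) ((t (i + 1)).e (f (s.e.symm m))) = 0
  rw [← ht]
  exact (congrArg _ (LinearMap.congr_fun hf.2 (s.e.symm m))).trans (map_zero _)

theorem coboundary (i : ℕ) (f : Y →ₗ[B] F.Y (i + 1)) (f' : M →ₗ[A] E.Y (i + 1))
    (hff : ∀ y, (t (i + 1)).e (f y) = f' (s.e y)) (hf' : E.Coboundary i f') :
    F.Coboundary i f := by
  obtain ⟨h, hh, h0, e⟩ := hf'
  refine ⟨s.conj (t i) h hh, conj_isHom _ _ _ _, fun hi => LinearMap.ext fun y => ?_,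
    LinearMap.ext fun y => (t (i + 1)).e.injective ?_⟩
  · have h00 := h0 hi
    rw [conj_apply, h00]
    exact map_zero _
  · rw [hff, LinearMap.comp_apply, ht, e_conj_apply]
    exact LinearMap.congr_fun e _

include s

theorem extZero_of (i : ℕ) (h : E.ExtZero i M) : F.ExtZero i Y := by
  intro f hf
  refine coboundary t ht s i f _ (fun y => ?_) (h _ (cocycle t ht s i f hf))
  change _ = (t (i + 1)).e (f (s.e.symm (s.e y)))
  rw [s.e.symm_apply_apply]

theorem extOneDim_of (i : ℕ) (h : E.ExtOneDim i M) : F.ExtOneDim i Y := by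
  have ht' : ∀ n x, (t (n + 1)).symm.e (E.δ n x) = F.δ n ((t n).symm.e x) := fun n x => by
    change (t (n + 1)).e.symm (E.δ n x) = F.δ n ((t n).e.symm x)
    rw [(t (n + 1)).e.symm_apply_eq, ht, (t n).e.apply_symm_apply]
  obtain ⟨z, hz, hz0, H⟩ := h
  refine ⟨s.conj (t (i + 1)) z hz.1, ?_, fun h0 => hz0 ?_, fun f hf => ?_⟩
  · exact cocycle (fun n => (t n).symm) ht' s.symm i z hz
  · refine coboundary (fun n => (t n).symm) ht' s.symm i z _ (fun m => ?_) h0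
    change (t (i + 1)).e.symm (z m) = (t (i + 1)).e.symm (z (s.e (s.e.symm m)))
    rw [s.e.apply_symm_apply]
  · obtain ⟨r, hr⟩ := H _ (cocycle t ht s i f hf)
    refine ⟨r, coboundary t ht s i _ _ (fun y => ?_) hr⟩
    change (t (i + 1)).e (f y - r • (t (i + 1)).e.symm (z (s.e y))) =
      (t (i + 1)).e (f (s.e.symm (s.e y))) - r • z (s.e y)
    rw [s.e.symm_apply_apply, map_sub, map_smul, (t (i + 1)).e.apply_symm_apply]

end RightRes

/-- The twists relating a twisted resolution to the original one. -/
def resEquiv (hc : IsTwist bB bA c) (t : TwistEquiv bB bA c Z N) (Q : InjRes N) :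
    ∀ n, TwistEquiv bB bA c ((t.injRes hc Q).toRightRes.Y n) (Q.toRightRes.Y n)
  | 0 => t
  | n + 1 => (Q.I n).twistEquiv hc

theorem resEquiv_comm (hc : IsTwist bB bA c) (t : TwistEquiv bB bA c Z N) (Q : InjRes N) :
    ∀ n y, (t.resEquiv hc Q (n + 1)).e ((t.injRes hc Q).toRightRes.δ n y) =
      Q.toRightRes.δ n ((t.resEquiv hc Q n).e y)
  | 0, _ => e_conj_apply _ _ _ Q.η_hom _
  | n + 1, _ => e_conj_apply _ _ _ (Q.d_hom n) _

theorem extZero (hc : IsTwist bB bA c) (s : TwistEquiv bB bA c Y M) (t : TwistEquiv bB bA c Z N)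
    {i : ℕ} (h : ExtZero i M N) : ExtZero i Y Z := by
  rw [extZero_iff_inj (t.injRes hc N.injRes)]
  exact extZero_of (t.resEquiv hc N.injRes) (t.resEquiv_comm hc N.injRes) s i h

theorem extZero_iff (hc : IsTwist bB bA c) (s : TwistEquiv bB bA c Y M)
    (t : TwistEquiv bB bA c Z N) {i : ℕ} : ExtZero i Y Z ↔ ExtZero i M N :=
  ⟨s.symm.extZero hc.symm t.symm, s.extZero hc t⟩

theorem extOneDim (hc : IsTwist bB bA c) (s : TwistEquiv bB bA c Y M)
    (t : TwistEquiv bB bA c Z N) {i : ℕ} (h : ExtOneDim i M N) : ExtOneDim i Y Z := by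
  rw [extOneDim_iff_inj (t.injRes hc N.injRes)]
  exact extOneDim_of (t.resEquiv hc N.injRes) (t.resEquiv_comm hc N.injRes) s i h

theorem extOneDim_iff (hc : IsTwist bB bA c) (s : TwistEquiv bB bA c Y M)
    (t : TwistEquiv bB bA c Z N) {i : ℕ} : ExtOneDim i Y Z ↔ ExtOneDim i M N :=
  ⟨s.symm.extOneDim hc.symm t.symm, s.extOneDim hc t⟩

end TwistEquiv

end TwistTransfer

/-! ### Positive gradings: augmentation, powers of 𝔪, torsion and local cohomology. -/

section Positive

variable {G : Type u} [AddCommGroup G] [DecidableEq G]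
variable {k : Type v} [Field k]
variable {A : Type w} [Ring A] [Algebra k A] {𝒜 : G → Submodule k A} [GradedAlgebra 𝒜]
variable {B : Type w} [Ring B] [Algebra k B] {ℬ : G → Submodule k B} [GradedAlgebra ℬ]
variable {S : Type u'} [AddCommMonoid S] {ψ : S →+ G}
variable {bB : TwistedBasis ℬ ψ} {bA : TwistedBasis 𝒜 ψ} {c : S → G → kˣ}

open GrMod

/-- The nonzero elements of `S` have positive degree for some additive degree function. -/
def IsPositive (ψ : S →+ G) : Prop := ∃ D : G →+ ℤ, ∀ s, s ≠ 0 → 0 < D (ψ s)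

theorem IsPositive.ne_zero (h : IsPositive ψ) {s : S} (hs : s ≠ 0) : ψ s ≠ 0 := by
  obtain ⟨D, hD⟩ := h
  intro h0
  have := hD s hs
  rw [h0, map_zero] at this
  exact this.false

theorem IsPositive.add_eq_zero (h : IsPositive ψ) {s t : S} : s + t = 0 ↔ s = 0 ∧ t = 0 := by
  obtain ⟨D, hD⟩ := h
  have hn : ∀ s, 0 ≤ D (ψ s) := fun s => by
    by_cases hs : s = 0
    · rw [hs, map_zero, map_zero]
    · exact (hD s hs).le
  refine ⟨fun hst => ?_, fun ⟨h1, h2⟩ => by rw [h1, h2, add_zero]⟩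
  have h0 : D (ψ s) + D (ψ t) = 0 := by rw [← map_add, ← map_add, hst, map_zero, map_zero]
  have h1 := hn s
  have h2 := hn t
  constructor
  · by_contra hs
    have := hD s hs
    omega
  · by_contra hs
    have := hD t hs
    omega

namespace TwistedBasis

variable (b : TwistedBasis 𝒜 ψ) (hψ : IsPositive ψ)

/-- The augmentation of a positively graded algebra with a twisted basis. -/
def augmentation : A →+* k where
  toFun a := b.X.coord 0 a
  map_one' := by
    rw [← b.one]
    simp
  map_mul' x y := by
    have : (LinearMap.mul k A).compr₂ (b.X.coord 0) =
        (LinearMap.mul k k).compl₁₂ (b.X.coord 0) (b.X.coord 0) := by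
      refine b.X.ext fun s => b.X.ext fun t => ?_
      change b.X.coord 0 (b.X s * b.X t) = b.X.coord 0 (b.X s) * b.X.coord 0 (b.X t)
      rw [b.mul, map_smul]
      simp only [Module.Basis.coord_apply, Module.Basis.repr_self]
      -- Positivity forces `s = t = 0` here, so the coefficient at `0` of a product sees only the
      -- coefficients at `0` of the factors.
      by_cases h : s + t = 0
      · obtain ⟨rfl, rfl⟩ := hψ.add_eq_zero.1 h
        simp [b.α_zero]
      · rw [Finsupp.single_eq_of_ne (Ne.symm h), smul_zero]
        rcases not_and_or.1 (fun h' => h (hψ.add_eq_zero.2 h')) with h' | h'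
        · rw [Finsupp.single_eq_of_ne (Ne.symm h'), zero_mul]
        · rw [Finsupp.single_eq_of_ne (Ne.symm h'), mul_zero]
    exact LinearMap.congr_fun (LinearMap.congr_fun this x) y
  map_zero' := map_zero _
  map_add' := map_add _

theorem augmentation_X {s : S} (hs : s ≠ 0) : b.augmentation hψ (b.X s) = 0 := by
  change b.X.repr (b.X s) 0 = _
  rw [Module.Basis.repr_self, Finsupp.single_eq_of_ne hs.symm]

theorem augmentation_smul (r : k) (a : A) :
    b.augmentation hψ (r • a) = r * b.augmentation hψ a :=
  map_smul (b.X.coord 0) r a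

include hψ in
theorem X_mem_augIdeal {s : S} (hs : s ≠ 0) : b.X s ∈ augIdeal 𝒜 :=
  TwoSidedIdeal.mem_asIdeal.2 (TwoSidedIdeal.subset_span ⟨ψ s, hψ.ne_zero hs, b.mem s⟩)

theorem augmentation_eq_zero_iff_mem_span (a : A) :
    b.augmentation hψ a = 0 ↔ a ∈ Submodule.span k (b.X '' {s | s ≠ 0}) := by
  rw [b.X.mem_span_image]
  change b.X.repr a 0 = 0 ↔ _
  constructor
  · intro h s hs h0
    rw [h0] at hs
    exact (Finsupp.mem_support_iff.1 hs) h
  · intro h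
    by_contra h0
    exact h (Finsupp.mem_support_iff.2 h0) rfl

/-- Since `ψ s ≠ 0` for `s ≠ 0`, the ideal is the span of the nontrivial basis elements; in
particular it does not depend on the chosen positive grading. -/
theorem mem_augIdeal {a : A} : a ∈ augIdeal 𝒜 ↔ b.augmentation hψ a = 0 := by
  constructor
  · intro ha
    have : TwoSidedIdeal.span {a : A | ∃ g : G, g ≠ 0 ∧ a ∈ 𝒜 g} ≤
        TwoSidedIdeal.ker (b.augmentation hψ) := by
      refine TwoSidedIdeal.span_le.2 ?_
      rintro a ⟨g, hg, ha⟩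
      refine (TwoSidedIdeal.mem_ker _).2 ((b.augmentation_eq_zero_iff_mem_span hψ a).2 ?_)
      refine Submodule.span_mono (Set.image_mono ?_) (b.mem_span_of_mem ha)
      rintro s hs rfl
      exact hg (by rw [← hs, map_zero])
    exact (TwoSidedIdeal.mem_ker _).1 (this (TwoSidedIdeal.mem_asIdeal.1 ha))
  · intro ha
    rw [augmentation_eq_zero_iff_mem_span] at ha
    have : Submodule.span k (b.X '' {s | s ≠ 0}) ≤ (augIdeal 𝒜).restrictScalars k := by
      refine Submodule.span_le.2 ?_
      rintro _ ⟨s, hs, rfl⟩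
      exact b.X_mem_augIdeal hψ hs
    exact this ha

/-- The trivial module is the base field. -/
def trivialEquiv : trivialModule 𝒜 ≃ₗ[k] k where
  toFun := QuotientAddGroup.lift (augIdeal 𝒜).toAddSubgroup (b.augmentation hψ).toAddMonoidHom
    fun a ha => (b.mem_augIdeal hψ).1 ha
  invFun r := (augIdeal 𝒜).mkQ (algebraMap k A r)
  map_add' := map_add _
  map_smul' r x := by
    obtain ⟨a, rfl⟩ := Submodule.Quotient.mk_surjective _ x
    exact (congrArg (b.augmentation hψ) (Algebra.smul_def r a).symm).trans
      (b.augmentation_smul hψ r a)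
  left_inv x := by
    obtain ⟨a, rfl⟩ := Submodule.Quotient.mk_surjective _ x
    refine (Submodule.Quotient.eq _).2 ((b.mem_augIdeal hψ).2 ?_)
    rw [map_sub, sub_eq_zero]
    refine (congrArg _ (Algebra.algebraMap_eq_smul_one _)).trans ?_
    rw [augmentation_smul, map_one, mul_one]
    rfl
  right_inv r := by
    change b.augmentation hψ (algebraMap k A r) = r
    rw [Algebra.algebraMap_eq_smul_one, augmentation_smul, map_one, mul_one]

theorem smul_trivial (a : A) (x : trivialModule 𝒜) :
    a • x = b.augmentation hψ a • x := by
  apply (b.trivialEquiv hψ).injective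
  rw [map_smul (b.trivialEquiv hψ) (b.augmentation hψ a) x]
  obtain ⟨a', rfl⟩ := Submodule.Quotient.mk_surjective _ x
  exact map_mul (b.augmentation hψ) a a'

variable (S) in
/-- The sums of an element of `S` and `n` nonzero elements. -/
def depth : ℕ → Set S
  | 0 => Set.univ
  | n + 1 => {s | ∃ t ∈ depth n, ∃ r, r ≠ 0 ∧ t + r = s}

include hψ

theorem X_mem_augIdeal_pow (n : ℕ) : ∀ s ∈ depth S n, b.X s ∈ augIdeal 𝒜 ^ n := by
  induction n with
  | zero =>
    intro s _
    rw [Submodule.pow_zero, Ideal.one_eq_top]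
    exact Submodule.mem_top
  | succ n ih =>
    rintro _ ⟨t, ht, r, hr, rfl⟩
    have h := Ideal.mul_mem_mul (ih t ht) (b.X_mem_augIdeal hψ hr)
    rw [b.mul, ← Submodule.pow_succ] at h
    have := ((augIdeal 𝒜 ^ (n + 1)).restrictScalars k).smul_mem ((b.α t r)⁻¹ : k) h
    rwa [smul_smul, inv_mul_cancel₀ (Units.ne_zero _), one_smul] at this

/-- Together with `X_mem_augIdeal_pow` this describes 𝔪^n through the monoid `S` alone, so torsion
can be tested on basis elements and transported along twists. -/
theorem mem_span_of_mem_augIdeal_pow (n : ℕ) :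
    ∀ a ∈ augIdeal 𝒜 ^ n, a ∈ Submodule.span k (b.X '' depth S n) := by
  induction n with
  | zero =>
    intro a _
    rw [depth, Set.image_univ, b.X.span_eq]
    exact Submodule.mem_top
  | succ n ih =>
    intro a ha
    rw [Submodule.pow_succ, ← Ideal.smul_eq_mul] at ha
    refine Submodule.smul_induction_on ha (fun x hx y hy => ?_) fun x y => add_mem
    have hx' := ih x hx
    have hy' := (b.augmentation_eq_zero_iff_mem_span hψ y).1 ((b.mem_augIdeal hψ).1 hy)
    have := Submodule.mul_mem_mul hx' hy'
    rw [Submodule.span_mul_span] at this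
    refine (Submodule.span_le (p := Submodule.span k (b.X '' depth S (n + 1)))).2 ?_ this
    rintro _ ⟨_, ⟨t, ht, rfl⟩, _, ⟨r, hr, rfl⟩, rfl⟩
    change b.X t * b.X r ∈ Submodule.span k (b.X '' depth S (n + 1))
    rw [b.mul]
    exact Submodule.smul_mem _ _ (Submodule.subset_span ⟨_, ⟨t, ht, r, hr, rfl⟩, rfl⟩)

theorem mem_torsion_iff {M : GrMod 𝒜} {x : M} :
    x ∈ torsion M ↔ ∃ N, ∀ n, N ≤ n → ∀ s ∈ depth S n, b.X s • x = 0 := by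
  refine exists_congr fun N => forall₂_congr fun n _ => ?_
  constructor
  · exact fun h s hs => h _ (b.X_mem_augIdeal_pow hψ n s hs)
  · intro h a ha
    have h1 : ∀ a ∈ Submodule.span k (b.X '' depth S n), a • x = 0 := by
      intro a ha
      induction ha using Submodule.span_induction with
      | mem x hx =>
        obtain ⟨s, hs, rfl⟩ := hx
        exact h s hs
      | zero => exact zero_smul _ _
      | add x y _ _ hx hy => rw [add_smul, hx, hy, add_zero]
      | smul r x _ hx => rw [smul_assoc, hx, smul_zero]
    exact h1 a (b.mem_span_of_mem_augIdeal_pow hψ n a ha)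

end TwistedBasis

namespace TwistEquiv

variable {Y : GrMod ℬ} {M : GrMod 𝒜}

theorem component (t : TwistEquiv bB bA c Y M) (g : G) (y : Y) :
    t.e (Y.component g y) = M.component g (t.e y) := by
  induction y using homogeneous_induction with
  | zero => simp
  | homogeneous h y hy =>
    rw [component_of_mem_eq_ite hy, component_of_mem_eq_ite ((t.mem_deg h y).2 hy)]
    split_ifs <;> simp
  | add y y' hy hy' => rw [map_add, map_add, map_add, map_add, hy, hy']

/-- The scalar relating the two actions depends on the degree, so the comparison is made on
components, which a homogeneous element sends to different degrees. -/
theorem X_smul_eq_zero (t : TwistEquiv bB bA c Y M) {s : S} {y : Y} :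
    bB.X s • y = 0 ↔ bA.X s • t.e y = 0 := by
  have h1 : bB.X s • y = 0 ↔ ∀ g, bB.X s • Y.component g y = 0 := by
    refine ⟨fun h g => ?_, fun h => component_ext fun g => ?_⟩
    · rw [← component_smul (bB.mem s), h, map_zero]
    · rw [component_smul' (bB.mem s), h, map_zero]
  have h2 : bA.X s • t.e y = 0 ↔ ∀ g, bA.X s • M.component g (t.e y) = 0 := by
    refine ⟨fun h g => ?_, fun h => component_ext fun g => ?_⟩
    · rw [← component_smul (bA.mem s), h, map_zero]
    · rw [component_smul' (bA.mem s), h, map_zero]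
  rw [h1, h2]
  refine forall_congr' fun g => ?_
  rw [← t.component, ← t.e.map_eq_zero_iff, t.X_smul s g _ (component_mem _ _ _),
    smul_eq_zero_iff_right (Units.ne_zero _)]

theorem mem_torsion_iff (hψ : IsPositive ψ) (t : TwistEquiv bB bA c Y M) {y : Y} :
    t.e y ∈ torsion M ↔ y ∈ torsion Y := by
  rw [bA.mem_torsion_iff hψ, bB.mem_torsion_iff hψ]
  simp only [t.X_smul_eq_zero]

theorem localCohomologyVanishes (hψ : IsPositive ψ) (hc : IsTwist bB bA c)
    (t : TwistEquiv bB bA c Y M) {i : ℕ} (h : LocalCohomologyVanishes M i) :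
    LocalCohomologyVanishes Y i := by
  obtain ⟨R, hR⟩ := h
  refine ⟨t.injRes hc R, ?_⟩
  rw [Submodule.Quotient.subsingleton_iff, Submodule.submoduleOf_eq_top] at hR ⊢
  rintro y ⟨hy, hy'⟩
  let e := fun n => ((R.I n).twistEquiv hc)
  have : (e i).e y ∈ R.coboundaries i := by
    refine hR ⟨((e i).mem_torsion_iff hψ).2 hy, ?_⟩
    refine (e_conj_apply _ (e (i + 1)) (R.d i) (R.d_hom i) y).symm.trans ?_
    exact (congrArg _ hy').trans (map_zero _)
  cases i with
  | zero => exact this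
  | succ i =>
    obtain ⟨x, hx, hxy⟩ := this
    exact ⟨x, ((e i).mem_torsion_iff hψ).1 hx, hxy⟩

theorem localCohomologyVanishes_iff (hψ : IsPositive ψ) (hc : IsTwist bB bA c)
    (t : TwistEquiv bB bA c Y M) {i : ℕ} :
    LocalCohomologyVanishes Y i ↔ LocalCohomologyVanishes M i :=
  ⟨t.symm.localCohomologyVanishes hψ hc.symm, t.localCohomologyVanishes hψ hc⟩

/-- The shifts of the trivial modules of two algebras. -/
def trivial (hψ : IsPositive ψ) (hc : IsTwist bB bA c) (g : G) :
    TwistEquiv bB bA c ((trivialModule ℬ).shift g) ((trivialModule 𝒜).shift g) where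
  e := (bB.trivialEquiv hψ).trans (bA.trivialEquiv hψ).symm
  mem_deg h y := by
    change _ ∈ (if h + g = 0 then (⊤ : AddSubgroup (trivialModule 𝒜)) else ⊥) ↔
      _ ∈ (if h + g = 0 then (⊤ : AddSubgroup (trivialModule ℬ)) else ⊥)
    split_ifs
    · exact Iff.rfl
    · exact ((bB.trivialEquiv hψ).trans (bA.trivialEquiv hψ).symm).map_eq_zero_iff
  X_smul s h y _ := by
    have h1 := bB.smul_trivial hψ (bB.X s) (show trivialModule ℬ from y)
    have h2 := bA.smul_trivial hψ (bA.X s)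
      ((bA.trivialEquiv hψ).symm (bB.trivialEquiv hψ y))
    refine (congrArg ((bB.trivialEquiv hψ).trans (bA.trivialEquiv hψ).symm) h1).trans
      (Eq.trans ?_ (congrArg (fun z => (c s h : k) • z) h2).symm)
    -- For `s ≠ 0` both basis elements act as zero and the scalar is irrelevant; for `s = 0` it is
    -- `1`.
    have h3 : (bB.augmentation hψ (bB.X s)) = (c s h : k) * bA.augmentation hψ (bA.X s) := by
      by_cases hs : s = 0
      · rw [hs, bA.one, bB.one, map_one, map_one, hc.zero_left, Units.val_one, one_mul]
      · rw [bA.augmentation_X hψ hs, bB.augmentation_X hψ hs, mul_zero]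
    refine (map_smul ((bB.trivialEquiv hψ).trans (bA.trivialEquiv hψ).symm) _
      (show trivialModule ℬ from y)).trans ?_
    rw [h3]
    exact mul_smul _ _ (show trivialModule 𝒜 from _)

/-- The shifts of two algebras as graded modules. -/
def self (hc : IsTwist bB bA c) (g : G) :
    TwistEquiv bB bA c ((selfModule ℬ).shift g) ((selfModule 𝒜).shift g) := by
  -- In the module shifted by `g` the element X^s is X^s applied to `1`, which sits in degree `-g`.
  -- An isomorphism sending `1` to `1` therefore has to rescale X^s by `c s (-g)`.
  let u : B ≃ₗ[k] A := bB.X.equiv (bA.X.unitsSMul fun s => c s (-g)) (Equiv.refl S)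
  have hu : ∀ s, u (bB.X s) = (c s (-g) : k) • bA.X s := fun s => by
    simp [u, Module.Basis.unitsSMul_apply, Units.smul_def]
  have hu' : ∀ s, u.symm (bA.X s) = ((c s (-g))⁻¹ : kˣ) • bB.X s := fun s => by
    rw [u.symm_apply_eq, Units.smul_def, map_smul, hu, smul_smul, ← Units.val_mul, inv_mul_cancel,
      Units.val_one, one_smul]
  have hd : ∀ h, ∀ y ∈ ℬ h, u y ∈ 𝒜 h := fun h y hy => by
    have := bB.mem_span_of_mem hy
    refine (Submodule.span_le (p := (𝒜 h).comap (u : B →ₗ[k] A))).2 ?_ this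
    rintro _ ⟨s, rfl, rfl⟩
    change u (bB.X s) ∈ 𝒜 (ψ s)
    rw [hu]
    exact Submodule.smul_mem _ _ (bA.mem s)
  have hd' : ∀ h, ∀ y ∈ 𝒜 h, u.symm y ∈ ℬ h := fun h y hy => by
    have := bA.mem_span_of_mem hy
    refine (Submodule.span_le (p := (ℬ h).comap (u.symm : A →ₗ[k] B))).2 ?_ this
    rintro _ ⟨s, rfl, rfl⟩
    change u.symm (bA.X s) ∈ ℬ (ψ s)
    rw [hu']
    exact Submodule.smul_mem _ _ (bB.mem s)
  have hd'' : ∀ h y, u y ∈ 𝒜 h → y ∈ ℬ h := fun h y hy => by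
    have := hd' h _ hy
    rwa [u.symm_apply_apply] at this
  have hX : ∀ s h, ∀ y ∈ ℬ (h + g), u (bB.X s * y) = (c s h : k) • (bA.X s * u y) := by
    intro s h y hy
    have := bB.mem_span_of_mem hy
    clear hy
    induction this using Submodule.span_induction with
    | mem x hx =>
      obtain ⟨t, ht, rfl⟩ := hx
      rw [bB.mul, map_smul, hu, hu, mul_smul_comm, bA.mul, smul_smul, smul_smul, smul_smul]
      congr 1
      have := congrArg Units.val (hc s t (-g))
      rw [show ψ t + -g = h by rw [show ψ t = h + g from ht]; abel] at this
      push_cast at this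
      rw [← this]
    | zero => simp
    | add x y _ _ hx hy => rw [mul_add, map_add, map_add, mul_add, smul_add, hx, hy]
    | smul r x _ hx => rw [mul_smul_comm, map_smul, map_smul, hx, mul_smul_comm, smul_comm]
  have hsA : ∀ (r : k) (a : A), r • a = algebraMap k A r * a := Algebra.smul_def
  have hsB : ∀ (r : k) (a : B), r • a = algebraMap k B r * a := Algebra.smul_def
  exact
    { e :=
        { toFun := u
          invFun := u.symm
          map_add' := map_add u
          map_smul' := fun r x =>
            (congrArg u (hsB r x).symm).trans ((u.map_smul r (show B from x)).trans (hsA r (u x)))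
          left_inv := u.left_inv
          right_inv := u.right_inv }
      mem_deg := fun h y => ⟨hd'' _ _, hd _ _⟩
      X_smul := fun s h y hy => (hX s h y hy).trans (hsA _ _) }

end TwistEquiv

end Positive

/-! ### Ext into bounded below modules is controlled by the trivial module. -/

section Bass

variable {G : Type u} [AddCommGroup G] [DecidableEq G]
variable {k : Type v} [Field k]
variable {A : Type w} [Ring A] [Algebra k A] {𝒜 : G → Submodule k A} [GradedAlgebra 𝒜]
variable {S : Type u'} [AddCommMonoid S] {ψ : S →+ G}

open GrMod

namespace GrMod

variable {M N : GrMod 𝒜}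

theorem isHom_shift_iff {l : G} (f : M →ₗ[A] N) :
    IsHom (M := M.shift l) (N := N) f ↔ IsHom (M := M) (N := N.shift (-l)) f := by
  constructor
  · intro h g m hm
    refine h (g + -l) m ?_
    change m ∈ M.deg (g + -l + l)
    rwa [neg_add_cancel_right]
  · intro h g m hm
    have : f m ∈ N.deg (g + l + -l) := h (g + l) m hm
    rwa [add_neg_cancel_right] at this

theorem IsInjective.shift {I : GrMod 𝒜} (hI : I.IsInjective) (l : G) : (I.shift l).IsInjective := by
  intro X Y i f hi hf hinj
  have hf' : IsHom (M := X.shift (-l)) (N := I) f :=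
    (isHom_shift_iff (M := X) (N := I) f).2 (by rwa [neg_neg])
  obtain ⟨h, hh, e⟩ := hI (X.shift (-l)) (Y.shift (-l)) i f (shift_isHom hi (-l)) hf' hinj
  refine ⟨h, ?_, e⟩
  have := (isHom_shift_iff (M := Y) (N := I) h).1 hh
  rwa [neg_neg] at this

/-- The shift of an injective resolution. -/
def _root_.InjRes.shift (Q : InjRes N) (l : G) : InjRes (N.shift l) where
  I n := (Q.I n).shift l
  injective n := (Q.injective n).shift l
  η := Q.η
  d n := Q.d n
  η_hom := shift_isHom Q.η_hom l
  d_hom n := shift_isHom (Q.d_hom n) l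
  η_injective := Q.η_injective
  exact_zero := Q.exact_zero
  exact_succ := Q.exact_succ

theorem extZero_shift {i : ℕ} {l : G} : ExtZero i (M.shift l) N ↔ ExtZero i M (N.shift (-l)) := by
  rw [extZero_iff_inj N.injRes, extZero_iff_inj (N.injRes.shift (-l))]
  cases i with
  | zero =>
    constructor
    · rintro H f ⟨hf, h0⟩
      obtain ⟨h, hh, h1, e⟩ := H f ⟨(isHom_shift_iff (M := M) (N := N.injRes.I 0) f).2 hf, h0⟩
      exact ⟨h, (isHom_shift_iff (M := M) (N := N) h).1 hh, h1, e⟩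
    · rintro H f ⟨hf, h0⟩
      obtain ⟨h, hh, h1, e⟩ := H f ⟨(isHom_shift_iff (M := M) (N := N.injRes.I 0) f).1 hf, h0⟩
      exact ⟨h, (isHom_shift_iff (M := M) (N := N) h).2 hh, h1, e⟩
  | succ i =>
    constructor
    · rintro H f ⟨hf, h0⟩
      obtain ⟨h, hh, h1, e⟩ := H f ⟨(isHom_shift_iff (M := M) (N := N.injRes.I (i + 1)) f).2 hf, h0⟩
      exact ⟨h, (isHom_shift_iff (M := M) (N := N.injRes.I i) h).1 hh, h1, e⟩
    · rintro H f ⟨hf, h0⟩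
      obtain ⟨h, hh, h1, e⟩ := H f ⟨(isHom_shift_iff (M := M) (N := N.injRes.I (i + 1)) f).1 hf, h0⟩
      exact ⟨h, (isHom_shift_iff (M := M) (N := N.injRes.I i) h).2 hh, h1, e⟩

theorem shift_shift (M : GrMod 𝒜) (g l : G) : (M.shift g).shift l = M.shift (l + g) := by
  simp only [shift, add_assoc]

theorem shift_zero (M : GrMod 𝒜) : M.shift 0 = M := by
  simp only [shift, add_zero]

/-- The components of `D`-degree less than `a` vanish. -/
def BoundedBelow (D : G →+ ℤ) (N : GrMod 𝒜) (a : ℤ) : Prop := ∀ g, D g < a → ∀ x ∈ N.deg g, x = 0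

/-- The i-th term of the resolution of `L` is finitely generated. A large shift moves all its
generators into degrees where `N` vanishes, so that there are no nonzero cochains at all. -/
theorem exists_extZero_shift [IsNoetherianRing A] (D : G →+ ℤ) (L : GrMod 𝒜) [Module.Finite A L]
    (a : ℤ) (i : ℕ) : ∃ m : ℤ, ∀ l, m ≤ D l → ∀ N : GrMod 𝒜, N.BoundedBelow D a →
      ExtZero i (L.shift l) N := by
  obtain ⟨T, hT, hspan, hfin⟩ := exists_homogeneous_generators (L.projRes.P i)
  choose! d hd using hT
  have hfin := hfin (projRes_finite L i)
  obtain ⟨m, hm⟩ := (hfin.image fun t => D (d t)).bddAbove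
  -- With `m` bounding the `D`-degrees of the generators, their degrees after the shift are at most
  -- `a - 1`.
  refine ⟨m + 1 - a, fun l hl N hN => ?_⟩
  rw [extZero_shift, extZero_iff_proj L.projRes]
  rintro f ⟨hf, -⟩
  have : f = 0 := by
    refine LinearMap.ext_on_range (v := ((↑) : T → L.projRes.P i))
      (by rw [Subtype.range_coe]; exact hspan) fun t => ?_
    refine hN (d t + -l) ?_ (f (show L.projRes.P i from t.1)) (hf _ _ (hd t t.2))
    have := hm ⟨t, t.2, rfl⟩
    simp only [map_add, map_neg] at this ⊢
    omega
  exact ⟨0, IsHom.zero, fun _ => rfl, by rw [this, LinearMap.zero_comp]⟩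

/-- A bounded below module whose `Ext` from the trivial modules vanishes above degree `d`. -/
def ExtBounded (D : G →+ ℤ) (d : ℕ) (a : ℤ) (N : GrMod 𝒜) : Prop :=
  N.BoundedBelow D a ∧ ∀ i, d < i → ∀ g, ExtZero i ((trivialModule 𝒜).shift g) N

/-- The modules whose `Ext` into modules as in `ExtBounded` vanishes above degree `d`. -/
def IsExtSmall (D : G →+ ℤ) (d : ℕ) (M : GrMod 𝒜) : Prop :=
  ∀ a (N : GrMod 𝒜), N.ExtBounded D d a → ∀ i, d < i → ExtZero i M N

variable {D : G →+ ℤ} {d : ℕ} {a : ℤ}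

theorem ExtBounded.shift (h : N.ExtBounded D d a) (l : G) :
    (N.shift l).ExtBounded D d (a - D l) := by
  refine ⟨fun g hg x hx => h.1 (g + l) (by rw [map_add]; omega) x hx, fun i hi g => ?_⟩
  have := h.2 i hi (-l + g)
  rwa [← shift_shift, extZero_shift, neg_neg] at this

theorem IsExtSmall.shift (h : M.IsExtSmall D d) (l : G) : (M.shift l).IsExtSmall D d :=
  fun a N hN i hi => extZero_shift.2 (h _ _ (hN.shift (-l)) i hi)

theorem isExtSmall_of_subsingleton (M : GrMod 𝒜) [Subsingleton M] : M.IsExtSmall D d :=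
  fun _ _ _ _ hi => M.isProjective_of_subsingleton.extZero (by omega)

theorem IsShortExact.isExtSmall {M₁ M₂ M₃ : GrMod 𝒜} {ι : M₁ →ₗ[A] M₂} {π : M₂ →ₗ[A] M₃}
    (E : IsShortExact ι π) (h1 : M₁.IsExtSmall D d) (h3 : M₃.IsExtSmall D d) :
    M₂.IsExtSmall D d :=
  fun a N hN i hi => E.extZero_middle (by omega) (h1 a N hN i hi) (h3 a N hN i hi)

theorem ExtBounded.twist {b : TwistedBasis 𝒜 ψ} {c : S → G → kˣ} (hψ : IsPositive ψ)
    (hc : IsTwist b b c) (t : TwistEquiv b b c N M) (h : N.ExtBounded D d a) :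
    M.ExtBounded D d a := by
  refine ⟨fun g hg x hx => ?_, fun i hi g => ?_⟩
  · have := h.1 g hg (t.e.symm x) (by rwa [← t.mem_deg, t.e.apply_symm_apply])
    exact t.e.symm.map_eq_zero_iff.1 this
  · exact (TwistEquiv.extZero_iff hc (.trivial hψ hc g) t).1 (h.2 i hi g)

theorem IsExtSmall.twist {b : TwistedBasis 𝒜 ψ} {c : S → G → kˣ} (hψ : IsPositive ψ)
    (hc : IsTwist b b c) (t : TwistEquiv b b c N M) (h : M.IsExtSmall D d) :
    N.IsExtSmall D d := fun a K hK i hi =>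
  (t.extZero_iff hc (.untwist hc K)).2 (h a _ (hK.twist hψ hc (.untwist hc K)) i hi)

end GrMod

/-! ### Multiplication by basis elements -/

namespace TwistedBasis

variable (b : TwistedBasis 𝒜 ψ)

/-- The commutation factors. -/
def q (s t : S) : kˣ := b.α s t * (b.α t s)⁻¹

theorem X_mul_X (s t : S) : b.X s * b.X t = (b.q s t : k) • (b.X t * b.X s) := by
  rw [b.mul, b.mul, smul_smul, add_comm t s, q]
  simp

theorem q_add (s t r : S) : b.q s (t + r) = b.q s t * b.q s r := by
  have h1 : b.X s * (b.X t * b.X r) = (b.q s (t + r) : k) • (b.X t * b.X r * b.X s) := by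
    rw [b.mul t r, mul_smul_comm, b.X_mul_X, smul_mul_assoc, smul_comm]
  have h2 : b.X s * (b.X t * b.X r) = ((b.q s t : k) * b.q s r) • (b.X t * b.X r * b.X s) := by
    rw [← mul_assoc, b.X_mul_X s t, smul_mul_assoc, mul_assoc, b.X_mul_X s r, mul_smul_comm,
      smul_smul, mul_assoc]
  have h3 : b.X t * b.X r * b.X s ≠ 0 := by
    rw [b.mul, smul_mul_assoc, b.mul, smul_smul]
    exact smul_ne_zero (mul_ne_zero (Units.ne_zero _) (Units.ne_zero _)) (b.X.ne_zero _)
  exact Units.ext (smul_left_injective k h3 (h1.symm.trans h2))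

/-- For fixed `s` the commutation factor is a character of `S`, hence a twist of the algebra into
itself. It makes multiplication by X^s linear as a map into a twisted shift (`mulHom`). -/
theorem isTwist_q (s : S) : IsTwist b b fun t _ => b.q s t := fun t r g => by
  change b.q s t * b.q s r * b.α t r = b.α t r * b.q s (t + r)
  rw [q_add, mul_comm]

theorem X_smul_X_smul {M : GrMod 𝒜} (s t : S) (m : M) :
    b.X s • b.X t • m = (b.q s t : k) • b.X t • b.X s • m := by
  rw [← mul_smul, X_mul_X, smul_assoc, mul_smul]

/-- The submodule of multiples of a basis element. -/
def multiples (M : GrMod 𝒜) (s : S) : Submodule A M where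
  carrier := {x | ∃ m, b.X s • m = x}
  zero_mem' := ⟨0, smul_zero _⟩
  add_mem' := by
    rintro _ _ ⟨m, rfl⟩ ⟨m', rfl⟩
    exact ⟨m + m', smul_add _ _ _⟩
  smul_mem' := by
    rintro x _ ⟨m, rfl⟩
    have hx : x ∈ Submodule.span k (Set.range b.X) := b.X.span_eq ▸ Submodule.mem_top
    induction hx using Submodule.span_induction with
    | mem x hx =>
      obtain ⟨t, rfl⟩ := hx
      refine ⟨(b.q t s : k) • b.X t • m, ?_⟩
      rw [smul_comm, b.X_smul_X_smul t s]
    | zero => exact ⟨0, by rw [zero_smul, smul_zero]⟩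
    | add x y _ _ hx hy =>
      obtain ⟨m1, h1⟩ := hx
      obtain ⟨m2, h2⟩ := hy
      exact ⟨m1 + m2, by rw [smul_add, h1, h2, add_smul]⟩
    | smul r x _ hx =>
      obtain ⟨m1, h1⟩ := hx
      exact ⟨r • m1, by rw [smul_comm, h1, smul_assoc]⟩

theorem multiples_isHomogeneous (M : GrMod 𝒜) (s : S) : IsHomogeneous (b.multiples M s) := by
  rintro _ ⟨m, rfl⟩ g
  exact ⟨M.component (g - ψ s) m, (component_smul' (b.mem s) g m).symm⟩

/-- The target of the multiplication by a basis element. -/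
def mulTarget (M : GrMod 𝒜) (s : S) : GrMod 𝒜 := (M.shift (ψ s)).twist (b.isTwist_q s)

/-- Multiplication by a basis element. -/
def mulHom (M : GrMod 𝒜) (s : S) : M →ₗ[A] b.mulTarget M s :=
  b.toLin ((twistEquiv (b.isTwist_q s) (M.shift (ψ s))).e.symm.toLinearMap ∘ₗ
    (Algebra.lsmul k k M (b.X s) : M →ₗ[k] M)) fun t g m hm => by
    let τ := twistEquiv (b.isTwist_q s) (M.shift (ψ s))
    change τ.e.symm (b.X s • b.X t • m) = b.X t • τ.e.symm (b.X s • m)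
    have hd : b.X s • m ∈ (M.shift (ψ s)).deg g := by
      change b.X s • m ∈ M.deg (g + ψ s)
      rw [add_comm]
      exact M.smul_mem (b.mem s) hm
    exact τ.e.symm_apply_eq.2 ((b.X_smul_X_smul s t m).trans
      (τ.X_smul t g (τ.e.symm (show M.shift (ψ s) from b.X s • m)) hd).symm)

theorem mulHom_isHom (M : GrMod 𝒜) (s : S) : IsHom (b.mulHom M s) := fun g m hm => by
  change b.X s • m ∈ M.deg (g + ψ s)
  rw [add_comm]
  exact M.smul_mem (b.mem s) hm

/-- The cokernel of the multiplication by a basis element. -/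
def mulCoker (M : GrMod 𝒜) (s : S) : GrMod 𝒜 :=
  ((M.quot _ (b.multiples_isHomogeneous M s)).shift (ψ s)).twist (b.isTwist_q s)

/-- The projection to the cokernel of the multiplication by a basis element. -/
def mulCokerπ (M : GrMod 𝒜) (s : S) : b.mulTarget M s →ₗ[A] b.mulCoker M s :=
  (twistEquiv (b.isTwist_q s) (M.shift (ψ s))).conj
    (twistEquiv (b.isTwist_q s) ((M.quot _ (b.multiples_isHomogeneous M s)).shift (ψ s)))
    (M.quotπ _ (b.multiples_isHomogeneous M s)) (shift_isHom (quotπ_isHom _) _)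

/-- Up to shift and twist this relates `M` to its quotients by the kernel and by the image of X^s,
both of which are accessible to Noetherian induction. -/
theorem isShortExact_mul (M : GrMod 𝒜) (s : S) :
    IsShortExact (M₁ := M.quot _ (b.mulHom_isHom M s).ker_isHomogeneous)
      ((LinearMap.ker (b.mulHom M s)).liftQ (b.mulHom M s) le_rfl) (b.mulCokerπ M s) where
  hom_left := by
    rintro g _ ⟨x, hx, rfl⟩
    exact b.mulHom_isHom M s g x hx
  hom_right := TwistEquiv.conj_isHom _ _ _ _
  injective := LinearMap.ker_eq_bot.1 (Submodule.ker_liftQ_eq_bot _ _ _ le_rfl)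
  surjective := TwistEquiv.conj_surjective _ _ _ (quotπ_surjective _)
  exact y := by
    refine Iff.trans (quotπ_eq_zero (M := M) (b.multiples_isHomogeneous M s)) ?_
    constructor
    · rintro ⟨m, hm⟩
      exact ⟨M.quotπ _ (b.mulHom_isHom M s).ker_isHomogeneous m, hm⟩
    · rintro ⟨x, hx⟩
      obtain ⟨m, rfl⟩ := quotπ_surjective (b.mulHom_isHom M s).ker_isHomogeneous x
      exact ⟨m, hx⟩

theorem isShortExact_mul_of_injective (M : GrMod 𝒜) (s : S)
    (h : Function.Injective (b.mulHom M s)) : IsShortExact (b.mulHom M s) (b.mulCokerπ M s) where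
  hom_left := b.mulHom_isHom M s
  hom_right := TwistEquiv.conj_isHom _ _ _ _
  injective := h
  surjective := TwistEquiv.conj_surjective _ _ _ (quotπ_surjective _)
  exact y := quotπ_eq_zero (M := M) (b.multiples_isHomogeneous M s)

end TwistedBasis

namespace GrMod

/-- Noetherian induction on the kernel of a graded epimorphism from the fixed module `M`, carried
out for all targets `L` at once. -/
theorem induction_on_quotients [IsNoetherianRing A] {P : GrMod 𝒜 → Prop}
    (step : ∀ L : GrMod 𝒜, Module.Finite A L →
      (∀ (W : Submodule A L) (hW : IsHomogeneous W), W ≠ ⊥ → P (L.quot W hW)) → P L)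
    (M : GrMod 𝒜) [Module.Finite A M] : P M := by
  have : IsNoetherian A M := isNoetherian_of_isNoetherianRing_of_finite A _
  suffices H : ∀ (U : Submodule A M) (L : GrMod 𝒜) (p : M →ₗ[A] L), IsHom p →
      Function.Surjective p → LinearMap.ker p = U → P L from
    H _ M LinearMap.id IsHom.id Function.surjective_id rfl
  intro U
  induction U using WellFoundedGT.induction with
  | ind U ih =>
    rintro L p hp hsurj rfl
    refine step L (Module.Finite.of_surjective p hsurj) fun W hW hne => ?_
    refine ih _ ?_ _ (L.quotπ W hW ∘ₗ p) ((quotπ_isHom hW).comp hp)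
      ((quotπ_surjective hW).comp hsurj) rfl
    refine lt_of_le_of_ne (fun x hx => ?_) fun heq => hne ((Submodule.eq_bot_iff _).2 ?_)
    · exact (congrArg (L.quotπ W hW) hx).trans (map_zero _)
    · intro w hw
      obtain ⟨x, rfl⟩ := hsurj w
      have : x ∈ LinearMap.ker (L.quotπ W hW ∘ₗ p) := (quotπ_eq_zero hW).2 hw
      rw [← heq] at this
      exact this

variable (b : TwistedBasis 𝒜 ψ) (hψ : IsPositive ψ) {D : G →+ ℤ}
  (hD : ∀ s, s ≠ 0 → 0 < D (ψ s)) {d : ℕ} {L : GrMod 𝒜} {s : S}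

include b hψ

theorem isExtSmall_of_mulTarget (h : (b.mulTarget L s).IsExtSmall D d) : L.IsExtSmall D d := by
  have h1 := (h.twist hψ (b.isTwist_q s).symm (twistEquiv _ _).symm).shift (-ψ s)
  rwa [shift_shift, neg_add_cancel, shift_zero] at h1

theorem isExtSmall_mulCoker (h : (L.quot _ (b.multiples_isHomogeneous L s)).IsExtSmall D d) :
    (b.mulCoker L s).IsExtSmall D d :=
  (h.shift _).twist hψ (b.isTwist_q s) (twistEquiv _ _)

include hD

/-- The substitute for Nakayama's lemma. The cokernel of X^s has vanishing Ext, so vanishing of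
Ext^i passes from the twisted shift of `L` by `ψ s` back to `L`. Iterating raises the shift until
`exists_extZero_shift` applies. -/
theorem isExtSmall_of_injective [IsNoetherianRing A] [Module.Finite A L] (hs : s ≠ 0)
    (hinj : Function.Injective (b.mulHom L s))
    (h : (L.quot _ (b.multiples_isHomogeneous L s)).IsExtSmall D d) : L.IsExtSmall D d := by
  intro a N hN i hi
  obtain ⟨m, hm⟩ := exists_extZero_shift D L a i
  -- Induction on the deficit `n`: replacing `l` by `l + ψ s` raises `D l` by at least one. The
  -- module `N` is quantified because the twist on the source is moved onto `N` in each step,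
  -- without changing the bound `a`.
  have key : ∀ n : ℕ, ∀ l, m - n ≤ D l → ∀ N : GrMod 𝒜, N.ExtBounded D d a →
      ExtZero i (L.shift l) N := by
    intro n
    induction n with
    | zero => exact fun l hl N hN => hm l (by simpa using hl) N hN.1
    | succ n ih =>
      intro l hl N hN
      have E : IsShortExact (M₁ := L.shift l) (M₂ := (b.mulTarget L s).shift l)
          (M₃ := (b.mulCoker L s).shift l) (b.mulHom L s) (b.mulCokerπ L s) :=
        have E := b.isShortExact_mul_of_injective L s hinj
        ⟨shift_isHom E.hom_left l, shift_isHom E.hom_right l, E.injective, E.surjective, E.exact⟩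
      refine E.extZero_left (by omega) ?_
        ((isExtSmall_mulCoker b hψ h).shift l a N hN (i + 1) (by omega))
      have hc := b.isTwist_q s
      rw [extZero_shift]
      have hN' : (N.shift (-l)).ExtBounded D d (a - D (-l)) := hN.shift (-l)
      refine ((twistEquiv hc (L.shift (ψ s))).extZero_iff hc (.untwist hc (N.shift (-l)))).2 ?_
      have h1 := ih (l + ψ s) (by
        have := hD s hs
        rw [map_add]
        push_cast at hl
        omega) _ ((hN'.twist hψ hc (.untwist hc (N.shift (-l)))).shift l |> fun h => by
          rw [map_neg, sub_neg_eq_add, add_sub_cancel_right] at h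
          exact h)
      rw [← shift_shift, extZero_shift, shift_shift, neg_add_cancel, shift_zero] at h1
      exact h1
  have := key (m.toNat) 0 (by rw [map_zero]; omega) N hN
  rwa [shift_zero] at this

/-- When 𝔪 kills `L`, a nonzero homogeneous element spans a shifted copy of k, for which the claim
is the hypothesis on `N`; the quotient is covered by induction. -/
theorem isExtSmall_of_smul_eq_zero (h0 : ∀ s, s ≠ 0 → ∀ x : L, b.X s • x = 0) {g : G} {m : L}
    (hm : m ∈ L.deg g) (hm0 : m ≠ 0) (h : ∀ (W : Submodule A L) (hW : IsHomogeneous W), W ≠ ⊥ →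
      (L.quot W hW).IsExtSmall D d) : L.IsExtSmall D d := by
  have hs : ∀ a : A, a • m = b.augmentation hψ a • m := by
    intro a
    have ha : a ∈ Submodule.span k (Set.range b.X) := b.X.span_eq ▸ Submodule.mem_top
    induction ha using Submodule.span_induction with
    | mem x hx =>
      obtain ⟨s, rfl⟩ := hx
      by_cases hs : s = 0
      · rw [hs, b.one, map_one, one_smul, one_smul]
      · rw [h0 s hs, b.augmentation_X hψ hs, zero_smul]
    | zero => rw [map_zero, zero_smul, zero_smul]
    | add x y _ _ hx hy => rw [map_add, add_smul, add_smul, hx, hy]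
    | smul r x _ hx => rw [b.augmentation_smul, smul_assoc, hx, mul_smul]
  let f : (trivialModule 𝒜).shift (-g) →ₗ[A] L :=
    (augIdeal 𝒜).liftQ (LinearMap.toSpanSingleton A L m) fun a ha => by
      change a • m = 0
      rw [hs, (b.mem_augIdeal hψ).1 ha, zero_smul]
  have hf : IsHom f := by
    intro h x hx
    change x ∈ (if h + -g = 0 then (⊤ : AddSubgroup (trivialModule 𝒜)) else ⊥) at hx
    split_ifs at hx with hg
    · obtain ⟨a, rfl⟩ := Submodule.Quotient.mk_surjective _ x
      change a • m ∈ L.deg h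
      rw [hs, eq_of_sub_eq_zero ((sub_eq_add_neg h g).trans hg)]
      exact base_smul_mem _ hm
    · have hx' : x = 0 := hx
      rw [hx', map_zero]
      exact zero_mem _
  have hinj : Function.Injective f := by
    refine (injective_iff_map_eq_zero _).2 fun x hx => ?_
    obtain ⟨a, rfl⟩ := Submodule.Quotient.mk_surjective _ x
    have hx' : a • m = 0 := hx
    rw [hs, smul_eq_zero_iff_left hm0] at hx'
    exact (Submodule.Quotient.mk_eq_zero _).2 ((b.mem_augIdeal hψ).2 hx')
  have E : IsShortExact f (L.quotπ _ hf.range_isHomogeneous) :=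
    ⟨hf, quotπ_isHom _, hinj, quotπ_surjective _, fun x => quotπ_eq_zero _⟩
  refine E.isExtSmall (fun a N hN i hi => hN.2 i hi _) (h _ _ fun hbot => hm0 ?_)
  have : m ∈ LinearMap.range f := ⟨(augIdeal 𝒜).mkQ 1, one_smul A m⟩
  rw [hbot] at this
  exact this

/-- If some X^s with `s ≠ 0` acts nontrivially on `L`, then L/X^sL is a proper quotient. When X^s is
injective this suffices; otherwise the quotient by its kernel is proper too, and the two together
build the twisted shift of `L`. -/
theorem isExtSmall_of_finite [IsNoetherianRing A] (M : GrMod 𝒜) [Module.Finite A M] :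
    M.IsExtSmall D d := by
  refine induction_on_quotients (P := fun M => M.IsExtSmall D d) (fun L hL ih => ?_) M
  by_cases h0 : ∀ s, s ≠ 0 → ∀ x : L, b.X s • x = 0
  · by_cases hm : ∃ g, ∃ m ∈ L.deg g, m ≠ 0
    · obtain ⟨g, m, hm, hm0⟩ := hm
      exact isExtSmall_of_smul_eq_zero b hψ hD h0 hm hm0 ih
    · push Not at hm
      have : Subsingleton L := ⟨fun x y => component_ext fun g => by
        rw [hm g _ (component_mem _ _ _), hm g _ (component_mem _ _ _)]⟩
      exact L.isExtSmall_of_subsingleton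
  · push Not at h0
    obtain ⟨s, hs, x, hx⟩ := h0
    have h1 : (L.quot _ (b.multiples_isHomogeneous L s)).IsExtSmall D d := by
      refine ih _ _ fun hbot => hx ?_
      have : b.X s • x ∈ b.multiples L s := ⟨x, rfl⟩
      rw [hbot] at this
      exact this
    by_cases hker : LinearMap.ker (b.mulHom L s) = ⊥
    · exact isExtSmall_of_injective b hψ hD hs (LinearMap.ker_eq_bot.1 hker) h1
    · exact isExtSmall_of_mulTarget b hψ ((b.isShortExact_mul L s).isExtSmall (ih _ _ hker)
        (isExtSmall_mulCoker b hψ h1))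

end GrMod

end Bass

/-! ### Injective dimension of the algebra, and global dimension. -/

section Dimensions

variable {G : Type u} [AddCommGroup G] [DecidableEq G]
variable {k : Type v} [Field k]
variable {A : Type w} [Ring A] [Algebra k A] {𝒜 : G → Submodule k A} [GradedAlgebra 𝒜]
variable {S : Type u'} [AddCommMonoid S] {ψ : S →+ G}

open GrMod

/-- The basis of the opposite algebra. -/
def TwistedBasis.op (b : TwistedBasis 𝒜 ψ) : TwistedBasis (opGrading 𝒜) ψ where
  X := b.X.map (MulOpposite.opLinearEquiv k)
  α s t := b.α t s
  mul s t := MulOpposite.unop_injective (by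
    change b.X t * b.X s = (b.α t s : k) • b.X (s + t)
    rw [b.mul, add_comm])
  one := MulOpposite.unop_injective b.one
  mem s := b.mem s

variable (b : TwistedBasis 𝒜 ψ) (hψ : IsPositive ψ) {D : G →+ ℤ}
  (hD : ∀ s, s ≠ 0 → 0 < D (ψ s))

namespace GrMod

section

include b hD

theorem boundedBelow_self : (selfModule 𝒜).BoundedBelow D 0 := by
  intro g hg x hx
  have h1 := b.mem_span_of_mem (show x ∈ 𝒜 g from hx)
  have h2 : {s | ψ s = g} = ∅ := by
    refine Set.eq_empty_iff_forall_notMem.2 fun s hs => ?_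
    have hs' : ψ s = g := hs
    rw [← hs'] at hg
    by_cases h0 : s = 0
    · rw [h0, map_zero, map_zero] at hg
      exact hg.false
    · exact (hD s h0).not_gt hg
  rw [h2, Set.image_empty, Submodule.span_empty] at h1
  exact h1

/-- A finite free cover starts in the least degree of its generators, since the algebra lives in
nonnegative `D`-degrees. -/
theorem exists_boundedBelow (M : GrMod 𝒜) [hM : Module.Finite A M] : ∃ a, M.BoundedBelow D a := by
  obtain ⟨I, d, p, hp, hsurj, hfin⟩ := exists_cover M
  have := hfin hM
  obtain ⟨a, ha⟩ := (Set.finite_range fun i => D (d i)).bddBelow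
  refine ⟨a, fun g hg x hx => ?_⟩
  obtain ⟨y, rfl⟩ := hsurj x
  have h1 : (free 𝒜 I d).component g y = 0 := by
    have h2 := component_mem (free 𝒜 I d) g y
    refine Finsupp.ext fun i => boundedBelow_self b hD (g - d i) ?_ _ (h2 i)
    have := ha ⟨i, rfl⟩
    simp only [map_sub] at this ⊢
    omega
  rw [← component_of_mem hx, hp.component, h1, map_zero]

end

variable [IsNoetherianRing A]

include b hψ

/-- Bass' theorem: the injective dimension of the algebra is detected by the trivial module. -/
theorem exists_injRes_self {n : ℕ}
    (h : ∀ i, n < i → ∀ g, ExtZero i (trivialModule 𝒜) ((selfModule 𝒜).shift g)) :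
    ∃ Q : InjRes (selfModule 𝒜), ∀ i, n < i → Subsingleton (Q.I i) := by
  obtain ⟨D, hD⟩ := id hψ
  refine exists_injRes_of_extZero n _ fun M hM =>
    isExtSmall_of_finite b hψ hD M 0 _ ⟨boundedBelow_self b hD, fun i hi g => ?_⟩ _ n.lt_succ_self
  exact extZero_shift.2 (h i hi (-g))

/-- The global dimension is detected by the trivial module. -/
theorem grGlobalDim_eq : grGlobalDim 𝒜 = grProjDim (trivialModule 𝒜) := by
  refine le_antisymm (iSup_le fun M => le_sInf ?_)
    (le_iSup (fun M : GrMod 𝒜 => grProjDim M) (trivialModule 𝒜))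
  rintro _ ⟨n, rfl, R, hR⟩
  obtain ⟨D, hD⟩ := id hψ
  -- The restrictions on `M` and `N` are removed one at a time; finitely generated `N` are bounded
  -- below.
  have h1 : ∀ M N : GrMod 𝒜, Module.Finite A M → Module.Finite A N → ExtZero (n + 1) M N := by
    intro M N hM hN
    obtain ⟨a, ha⟩ := exists_boundedBelow b hD N
    refine isExtSmall_of_finite b hψ hD M a N ⟨ha, fun i hi g => ?_⟩ _ n.lt_succ_self
    have := hR i hi
    exact extZero_shift.2 (extZero_of_projRes R)
  -- Testing against finitely generated syzygies already yields a projective resolution of length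
  -- `n`, which disposes of arbitrary `N`.
  have h2 : ∀ M N : GrMod 𝒜, Module.Finite A M → ExtZero (n + 1) M N := by
    intro M N hM
    obtain ⟨R, hR⟩ := exists_projRes_of_extZero (C := fun M : GrMod 𝒜 => Module.Finite A M)
      (fun M hM => syzygy_finite M) n M hM fun N hN => h1 M N hM hN
    have := hR (n + 1) n.lt_succ_self
    exact extZero_of_projRes R
  -- By Baer's criterion every `N` now has an injective resolution of length `n`, which disposes of
  -- arbitrary `M`.
  obtain ⟨R, hR⟩ := exists_projRes_of_extZero (C := fun _ : GrMod 𝒜 => True) (fun _ _ => trivial) n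
    M trivial fun N _ => by
      obtain ⟨Q, hQ⟩ := exists_injRes_of_extZero n N fun M hM => h2 M N hM
      have := hQ (n + 1) n.lt_succ_self
      exact extZero_of_injRes Q
  exact sInf_le ⟨n, rfl, R, hR⟩

end GrMod

end Dimensions

section Gorenstein

variable {G : Type u} [AddCommGroup G] [DecidableEq G]
variable {k : Type v} [Field k]
variable {A : Type w} [Ring A] [Algebra k A] {𝒜 : G → Submodule k A} [GradedAlgebra 𝒜]

open GrMod

/-! ### Homogeneous components of maps into the algebra -/

/-- The pointwise formula for the components is what lets the cocycle and coboundary conditions pass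
from `φ` to each `f j`. -/
theorem exists_components_of_mem_gradedDual {M : GrMod 𝒜} {φ : M →ₗ[A] A} (hφ : φ ∈ gradedDual M) :
    ∃ (s : Finset G) (f : G → M →ₗ[A] A), (∀ j, f j ∈ dualDeg M j) ∧ ∑ j ∈ s, f j = φ ∧
      (∀ j ∉ s, f j = 0) ∧
      ∀ j i, ∀ m ∈ M.deg i, f j m = (selfModule 𝒜).component (i + j) (φ m) := by
  change φ ∈ (⨆ g : G, dualDeg M g : AddSubgroup (M →ₗ[A] A)) at hφ
  induction hφ using AddSubgroup.iSup_induction' with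
  | h1 =>
    exact ⟨∅, 0, fun j => zero_mem _, rfl, fun _ _ => rfl, fun j i m _ => (map_zero _).symm⟩
  | hadd x y _ _ hx hy =>
    obtain ⟨s, f, h1, h2, h3, h4⟩ := hx
    obtain ⟨s', f', h1', h2', h3', h4'⟩ := hy
    refine ⟨s ∪ s', f + f', fun j => add_mem (h1 j) (h1' j), ?_, fun j hj => ?_,
      fun j i m hm => ?_⟩
    · simp only [Pi.add_apply]
      rw [Finset.sum_add_distrib, ← h2, ← h2']
      congr 1
      · exact (Finset.sum_subset Finset.subset_union_left fun j _ hj => h3 j hj).symm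
      · exact (Finset.sum_subset Finset.subset_union_right fun j _ hj => h3' j hj).symm
    · rw [Finset.mem_union, not_or] at hj
      rw [Pi.add_apply, h3 j hj.1, h3' j hj.2, add_zero]
    · exact (congrArg₂ (· + ·) (h4 j i m hm) (h4' j i m hm)).trans (map_add _ _ _).symm
  | hp g f hf =>
    refine ⟨{g}, fun j => if j = g then f else 0, fun j => ?_, by simp, fun j hj => ?_,
      fun j i m hm => ?_⟩
    · dsimp only
      split_ifs with h
      · rw [h]
        exact hf
      · exact zero_mem _
    · exact if_neg (by simpa using hj)
    · by_cases h : j = g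
      · subst h
        refine (LinearMap.congr_fun (if_pos rfl) m).trans ?_
        exact (component_of_mem (M := selfModule 𝒜) (hf i m hm)).symm
      · refine (LinearMap.congr_fun (if_neg h) m).trans ?_
        exact (component_of_mem_ne (M := selfModule 𝒜) (fun h' => h (add_left_cancel h').symm)
          (hf i m hm)).symm

theorem dualDeg_le_gradedDual {M : GrMod 𝒜} {g : G} {f : M →ₗ[A] A} (hf : f ∈ dualDeg M g) :
    f ∈ gradedDual M := AddSubgroup.mem_iSup_of_mem (S := fun g => dualDeg M g) g hf

theorem linearMap_ext_homogeneous {M : GrMod 𝒜} {N : Type*} [AddCommGroup N] [Module A N]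
    {f f' : M →ₗ[A] N} (h : ∀ g, ∀ m ∈ M.deg g, f m = f' m) : f = f' := by
  refine LinearMap.ext fun m => ?_
  induction m using homogeneous_induction with
  | zero => rw [map_zero, map_zero]
  | homogeneous g m hm => exact h g m hm
  | add m m' hm hm' => rw [map_add, map_add, hm, hm']

namespace ProjRes

variable {M : GrMod 𝒜} (R : ProjRes M)

theorem exists_cocycle_components {i : ℕ} {φ : R.P i →ₗ[A] A} (hφ : φ ∈ R.cocycles i) :
    ∃ (s : Finset G) (f : G → R.P i →ₗ[A] A),
      (∀ j, f j ∈ dualDeg (R.P i) j ∧ f j ∈ R.cocycles i) ∧ ∑ j ∈ s, f j = φ := by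
  obtain ⟨s, f, h1, h2, -, h4⟩ := exists_components_of_mem_gradedDual hφ.1
  refine ⟨s, f, fun j => ⟨h1 j, dualDeg_le_gradedDual (h1 j), ?_⟩, h2⟩
  refine linearMap_ext_homogeneous fun g m hm => ?_
  refine (h4 j g _ (R.d_hom i g m hm)).trans ?_
  exact (congrArg _ (LinearMap.congr_fun hφ.2 m)).trans (map_zero _)

/-- Homogeneous cocycles with values in the algebra. -/
theorem cocycle_iff {i : ℕ} {g : G} (f : R.P i →ₗ[A] A) :
    R.toLeftRes.Cocycle i (N := (selfModule 𝒜).shift g) f ↔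
      f ∈ dualDeg (R.P i) g ∧ f ∈ R.cocycles i :=
  ⟨fun h => ⟨h.1, dualDeg_le_gradedDual h.1, h.2⟩, fun h => ⟨h.1, h.2.2⟩⟩

/-- Homogeneous coboundaries with values in the algebra. -/
theorem coboundary_iff {i : ℕ} {g : G} {f : R.P i →ₗ[A] A} (hf : f ∈ dualDeg (R.P i) g) :
    R.toLeftRes.Coboundary i (N := (selfModule 𝒜).shift g) f ↔ f ∈ R.coboundaries i := by
  cases i with
  | zero =>
    constructor
    · rintro ⟨h, -, h0, rfl⟩
      rw [h0 rfl]
      exact LinearMap.zero_comp _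
    · intro h
      exact ⟨0, IsHom.zero, fun _ => rfl, (LinearMap.zero_comp _).trans
        ((Submodule.mem_bot _).1 h).symm⟩
  | succ i =>
    constructor
    · rintro ⟨h, hh, -, rfl⟩
      exact ⟨h, dualDeg_le_gradedDual hh, rfl⟩
    · rintro ⟨h, hh, rfl⟩
      obtain ⟨s, c, h1, -, -, h4⟩ := exists_components_of_mem_gradedDual hh
      refine ⟨c g, h1 g, fun h => by omega, linearMap_ext_homogeneous fun j m hm => ?_⟩
      refine (h4 g j _ (R.d_hom i j m hm)).trans ?_
      exact component_of_mem (M := selfModule 𝒜) (hf j m hm)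

theorem mem_coboundaries_of_extZero {i : ℕ} {g : G}
    (h : R.toLeftRes.ExtZero i ((selfModule 𝒜).shift g)) {f : R.P i →ₗ[A] A}
    (hf : f ∈ dualDeg (R.P i) g) (hf' : f ∈ R.cocycles i) : f ∈ R.coboundaries i :=
  (R.coboundary_iff hf).1 (h f ((R.cocycle_iff f).2 ⟨hf, hf'⟩))

theorem subsingleton_ext_iff (i : ℕ) :
    Subsingleton (R.ext i) ↔ ∀ g, R.toLeftRes.ExtZero i ((selfModule 𝒜).shift g) := by
  rw [Submodule.subsingleton_iff_eq_bot, Submodule.eq_bot_iff]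
  constructor
  · intro H g f hf
    obtain ⟨h1, h2⟩ := (R.cocycle_iff f).1 hf
    exact (R.coboundary_iff h1).2 ((Submodule.Quotient.mk_eq_zero _).1 (H _ ⟨f, h2, rfl⟩))
  · rintro H _ ⟨φ, hφ, rfl⟩
    refine (Submodule.Quotient.mk_eq_zero _).2 ?_
    obtain ⟨s, f, hf, rfl⟩ := R.exists_cocycle_components hφ
    exact sum_mem fun j _ => R.mem_coboundaries_of_extZero (H j) (hf j).1 (hf j).2

end ProjRes

end Gorenstein

/-! ### The Gorenstein condition in terms of Ext(k, A[g]) alone. -/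

section Gorenstein

variable {G : Type u} [AddCommGroup G] [DecidableEq G]
variable {k : Type v} [Field k]
variable {A : Type w} [Ring A] [Algebra k A] {𝒜 : G → Submodule k A} [GradedAlgebra 𝒜]
variable {S : Type u'} [AddCommMonoid S] {ψ : S →+ G}

open GrMod

namespace ProjRes

variable {M : GrMod 𝒜} (R : ProjRes M)

/-- The class of a cocycle. -/
def extClass {i : ℕ} (φ : R.P i →ₗ[A] A) (hφ : φ ∈ R.cocycles i) : R.ext i :=
  ⟨(R.coboundaries i).mkQ φ, φ, hφ, rfl⟩

theorem extClass_eq_zero {i : ℕ} {φ : R.P i →ₗ[A] A} (hφ : φ ∈ R.cocycles i) :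
    R.extClass φ hφ = 0 ↔ φ ∈ R.coboundaries i :=
  Subtype.ext_iff.trans (Submodule.Quotient.mk_eq_zero _)

/-- Scalars act on the target from the left in `GrMod` and from the right on Ext; they agree because
`k` is central. -/
theorem base_smul_eq {i : ℕ} (g : G) (r : k) (φ : R.P i →ₗ[A] A) :
    (show R.toLeftRes.X (i + 1) →ₗ[A] (selfModule 𝒜).shift g from
      r • (show R.toLeftRes.X (i + 1) →ₗ[A] (selfModule 𝒜).shift g from φ)) =
      algebraMap k Aᵐᵒᵖ r • φ :=
  LinearMap.ext fun m => (Algebra.commutes r (φ m))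

theorem extOneDim_self_iff {i : ℕ} {g : G} :
    R.toLeftRes.ExtOneDim i ((selfModule 𝒜).shift g) ↔ ∃ z : R.P i →ₗ[A] A,
      z ∈ dualDeg (R.P i) g ∧ z ∈ R.cocycles i ∧ z ∉ R.coboundaries i ∧
      ∀ f ∈ dualDeg (R.P i) g, f ∈ R.cocycles i →
        ∃ r : k, f - algebraMap k Aᵐᵒᵖ r • z ∈ R.coboundaries i := by
  have hmem : ∀ f z : R.P i →ₗ[A] A, f ∈ dualDeg (R.P i) g → z ∈ dualDeg (R.P i) g → ∀ r : k,
      f - algebraMap k Aᵐᵒᵖ r • z ∈ dualDeg (R.P i) g := by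
    intro f z hf hz r
    have : IsHom (N := (selfModule 𝒜).shift g) z := hz
    rw [← R.base_smul_eq g r z]
    exact sub_mem hf (this.smul r)
  constructor
  · rintro ⟨z, hz, hz', H⟩
    have hz1 := (R.cocycle_iff z).1 hz
    refine ⟨z, hz1.1, hz1.2, fun h => hz' ((R.coboundary_iff hz1.1).2 h), fun f h1 h2 => ?_⟩
    obtain ⟨r, hr⟩ := H f ((R.cocycle_iff f).2 ⟨h1, h2⟩)
    have h3 := R.base_smul_eq g r z
    refine ⟨r, (R.coboundary_iff (hmem f z h1 hz1.1 r)).1 ?_⟩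
    rw [← h3]
    exact hr
  · rintro ⟨z, hz, hz', hz'', H⟩
    refine ⟨z, (R.cocycle_iff z).2 ⟨hz, hz'⟩, fun h => hz'' ((R.coboundary_iff hz).1 h),
      fun f hf => ?_⟩
    obtain ⟨h1, h2⟩ := (R.cocycle_iff f).1 hf
    obtain ⟨r, hr⟩ := H f h1 h2
    have h3 := (R.coboundary_iff (hmem f z h1 hz r)).2 hr
    rw [← R.base_smul_eq g r z] at h3
    exact ⟨r, h3⟩

end ProjRes

/-- The conditions on `Ext(k, A)` in the definition of AS-Gorenstein algebras. -/
structure IsGorensteinExt (𝒜 : G → Submodule k A) [GradedAlgebra 𝒜] (n : ℕ) (l : G) : Prop where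
  zero_of_ne : ∀ i ≠ n, ∀ g, ExtZero i (trivialModule 𝒜) ((selfModule 𝒜).shift g)
  zero : ∀ g ≠ -l, ExtZero n (trivialModule 𝒜) ((selfModule 𝒜).shift g)
  oneDim : ExtOneDim n (trivialModule 𝒜) ((selfModule 𝒜).shift (-l))

variable (b : TwistedBasis 𝒜 ψ) (hψ : IsPositive ψ) {n : ℕ} {l : G}

theorem extOneDim_not_extZero {i : ℕ} {M N : GrMod 𝒜} (h : ExtOneDim i M N) : ¬ ExtZero i M N := by
  obtain ⟨z, hz, hz', -⟩ := h
  exact fun h => hz' (h z hz)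

include b hψ

/-- The module k[l] is one-dimensional and lives in degree `-l`; the graded isomorphism transfers
this to Ext^n. -/
theorem IsLeftASGorensteinWith.isGorensteinExt (h : IsLeftASGorensteinWith 𝒜 n l) :
    IsGorensteinExt 𝒜 n l := by
  obtain ⟨-, R, ⟨e, he⟩, hR⟩ := h
  let τ := b.op.trivialEquiv hψ
  refine ⟨fun i hi g => ?_, fun g hg => ?_, ?_⟩
  · rw [extZero_iff_proj R]
    exact (R.subsingleton_ext_iff i).1 (hR i hi) g
  · rw [extZero_iff_proj R]
    intro f hf
    obtain ⟨h1, h2⟩ := (R.cocycle_iff f).1 hf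
    refine (R.coboundary_iff h1).2 ((R.extClass_eq_zero h2).1 (e.map_eq_zero_iff.1 ?_))
    have h3 := (he g _).1 (show R.extClass f h2 ∈ R.extDeg n g from ⟨f, h2, h1, rfl⟩)
    change _ ∈ (if g + l = 0 then (⊤ : AddSubgroup (trivialModule (opGrading 𝒜))) else ⊥) at h3
    rwa [if_neg fun h => hg (eq_neg_of_add_eq_zero_left h)] at h3
  · rw [extOneDim_iff_proj R, R.extOneDim_self_iff]
    let y : (trivialModule (opGrading 𝒜)).shift l := τ.symm 1
    have hy : e.symm y ∈ R.extDeg n (-l) := by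
      rw [he, e.apply_symm_apply]
      change _ ∈ (if -l + l = 0 then (⊤ : AddSubgroup (trivialModule (opGrading 𝒜))) else ⊥)
      rw [if_pos (neg_add_cancel l)]
      trivial
    obtain ⟨z, hz, hz', hzy⟩ := hy
    have hzy' : R.extClass z hz = e.symm y := Subtype.ext hzy
    have key : ∀ r : k, e (algebraMap k Aᵐᵒᵖ r • R.extClass z hz) = τ.symm r := by
      intro r
      rw [map_smul, hzy', e.apply_symm_apply]
      refine (map_smul τ.symm r 1).symm.trans ?_
      rw [smul_eq_mul, mul_one]
    refine ⟨z, hz', hz, fun h => ?_, fun f h1 h2 => ?_⟩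
    · have h2 := key 1
      rw [(R.extClass_eq_zero hz).2 h, smul_zero, map_zero] at h2
      exact one_ne_zero (τ.symm.map_eq_zero_iff.1 h2.symm)
    · let r : k := τ (e (R.extClass f h2))
      refine ⟨r, (Submodule.Quotient.eq _).1 (congrArg Subtype.val (?_ :
        R.extClass f h2 = algebraMap k Aᵐᵒᵖ r • R.extClass z hz))⟩
      apply e.injective
      rw [key]
      exact (τ.symm_apply_apply _).symm

/-- The injective dimension is at most `n` by `exists_injRes_self`, and at least `n` because Ext^n
does not vanish. The module structure comes for free: a basis element X^s with `s ≠ 0` moves the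
class `z` to a degree where Ext^n is zero, so 𝔪 kills `z` and its multiples form k[l]. -/
theorem IsGorensteinExt.isLeftASGorensteinWith [IsNoetherianRing A] (h : IsGorensteinExt 𝒜 n l) :
    IsLeftASGorensteinWith 𝒜 n l := by
  constructor
  · obtain ⟨Q, hQ⟩ := exists_injRes_self b hψ fun i (hi : n < i) g => h.zero_of_ne i (by omega) g
    refine le_antisymm (sInf_le ⟨n, rfl, Q, hQ⟩) (le_sInf ?_)
    rintro _ ⟨m, rfl, Q, hQ⟩
    by_contra hlt
    have := hQ n (by simpa using hlt)
    refine extOneDim_not_extZero h.oneDim (extZero_shift.1 ?_ : ExtZero n _ _)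
    exact extZero_of_injRes Q
  · let R := (trivialModule 𝒜).projRes
    let τ := b.op.trivialEquiv hψ
    have h0 : ∀ g ≠ -l, ∀ f : R.P n →ₗ[A] A, f ∈ dualDeg (R.P n) g → f ∈ R.cocycles n →
        f ∈ R.coboundaries n := fun g hg f => R.mem_coboundaries_of_extZero
      ((extZero_iff_proj R n).1 (h.zero g hg))
    obtain ⟨z, hz1, hz2, hz3, H⟩ :=
      R.extOneDim_self_iff.1 ((extOneDim_iff_proj R n).1 h.oneDim)
    have hz4 : R.extClass z hz2 ≠ 0 := fun h => hz3 ((R.extClass_eq_zero hz2).1 h)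
    let F' := LinearMap.toSpanSingleton Aᵐᵒᵖ _ (R.extClass z hz2)
    have hF' : augIdeal (opGrading 𝒜) ≤ LinearMap.ker F' := by
      intro a ha
      have h1 := (b.op.augmentation_eq_zero_iff_mem_span hψ a).1 ((b.op.mem_augIdeal hψ).1 ha)
      refine (Submodule.span_le (p := (LinearMap.ker F').restrictScalars k)).2 ?_ h1
      rintro _ ⟨s, hs, rfl⟩
      have hmem : b.op.X s • z ∈ R.cocycles n := (R.cocycles n).smul_mem _ hz2
      refine (R.extClass_eq_zero hmem).2 (h0 (-l + ψ s)
        (fun h => hψ.ne_zero hs (by simpa using h)) _ ?_ hmem)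
      intro j m hm
      rw [← add_assoc]
      exact SetLike.GradedMul.mul_mem (hz1 j m hm) (b.mem s)
    let F : (trivialModule (opGrading 𝒜)).shift l →ₗ[Aᵐᵒᵖ] R.ext n :=
      (augIdeal (opGrading 𝒜)).liftQ F' hF'
    have hF : ∀ r, F (τ.symm r) = algebraMap k Aᵐᵒᵖ r • R.extClass z hz2 := fun r => rfl
    have hinj : Function.Injective F := by
      refine (injective_iff_map_eq_zero _).2 fun x hx => ?_
      have h1 : τ.symm (τ x) = x := τ.symm_apply_apply x
      rw [← h1, hF] at hx
      by_cases h2 : τ x = 0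
      · exact τ.map_eq_zero_iff.1 h2
      · refine (hz4 ?_).elim
        have h3 := congrArg (fun y => algebraMap k Aᵐᵒᵖ (τ x)⁻¹ • y) hx
        simpa only [smul_zero, smul_smul, ← map_mul, inv_mul_cancel₀ h2, map_one, one_smul] using h3
    have hsurj : Function.Surjective F := by
      rintro ⟨_, φ, hφ, rfl⟩
      suffices hs : (R.coboundaries n).mkQ φ ∈ (LinearMap.range F).map (Submodule.subtype _) by
        obtain ⟨_, ⟨x, rfl⟩, hx⟩ := hs
        exact ⟨x, Subtype.ext hx⟩
      obtain ⟨s, f, hf, rfl⟩ := R.exists_cocycle_components hφ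
      rw [map_sum]
      refine sum_mem fun j _ => ?_
      by_cases hj : j = -l
      · subst hj
        obtain ⟨r, hr⟩ := H (f (-l)) (hf (-l)).1 (hf (-l)).2
        exact ⟨_, ⟨τ.symm r, rfl⟩, ((Submodule.Quotient.eq _).2 hr).symm⟩
      · have := (Submodule.Quotient.mk_eq_zero _).2 (h0 j hj _ (hf j).1 (hf j).2)
        exact ⟨0, zero_mem _, this.symm⟩
    refine ⟨R, ⟨(LinearEquiv.ofBijective F ⟨hinj, hsurj⟩).symm, fun g x => ?_⟩, fun i hi =>
      (R.subsingleton_ext_iff i).2 fun g => (extZero_iff_proj R i).1 (h.zero_of_ne i hi g)⟩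
    obtain ⟨y, rfl⟩ := (LinearEquiv.ofBijective F ⟨hinj, hsurj⟩).surjective x
    rw [LinearEquiv.symm_apply_apply]
    change F y ∈ R.extDeg n g ↔
      y ∈ (if g + l = 0 then (⊤ : AddSubgroup (trivialModule (opGrading 𝒜))) else ⊥)
    split_ifs with hg
    · have hg' : g = -l := eq_neg_of_add_eq_zero_left hg
      subst hg'
      refine iff_of_true ?_ (AddSubgroup.mem_top y)
      have h1 : τ.symm (τ y) = y := τ.symm_apply_apply y
      rw [← h1, hF]
      refine ⟨algebraMap k Aᵐᵒᵖ (τ y) • z, (R.cocycles n).smul_mem _ hz2, ?_, rfl⟩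
      have h2 : IsHom (N := (selfModule 𝒜).shift (-l)) z := hz1
      rw [← R.base_smul_eq (-l)]
      exact h2.smul _
    · have hg' : g ≠ -l := fun h => hg (by rw [h, neg_add_cancel])
      constructor
      · rintro ⟨φ, hφ, hφ', hx⟩
        have h1 : F y = 0 := Subtype.ext (hx.symm.trans
          ((Submodule.Quotient.mk_eq_zero _).2 (h0 g hg' φ hφ' hφ)))
        exact (map_eq_zero_iff F hinj).1 h1
      · intro hy
        have hy' : y = 0 := hy
        rw [hy', map_zero]
        exact ⟨0, zero_mem _, zero_mem _, map_zero _⟩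

theorem isLeftASGorensteinWith_iff [IsNoetherianRing A] :
    IsLeftASGorensteinWith 𝒜 n l ↔ IsGorensteinExt 𝒜 n l :=
  ⟨fun h => h.isGorensteinExt b hψ, fun h => h.isLeftASGorensteinWith b hψ⟩

end Gorenstein

universe x

/-! ### Coarsening a grading along a homomorphism. -/

section Regrading

variable {G : Type u} [AddCommGroup G] [DecidableEq G] {H : Type x} [AddCommGroup H] [DecidableEq H]
variable {k : Type v} [Field k]
variable {A : Type w} [Ring A] [Algebra k A] {𝒜 : G → Submodule k A} [GradedAlgebra 𝒜]
variable {ℬ : H → Submodule k A} [GradedAlgebra ℬ]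
variable {S : Type u'} [AddCommMonoid S] {ψ : S →+ G} {φ : G →+ H}

open GrMod

/-- The grading `ℬ` is obtained from `𝒜` along `φ`. -/
structure IsRegrading (φ : G →+ H) (𝒜 : G → Submodule k A) [GradedAlgebra 𝒜]
    (ℬ : H → Submodule k A) : Prop where
  le : ∀ g, 𝒜 g ≤ ℬ (φ g)
  component_eq_zero : ∀ h, ∀ a ∈ ℬ h, ∀ g, φ g ≠ h → (selfModule 𝒜).component g a = 0

namespace TwistedBasis

/-- A twisted basis for a coarser grading. -/
def regrade (b : TwistedBasis 𝒜 ψ) (h : ∀ g, 𝒜 g ≤ ℬ (φ g)) : TwistedBasis ℬ (φ.comp ψ) where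
  X := b.X
  α := b.α
  mul := b.mul
  one := b.one
  mem s := h _ (b.mem s)

theorem isRegrading (b : TwistedBasis 𝒜 ψ) (h : ∀ g, 𝒜 g ≤ ℬ (φ g)) : IsRegrading φ 𝒜 ℬ where
  le := h
  component_eq_zero h' a ha g hg := by
    have := (b.regrade h).mem_span_of_mem ha
    clear ha
    induction this using Submodule.span_induction with
    | mem x hx =>
      obtain ⟨s, hs, rfl⟩ := hx
      refine component_of_mem_ne (M := selfModule 𝒜) (g := ψ s) ?_ (b.mem s)
      rintro rfl
      exact hg hs
    | zero => exact map_zero _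
    | add x y _ _ hx hy => exact (map_add _ _ _).trans (by rw [hx, hy, add_zero])
    | smul r x _ hx =>
      have h1 : r • x = (algebraMap k A r : A) * x := Algebra.smul_def r x
      rw [h1]
      refine (component_base_smul (M := selfModule 𝒜) g r x).trans ?_
      rw [hx, smul_zero]

end TwistedBasis

namespace GrMod

/-- A graded module regraded along a homomorphism. -/
def regrade (hr : IsRegrading φ 𝒜 ℬ) (M : GrMod 𝒜) : GrMod ℬ where
  carrier := M.carrier
  deg h := { carrier := {m | ∀ g, φ g ≠ h → M.component g m = 0}
             zero_mem' := fun g _ => map_zero _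
             add_mem' := fun hx hy g hg => by rw [map_add, hx g hg, hy g hg, add_zero]
             neg_mem' := fun hx g hg => by rw [map_neg, hx g hg, neg_zero] }
  isInternal := by
    classical
    refine isInternal_of_projections
      (fun h => (M.scale fun g => if φ g = h then 1 else 0).toAddMonoidHom) ?_ ?_
    · intro h h' m hm
      change (M.scale fun g => if φ g = h' then 1 else 0) m = _
      change ∑ᶠ g, (if φ g = h' then (1 : k) else 0) • M.component g m = _
      rw [← apply_ite (fun m : M => m)]
      split_ifs with hh
      · subst hh
        have : ∀ g, (if φ g = h then (1 : k) else 0) • M.component g m = M.component g m := by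
          intro g
          split_ifs with hg
          · rw [one_smul]
          · rw [hm g hg, smul_zero]
        simp only [this]
        rw [finsum_eq_sum_of_support_subset (s := (finite_component_support m).toFinset) _
          (by simp [Function.support])]
        exact sum_component m _ (by simp)
      · refine finsum_eq_zero_of_forall_eq_zero fun g => ?_
        split_ifs with hg
        · rw [hm g (by rw [hg]; exact Ne.symm hh), smul_zero]
        · rw [zero_smul]
    · intro m
      induction m using homogeneous_induction with
      | zero => exact zero_mem _
      | homogeneous g m hm =>
        exact AddSubgroup.mem_iSup_of_mem (φ g) fun g' hg' =>
          component_of_mem_ne (fun h => hg' (by rw [h])) hm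
      | add m m' hm hm' => exact add_mem hm hm'
  smul_mem {h h' a m} ha hm := by
    intro g hg
    have h1 := sum_component (M := selfModule 𝒜) a
      (finite_component_support (M := selfModule 𝒜) a).toFinset (by simp)
    have h2 : a • m = ∑ g' ∈ (finite_component_support (M := selfModule 𝒜) a).toFinset,
        (show A from (selfModule 𝒜).component g' a) • m := by
      rw [← Finset.sum_smul]
      exact congrArg (· • m) h1.symm
    rw [h2, map_sum]
    refine Finset.sum_eq_zero fun g' _ => ?_
    rw [component_smul' (show (show A from (selfModule 𝒜).component g' a) ∈ 𝒜 g' from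
      component_mem (selfModule 𝒜) g' a)]
    by_cases hg' : φ g' = h
    · rw [hm (g - g') fun h3 => hg ?_, smul_zero]
      rw [← h3, ← hg', ← map_add, add_sub_cancel]
    · have h3 : (show A from (selfModule 𝒜).component g' a) = 0 := hr.component_eq_zero h a ha g' hg'
      rw [h3, zero_smul]

variable (hr : IsRegrading φ 𝒜 ℬ) {M N : GrMod 𝒜}

theorem mem_regrade {g : G} {m : M} (hm : m ∈ M.deg g) : m ∈ (M.regrade hr).deg (φ g) :=
  fun _ hg' => component_of_mem_ne (fun h => hg' (by rw [h])) hm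

/-- Coarse homogeneity need only be checked on finely homogeneous elements, since these sum to the
coarse ones. -/
theorem isHom_of_regrade {Y : GrMod ℬ} (f : M.regrade hr →ₗ[A] Y)
    (h : ∀ g, ∀ m ∈ M.deg g, f m ∈ Y.deg (φ g)) : IsHom f := by
  intro j m hm
  have h1 := sum_component (M := M) m (finite_component_support (M := M) m).toFinset (by simp)
  have h2 : f m = ∑ g ∈ (finite_component_support (M := M) m).toFinset,
      f (show M from M.component g m) := by
    refine (congrArg f h1.symm).trans ?_
    exact map_sum f _ _
  rw [h2]
  refine sum_mem fun g _ => ?_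
  by_cases hg : φ g = j
  · rw [← hg]
    exact h g _ (component_mem _ _ _)
  · have h3 : M.component g m = 0 := hm g hg
    exact (congrArg (· ∈ Y.deg j) ((congrArg f h3).trans (map_zero f))).mpr (zero_mem _)

theorem IsHom.regrade {f : M →ₗ[A] N} (hf : IsHom f) :
    IsHom (M := M.regrade hr) (N := N.regrade hr) f :=
  isHom_of_regrade hr _ fun g m hm => mem_regrade hr (hf g m hm)

theorem free_regrade_isProjective (I : Type w) (d : I → G) :
    ((free 𝒜 I d).regrade hr).IsProjective := by
  intro X Y p f hp hf hsurj
  have : ∀ i, ∃ x ∈ X.deg (φ (d i)), p x = f (freeBasis (𝒜 := 𝒜) d i) := by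
    intro i
    obtain ⟨x, hx⟩ := hsurj (f (freeBasis (𝒜 := 𝒜) d i))
    refine ⟨X.component _ x, component_mem _ _ _, ?_⟩
    rw [← hp.component, hx]
    exact component_of_mem (hf _ _ (mem_regrade hr (freeBasis_mem d i)))
  choose x hx hpx using this
  let h : (free 𝒜 I d).regrade hr →ₗ[A] X := (Finsupp.linearCombination A x : (I →₀ A) →ₗ[A] X)
  refine ⟨h, isHom_of_regrade hr _ fun g m hm => ?_, ?_⟩
  · refine sum_mem fun i _ => ?_
    have := X.smul_mem (hr.le _ (hm i)) (hx i)
    rwa [map_sub, sub_add_cancel] at this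
  · refine free_hom_ext (d := d) (𝒜 := 𝒜) fun i => ?_
    refine Eq.trans (congrArg p ?_) (hpx i)
    exact (Finsupp.linearCombination_single A (1 : A) i).trans (one_smul _ _)

/-- A projective module is a direct summand of its free cover, and for free modules the basis, with
degrees pushed along `φ`, still lifts maps. -/
theorem IsProjective.regrade {P : GrMod 𝒜} (hP : P.IsProjective) :
    (P.regrade hr).IsProjective := by
  intro X Y p f hp hf hsurj
  obtain ⟨s, hs, e⟩ := hP P.cover P P.coverπ LinearMap.id (coverπ_spec P).1 IsHom.id
    (coverπ_spec P).2.1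
  obtain ⟨h, hh, e'⟩ := free_regrade_isProjective hr P.CoverIndex _ X Y p
    (f ∘ₗ (P.coverπ : P.cover.regrade hr →ₗ[A] P.regrade hr)) hp
    (hf.comp ((coverπ_spec P).1.regrade hr)) hsurj
  refine ⟨h ∘ₗ (s : P.regrade hr →ₗ[A] P.cover.regrade hr), hh.comp (hs.regrade hr),
    LinearMap.ext fun x => ?_⟩
  exact (LinearMap.congr_fun e' (s x)).trans (congrArg f (LinearMap.congr_fun e x))

end GrMod

/-- Regrading an augmented left resolution. -/
def LeftRes.regrade (hr : IsRegrading φ 𝒜 ℬ) (L : LeftRes 𝒜) : LeftRes ℬ where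
  X n := (L.X n).regrade hr
  δ n := L.δ n
  δ_hom n := (L.δ_hom n).regrade hr
  surjective := L.surjective
  exact := L.exact

/-- Regrading an augmented right resolution. -/
def RightRes.regrade (hr : IsRegrading φ 𝒜 ℬ) (E : RightRes 𝒜) : RightRes ℬ where
  Y n := (E.Y n).regrade hr
  δ n := E.δ n
  δ_hom n := (E.δ_hom n).regrade hr
  injective := E.injective
  exact := E.exact

/-! ### Homogeneous components of maps -/

namespace GrMod

variable {M N : GrMod 𝒜}

/-- The homogeneous components of a linear map. -/
theorem exists_homComponent (b : TwistedBasis 𝒜 ψ) (f : M →ₗ[A] N) (e : G) :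
    ∃ f' : M →ₗ[A] N, ∀ g, ∀ m ∈ M.deg g, f' m = N.component (g + e) (f m) := by
  obtain ⟨f', h1⟩ : ∃ f' : M →ₗ[k] N, ∀ g, ∀ m ∈ M.deg g, f' m = N.component (g + e) (f m) := by
    obtain ⟨f', hf'⟩ := exists_degree_zero_part (M := N.shift e) (Y := M) (baseLin f)
    exact ⟨f', fun g m hm => (hf' g m hm).trans (component_shift e g _)⟩
  refine ⟨b.toLin (N := N) f' fun s g m hm => ?_, h1⟩
  rw [h1 g m hm, h1 _ _ (M.smul_mem (b.mem s) hm), map_smul, add_assoc, component_smul (b.mem s)]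

/-- A map from a finitely generated module is the sum of its homogeneous components. -/
theorem exists_homComponents (b : TwistedBasis 𝒜 ψ) [hM : Module.Finite A M] (f : M →ₗ[A] N) :
    ∃ (s : Finset G) (F : G → M →ₗ[A] N), ∑ e ∈ s, F e = f ∧
      ∀ e g, ∀ m ∈ M.deg g, F e m = N.component (g + e) (f m) := by
  choose F hF using exists_homComponent b f
  obtain ⟨T, hT, hspan, hfin⟩ := exists_homogeneous_generators M
  choose! d hd using hT
  have hfin := hfin hM
  classical
  -- The degrees by which `f` can move one of the finitely many generators.
  let s : Finset G := hfin.toFinset.biUnion fun t =>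
    (finite_component_support (f t)).toFinset.image fun g => g - d t
  refine ⟨s, F, ?_, hF⟩
  refine LinearMap.ext_on_range (v := ((↑) : T → M)) (by rw [Subtype.range_coe]; exact hspan)
    fun t => ?_
  have h1 : ∑ e ∈ s, N.component (d t + e) (f t) = f t := by
    rw [← Finset.sum_image (f := fun g => N.component g (f t)) (g := fun e => d t + e)
      fun x _ y _ h => add_left_cancel h]
    refine sum_component _ _ fun g hg => ?_
    refine Finset.mem_image.2 ⟨g - d t, ?_, add_sub_cancel _ _⟩
    refine Finset.mem_biUnion.2 ⟨t, by simp, Finset.mem_image.2 ⟨g, by simpa using hg, rfl⟩⟩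
  rw [LinearMap.sum_apply]
  exact (Finset.sum_congr rfl fun e _ => hF e _ _ (hd t t.2)).trans h1

end GrMod

end Regrading

/-! ### Total Ext into the algebra and the degree in which it is concentrated. -/

section TotalExt

variable {G : Type u} [AddCommGroup G] [DecidableEq G]
variable {k : Type v} [Field k]
variable {A : Type w} [Ring A] [Algebra k A] {𝒜 : G → Submodule k A} [GradedAlgebra 𝒜]
variable {S : Type u'} [AddCommMonoid S] {ψ : S →+ G}

open GrMod

namespace ProjRes

variable {M : GrMod 𝒜} (R : ProjRes M)

/-- One-dimensionality of `Ext^n(M, A)`. -/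
def IsOneDimExt (n : ℕ) : Prop := ∃ z ∈ R.cocycles n, z ∉ R.coboundaries n ∧
  ∀ f ∈ R.cocycles n, ∃ r : k, f - algebraMap k Aᵐᵒᵖ r • z ∈ R.coboundaries n

/-- `Ext^n(M, A)` is one-dimensional and concentrated in degree `g`. -/
def IsOneDimExtAt (n : ℕ) (g : G) : Prop :=
  (∀ j ≠ g, ∀ f ∈ dualDeg (R.P n) j, f ∈ R.cocycles n → f ∈ R.coboundaries n) ∧
  ∃ z ∈ dualDeg (R.P n) g, z ∈ R.cocycles n ∧ z ∉ R.coboundaries n ∧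
    ∀ f ∈ dualDeg (R.P n) g, f ∈ R.cocycles n →
      ∃ r : k, f - algebraMap k Aᵐᵒᵖ r • z ∈ R.coboundaries n

theorem subsingleton_ext_iff_le (i : ℕ) :
    Subsingleton (R.ext i) ↔ R.cocycles i ≤ R.coboundaries i := by
  rw [Submodule.subsingleton_iff_eq_bot, Submodule.eq_bot_iff]
  constructor
  · exact fun h f hf => (Submodule.Quotient.mk_eq_zero _).1 (h _ ⟨f, hf, rfl⟩)
  · rintro h _ ⟨f, hf, rfl⟩
    exact (Submodule.Quotient.mk_eq_zero _).2 (h hf)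

variable {R}

theorem component_mem_coboundaries {i : ℕ} {y f : R.P i →ₗ[A] A} (hy : y ∈ R.coboundaries i) {g : G}
    (hf : ∀ j, ∀ m ∈ (R.P i).deg j, f m = (selfModule 𝒜).component (j + g) (y m)) :
    f ∈ R.coboundaries i := by
  cases i with
  | zero =>
    have hy0 : y = 0 := hy
    have : f = 0 := linearMap_ext_homogeneous fun j m hm => by
      rw [hf j m hm, hy0]
      exact map_zero _
    rw [this]
    exact zero_mem _
  | succ i =>
    obtain ⟨h, hh, rfl⟩ := hy
    obtain ⟨s, c, h1, -, -, h4⟩ := exists_components_of_mem_gradedDual hh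
    refine ⟨c g, dualDeg_le_gradedDual (h1 g), linearMap_ext_homogeneous fun j m hm => ?_⟩
    exact (h4 g j _ (R.d_hom i j m hm)).trans (hf j m hm).symm

theorem algebraMap_smul_mem_dualDeg {i : ℕ} {f : R.P i →ₗ[A] A} {g : G}
    (hf : f ∈ dualDeg (R.P i) g) (r : k) : algebraMap k Aᵐᵒᵖ r • f ∈ dualDeg (R.P i) g := by
  have : IsHom (N := (selfModule 𝒜).shift g) f := hf
  rw [← R.base_smul_eq g r f]
  exact this.smul r

theorem IsOneDimExtAt.isOneDimExt {n : ℕ} {g : G} (h : R.IsOneDimExtAt n g) : R.IsOneDimExt n := by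
  obtain ⟨h0, z, hz, hz1, hz2, H⟩ := h
  refine ⟨z, hz1, hz2, fun f hf => ?_⟩
  obtain ⟨s, F, hF, rfl⟩ := R.exists_cocycle_components hf
  have : ∀ j, ∃ r : k, F j - algebraMap k Aᵐᵒᵖ r • z ∈ R.coboundaries n := by
    intro j
    by_cases hj : j = g
    · subst hj
      exact H _ (hF j).1 (hF j).2
    · exact ⟨0, by
        rw [map_zero, zero_smul, sub_zero]
        exact h0 j hj _ (hF j).1 (hF j).2⟩
  choose r hr using this
  refine ⟨∑ j ∈ s, r j, ?_⟩
  rw [map_sum, Finset.sum_smul, ← Finset.sum_sub_distrib]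
  exact sum_mem fun j _ => hr j

/-- A one-dimensional graded space sits in a single degree: some component of a generator is not a
coboundary, so it generates as well, and comparing components kills every class of another degree.
-/
theorem IsOneDimExt.exists_at {n : ℕ} (h : R.IsOneDimExt n) : ∃ g, R.IsOneDimExtAt n g := by
  obtain ⟨z, hz, hz1, H⟩ := h
  obtain ⟨s, F, hF, rfl⟩ := R.exists_cocycle_components hz
  obtain ⟨g, hg⟩ : ∃ g, F g ∉ R.coboundaries n := by
    by_contra hcon
    push Not at hcon
    exact hz1 (sum_mem fun j _ => hcon j)
  set z := ∑ j ∈ s, F j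
  have key : ∀ f ∈ R.cocycles n, ∃ r : k, f - algebraMap k Aᵐᵒᵖ r • F g ∈ R.coboundaries n := by
    intro f hf
    obtain ⟨c, hc⟩ := H _ (hF g).2
    obtain ⟨r, hr⟩ := H f hf
    -- The class of `F g` is `c` times that of `z`, so `c` can be inverted to make `F g` the
    -- generator.
    have hc0 : c ≠ 0 := by
      rintro rfl
      rw [map_zero, zero_smul, sub_zero] at hc
      exact hg hc
    refine ⟨r * c⁻¹, ?_⟩
    have := sub_mem hr ((R.coboundaries n).smul_mem (algebraMap k Aᵐᵒᵖ (r * c⁻¹)) hc)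
    rw [smul_sub, smul_smul, ← map_mul, inv_mul_cancel_right₀ hc0] at this
    rwa [sub_sub_sub_comm, sub_self, sub_zero] at this
  refine ⟨g, fun j hj f hf hf' => ?_, F g, (hF g).1, (hF g).2, hg, fun f _ hf' => key f hf'⟩
  obtain ⟨r, hr⟩ := key f hf'
  refine component_mem_coboundaries hr (g := j) fun i m hm => ?_
  have h1 := component_of_mem (M := selfModule 𝒜) (hf i m hm)
  have h2 := component_of_mem_ne (M := selfModule 𝒜) (h := i + j)
    (fun h => hj (add_left_cancel h).symm) (algebraMap_smul_mem_dualDeg (hF g).1 r i m hm)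
  refine Eq.trans ?_ (map_sub ((selfModule 𝒜).component (i + j)) (f m)
    ((algebraMap k Aᵐᵒᵖ r • F g) m)).symm
  exact ((congrArg₂ (fun x y : A => x - y) h1 h2).trans (sub_zero _)).symm

theorem IsOneDimExtAt.eq_of_not_mem {n : ℕ} {g g' : G} (h : R.IsOneDimExtAt n g)
    {f : R.P n →ₗ[A] A} (hf : f ∈ dualDeg (R.P n) g') (hf' : f ∈ R.cocycles n)
    (hf'' : f ∉ R.coboundaries n) : g' = g := by
  by_contra hne
  exact hf'' (h.1 g' hne f hf hf')

end ProjRes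

theorem isGorensteinExt_iff (R : ProjRes (trivialModule 𝒜)) {n : ℕ} {l : G} :
    IsGorensteinExt 𝒜 n l ↔ (∀ i ≠ n, Subsingleton (R.ext i)) ∧ R.IsOneDimExtAt n (-l) := by
  simp only [R.subsingleton_ext_iff]
  constructor
  · intro h
    refine ⟨fun i hi g => (extZero_iff_proj R i).1 (h.zero_of_ne i hi g), fun j hj f =>
      R.mem_coboundaries_of_extZero ((extZero_iff_proj R n).1 (h.zero j hj)), ?_⟩
    exact R.extOneDim_self_iff.1 ((extOneDim_iff_proj R n).1 h.oneDim)
  · rintro ⟨h1, h2, h3⟩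
    refine ⟨fun i hi g => (extZero_iff_proj R i).2 (h1 i hi g), fun g hg =>
      (extZero_iff_proj R n).2 fun f hf => ?_,
      (extOneDim_iff_proj R n).2 (R.extOneDim_self_iff.2 h3)⟩
    obtain ⟨h4, h5⟩ := (R.cocycle_iff f).1 hf
    exact (R.coboundary_iff h4).2 (h2 g hg f h4 h5)

/-- On finitely generated modules every linear map is a finite sum of homogeneous ones. Hence the
graded dual, and with it total Ext, is the same for the fine and the coarse grading. -/
theorem gradedDual_eq_top (b : TwistedBasis 𝒜 ψ) (M : GrMod 𝒜) [Module.Finite A M] :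
    gradedDual M = ⊤ := by
  refine Submodule.eq_top_iff'.2 fun f => ?_
  obtain ⟨s, F, rfl, hF⟩ := exists_homComponents (N := selfModule 𝒜) b f
  refine sum_mem fun e _ => dualDeg_le_gradedDual (g := e) fun g m hm => ?_
  have h := hF e g m hm
  have h' := component_mem (selfModule 𝒜) (g + e) ((∑ e ∈ s, F e) m)
  rw [← h] at h'
  exact h'

end TotalExt

/-! ### Ext and projective dimension of the trivial module under coarsening. -/

section RegradingExt

variable {G : Type u} [AddCommGroup G] [DecidableEq G] {H : Type x} [AddCommGroup H] [DecidableEq H]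
variable {k : Type v} [Field k]
variable {A : Type w} [Ring A] [Algebra k A] {𝒜 : G → Submodule k A} [GradedAlgebra 𝒜]
variable {ℬ : H → Submodule k A} [GradedAlgebra ℬ]
variable {S : Type u'} [AddCommMonoid S] {ψ : S →+ G} {φ : G →+ H}

open GrMod

theorem IsPositive.of_comp (h : IsPositive (φ.comp ψ)) : IsPositive ψ := by
  obtain ⟨D, hD⟩ := h
  exact ⟨D.comp φ, hD⟩

variable (b : TwistedBasis 𝒜 ψ) (hle : ∀ g, 𝒜 g ≤ ℬ (φ g)) (hψ : IsPositive (φ.comp ψ))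

include b hle hψ in
theorem augIdeal_regrade : augIdeal 𝒜 = augIdeal ℬ :=
  Submodule.ext fun _ => (b.mem_augIdeal hψ.of_comp).trans ((b.regrade hle).mem_augIdeal hψ).symm

/-- Regrading a projective resolution of the trivial module. -/
def ProjRes.regradeTrivial (R : ProjRes (trivialModule 𝒜)) : ProjRes (trivialModule ℬ) :=
  let e : (A ⧸ augIdeal 𝒜) ≃ₗ[A] A ⧸ augIdeal ℬ :=
    Submodule.quotEquivOfEq _ _ (augIdeal_regrade b hle hψ)
  let t : (trivialModule 𝒜).regrade (b.isRegrading hle) →ₗ[A] trivialModule ℬ := e.toLinearMap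
  have ht : Function.Injective t := e.injective
  have hom : IsHom t := isHom_of_regrade _ _ fun g m hm => by
    change m ∈ (if g = 0 then (⊤ : AddSubgroup (trivialModule 𝒜)) else ⊥) at hm
    change t m ∈ (if φ g = 0 then (⊤ : AddSubgroup (trivialModule ℬ)) else ⊥)
    by_cases hg : g = 0
    · rw [hg, map_zero, if_pos rfl]
      trivial
    · rw [if_neg hg, AddSubgroup.mem_bot] at hm
      have h0 : t m = 0 := (congrArg t hm).trans (map_zero t)
      rw [h0]
      exact zero_mem _
  { P := fun n => (R.P n).regrade (b.isRegrading hle)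
    projective := fun n => (R.projective n).regrade _
    ε := t ∘ₗ R.ε
    d := fun n => R.d n
    ε_hom := hom.comp (R.ε_hom.regrade _)
    d_hom := fun n => (R.d_hom n).regrade _
    ε_surjective := e.surjective.comp R.ε_surjective
    exact_zero := fun y => (map_eq_zero_iff t ht).trans (R.exact_zero y)
    exact_succ := R.exact_succ }

section

variable (R : ProjRes (trivialModule 𝒜)) [hR : ∀ i, Module.Finite A (R.P i)]

theorem cocycles_regradeTrivial (i : ℕ) (f : R.P i →ₗ[A] A) :
    f ∈ (R.regradeTrivial b hle hψ).cocycles i ↔ f ∈ R.cocycles i := by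
  have h1 : f ∈ gradedDual (R.P i) := by
    rw [gradedDual_eq_top b]
    trivial
  have : Module.Finite A ((R.P i).regrade (b.isRegrading hle)) := hR i
  have h2 : f ∈ gradedDual ((R.P i).regrade (b.isRegrading hle)) := by
    rw [gradedDual_eq_top (b.regrade hle)]
    trivial
  exact ⟨fun h => ⟨h1, h.2⟩, fun h => ⟨h2, h.2⟩⟩

theorem coboundaries_regradeTrivial (i : ℕ) (f : R.P i →ₗ[A] A) :
    f ∈ (R.regradeTrivial b hle hψ).coboundaries i ↔ f ∈ R.coboundaries i := by
  cases i with
  | zero => exact Iff.rfl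
  | succ i =>
    have h1 : ∀ f, f ∈ gradedDual (R.P i) := fun f => by
      rw [gradedDual_eq_top b]
      trivial
    have : Module.Finite A ((R.P i).regrade (b.isRegrading hle)) := hR i
    have h2 : ∀ f, f ∈ gradedDual ((R.P i).regrade (b.isRegrading hle)) := fun f => by
      rw [gradedDual_eq_top (b.regrade hle)]
      trivial
    exact ⟨fun ⟨h, _, e⟩ => ⟨h, h1 h, e⟩, fun ⟨h, _, e⟩ => ⟨h, h2 h, e⟩⟩

theorem subsingleton_ext_regradeTrivial (i : ℕ) :
    Subsingleton ((R.regradeTrivial b hle hψ).ext i) ↔ Subsingleton (R.ext i) := by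
  rw [ProjRes.subsingleton_ext_iff_le, ProjRes.subsingleton_ext_iff_le]
  exact forall_congr' fun f => imp_congr (cocycles_regradeTrivial b hle hψ R i f)
    (coboundaries_regradeTrivial b hle hψ R i f)

theorem isOneDimExt_regradeTrivial (n : ℕ) :
    (R.regradeTrivial b hle hψ).IsOneDimExt n ↔ R.IsOneDimExt n := by
  have h1 := cocycles_regradeTrivial b hle hψ R n
  have h2 := coboundaries_regradeTrivial b hle hψ R n
  constructor
  · rintro ⟨z, hz, hz', h⟩
    refine ⟨z, (h1 z).1 hz, fun h => hz' ((h2 z).2 h), fun f hf => ?_⟩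
    obtain ⟨r, hr⟩ := h f ((h1 f).2 hf)
    exact ⟨r, (h2 _).1 hr⟩
  · rintro ⟨z, hz, hz', h⟩
    refine ⟨z, (h1 z).2 hz, fun h => hz' ((h2 z).1 h), fun f hf => ?_⟩
    obtain ⟨r, hr⟩ := h f ((h1 f).1 hf)
    exact ⟨r, (h2 _).2 hr⟩

/-- One-dimensionality of total Ext does not refer to the grading, and a finely homogeneous
generator of degree `g` has coarse degree `φ g`. -/
theorem isOneDimExtAt_regradeTrivial (n : ℕ) (h : H) :
    (R.regradeTrivial b hle hψ).IsOneDimExtAt n h ↔ ∃ g, φ g = h ∧ R.IsOneDimExtAt n g := by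
  have h1 := cocycles_regradeTrivial b hle hψ R n
  have h2 := coboundaries_regradeTrivial b hle hψ R n
  have key : ∀ g h, R.IsOneDimExtAt n g → (R.regradeTrivial b hle hψ).IsOneDimExtAt n h →
      φ g = h := by
    rintro g h ⟨-, z, hz, hz', hz'', -⟩ hh
    refine hh.eq_of_not_mem (f := z) ?_ ((h1 z).2 hz') fun h => hz'' ((h2 z).1 h)
    have : IsHom (N := (selfModule ℬ).shift (φ g)) (M := (R.P n).regrade (b.isRegrading hle)) z :=
      isHom_of_regrade _ _ fun j m hm => by
        have := hle _ (hz j m hm)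
        rw [map_add] at this
        exact this
    exact this
  constructor
  · intro H
    obtain ⟨g, hg⟩ := ((isOneDimExt_regradeTrivial b hle hψ R n).1 H.isOneDimExt).exists_at
    exact ⟨g, key g h hg H, hg⟩
  · rintro ⟨g, rfl, hg⟩
    obtain ⟨h, hh⟩ := ((isOneDimExt_regradeTrivial b hle hψ R n).2 hg.isOneDimExt).exists_at
    rwa [key g h hg hh]

end

variable [IsNoetherianRing A]

theorem trivialModule_finite : Module.Finite A (trivialModule 𝒜) :=
  inferInstanceAs (Module.Finite A (A ⧸ augIdeal 𝒜))

include b hle hψ in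
theorem isGorensteinExt_regrade_iff {n : ℕ} {l : H} :
    IsGorensteinExt ℬ n l ↔ ∃ l', φ l' = l ∧ IsGorensteinExt 𝒜 n l' := by
  have := trivialModule_finite (𝒜 := 𝒜)
  let R := (trivialModule 𝒜).projRes
  have hR : ∀ i, Module.Finite A (R.P i) := projRes_finite _
  rw [isGorensteinExt_iff (R.regradeTrivial b hle hψ), isOneDimExtAt_regradeTrivial]
  simp only [subsingleton_ext_regradeTrivial, isGorensteinExt_iff R]
  constructor
  · rintro ⟨h1, g, hg, h2⟩
    exact ⟨-g, by rw [map_neg, hg, neg_neg], h1, by rwa [neg_neg]⟩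
  · rintro ⟨l', rfl, h1, h2⟩
    exact ⟨h1, -l', map_neg _ _, h2⟩

include b hle hψ in
-- A fine resolution can be regraded. Conversely, a short coarse resolution gives each fine cocycle
-- a coarse primitive; its component of fine degree zero is a fine primitive, so Ext vanishes in the
-- fine category too.
theorem grProjDim_trivial_regrade :
    grProjDim (trivialModule ℬ) = grProjDim (trivialModule 𝒜) := by
  refine le_antisymm (sInf_le_sInf ?_) (le_sInf ?_)
  · rintro _ ⟨m, rfl, R, hR⟩
    exact ⟨m, rfl, R.regradeTrivial b hle hψ, hR⟩
  · rintro _ ⟨m, rfl, R', hR'⟩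
    obtain ⟨R, hR⟩ := exists_projRes_of_extZero (C := fun _ : GrMod 𝒜 => True)
      (fun _ _ => trivial) m (trivialModule 𝒜) trivial fun N _ => by
        let R := (trivialModule 𝒜).projRes
        have := hR' (m + 1) m.lt_succ_self
        have h1 : ExtZero (m + 1) (trivialModule ℬ) (N.regrade (b.isRegrading hle)) :=
          extZero_of_projRes R'
        rw [extZero_iff_proj (R.regradeTrivial b hle hψ)] at h1
        rw [extZero_iff_proj R]
        rintro f ⟨hf, h0⟩
        obtain ⟨h, hh, -, e⟩ := h1 f ⟨hf.regrade _, h0⟩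
        obtain ⟨c, hc⟩ := exists_homComponent (M := R.P m) (N := N) b h 0
        have hc' : IsHom c := fun g x hx => by
          rw [hc g x hx, add_zero]
          exact component_mem _ _ _
        refine ⟨c, hc', fun h => by omega, linearMap_ext_homogeneous fun g x hx => ?_⟩
        refine (hc g _ (R.d_hom m g x hx)).trans ?_
        rw [add_zero]
        refine (congrArg (N.component g) (LinearMap.congr_fun e x)).trans ?_
        exact component_of_mem (hf g x hx)
    exact sInf_le ⟨m, rfl, R, hR⟩

end RegradingExt

/-! ### Comparison of resolutions, and local cohomology through homogeneous torsion cocycles. -/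

section Comparison

variable {G : Type u} [AddCommGroup G] [DecidableEq G]
variable {k : Type v} [Field k]
variable {A : Type w} [Ring A] [Algebra k A] {𝒜 : G → Submodule k A} [GradedAlgebra 𝒜]
variable {S : Type u'} [AddCommMonoid S] {ψ : S →+ G}

open GrMod

namespace RightRes

variable {E F : RightRes 𝒜}

/-- Maps extend to injective resolutions. -/
theorem exists_chainMap (hF : ∀ n, (F.Y (n + 1)).IsInjective) (u₀ : E.Y 0 →ₗ[A] F.Y 0)
    (h₀ : IsHom u₀) : ∃ u : ∀ n, E.Y n →ₗ[A] F.Y n, (∀ n, IsHom (u n)) ∧ u 0 = u₀ ∧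
      ∀ n, u (n + 1) ∘ₗ E.δ n = F.δ n ∘ₗ u n := by
  let P : ∀ n, (E.Y n →ₗ[A] F.Y n) → Prop := fun n u =>
    IsHom u ∧ LinearMap.ker (E.δ n) ≤ LinearMap.ker (F.δ n ∘ₗ u)
  have step : ∀ n (u : {u // P n u}), ∃ v : {v // P (n + 1) v}, v.1 ∘ₗ E.δ n = F.δ n ∘ₗ u.1 := by
    rintro n ⟨u, hu, hker⟩
    obtain ⟨v, hv, e⟩ := (hF n).exists_factor (E.δ n) (F.δ n ∘ₗ u) (E.δ_hom n)
      ((F.δ_hom n).comp hu) hker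
    refine ⟨⟨v, hv, fun x hx => ?_⟩, e⟩
    obtain ⟨y, rfl⟩ := (E.exact n x).1 hx
    exact (congrArg (F.δ (n + 1)) (LinearMap.congr_fun e y)).trans (F.δ_δ n _)
  choose next hnext using step
  have h0 : P 0 u₀ := ⟨h₀, fun x hx => by
    have : x = 0 := E.injective (hx.trans (map_zero _).symm)
    rw [this]
    exact zero_mem _⟩
  let u : ∀ n, {u // P n u} := fun n => Nat.rec ⟨u₀, h0⟩ (fun n u => next n u) n
  exact ⟨fun n => (u n).1, fun n => (u n).2.1, rfl, fun n => hnext n (u n)⟩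

/-- The map of double complexes induced by a map of resolutions. -/
def gridMap (L : LeftRes 𝒜) (hL : ∀ n, (L.X (n + 1)).IsProjective) (hE : E.IsAcyclicFor L)
    (hF : F.IsAcyclicFor L) (u : ∀ n, E.Y n →ₗ[A] F.Y n) (hu : ∀ n, IsHom (u n))
    (comm : ∀ n, u (n + 1) ∘ₗ E.δ n = F.δ n ∘ₗ u n) :
    (homGrid L E hL hE).Hom (homGrid L F hL hF) where
  app a b :=
    { toFun := fun f => ⟨u b ∘ₗ f.1, (hu b).comp f.2.1, fun ha hb => by
        rw [f.2.2 ha hb, LinearMap.comp_zero]⟩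
      map_add' := fun f g => Subtype.ext (LinearMap.comp_add _ _ _)
      map_smul' := fun c f => Subtype.ext (LinearMap.ext fun x =>
        map_smul (u b) (algebraMap k A c) (f.1 x)) }
  app_dh a b f := rfl
  app_dv a b f := Subtype.ext (LinearMap.ext fun x => LinearMap.congr_fun (comm b) (f.1 x))

/-- A chain map that is invertible on the resolved module is bijective on row zero of the double
complexes, and hence an isomorphism on the cohomology of column zero. The right resolutions need
only be acyclic for `L`. -/
theorem cohomology_comparison (L : LeftRes 𝒜) (hL : ∀ n, (L.X (n + 1)).IsProjective)
    (hE : E.IsAcyclicFor L) (hF : F.IsAcyclicFor L) (u : ∀ n, E.Y n →ₗ[A] F.Y n)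
    (hu : ∀ n, IsHom (u n)) (comm : ∀ n, u (n + 1) ∘ₗ E.δ n = F.δ n ∘ₗ u n)
    (v : F.Y 0 →ₗ[A] E.Y 0) (hv : IsHom v) (huv : u 0 ∘ₗ v = LinearMap.id)
    (hvu : v ∘ₗ u 0 = LinearMap.id) (i : ℕ) :
    (∀ f : L.X 0 →ₗ[A] E.Y (i + 1), E.Cocycle i f → F.Coboundary i (u (i + 1) ∘ₗ f) →
      E.Coboundary i f) ∧
    (∀ f' : L.X 0 →ₗ[A] F.Y (i + 1), F.Cocycle i f' →
      ∃ f : L.X 0 →ₗ[A] E.Y (i + 1), E.Cocycle i f ∧ F.Coboundary i (f' - u (i + 1) ∘ₗ f)) := by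
  have h0 : ∀ a, Function.Bijective ((gridMap L hL hE hF u hu comm).app a 0) := by
    refine fun a => ⟨fun f g h => Subtype.ext (LinearMap.ext fun x => ?_), fun f => ?_⟩
    · have h1 : u 0 (f.1 x) = u 0 (g.1 x) := LinearMap.congr_fun (congrArg Subtype.val h) x
      have h2 := congrArg v h1
      exact (LinearMap.congr_fun hvu (f.1 x)).symm.trans
        (h2.trans (LinearMap.congr_fun hvu (g.1 x)))
    · refine ⟨⟨v ∘ₗ f.1, hv.comp f.2.1, fun ha hb => by rw [f.2.2 ha hb, LinearMap.comp_zero]⟩,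
        Subtype.ext (LinearMap.ext fun x => LinearMap.congr_fun huv (f.1 x))⟩
  obtain ⟨h1, h2⟩ := (gridMap L hL hE hF u hu comm).bijective_on_cohomology h0 i
  constructor
  · intro f hf hf'
    refine (homGrid_mem_range_dv L E hL hE i ⟨f, hf.1, fun _ h => by omega⟩).1
      (h1 _ ((homGrid_mem_ker_dv L E hL hE i _).2 hf) ?_)
    exact (homGrid_mem_range_dv L F hL hF i _).2 hf'
  · intro f' hf'
    obtain ⟨f, hf, h⟩ := h2 ⟨f', hf'.1, fun _ h => by omega⟩
      ((homGrid_mem_ker_dv L F hL hF i _).2 hf')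
    exact ⟨f.1, (homGrid_mem_ker_dv L E hL hE i _).1 hf, (homGrid_mem_range_dv L F hL hF i _).1 h⟩

/-- Exactness of the complex of `I`-torsion elements. -/
def TorsionExact (E : RightRes 𝒜) (I : Ideal A) (i : ℕ) : Prop :=
  ∀ g, ∀ x ∈ (E.Y (i + 1)).deg g, ∀ n, (∀ a ∈ I ^ n, a • x = 0) → E.δ (i + 1) x = 0 →
    ∃ w ∈ (E.Y i).deg g, (∃ m, ∀ a ∈ I ^ m, a • w = 0) ∧ (i = 0 → w = 0) ∧ E.δ i w = x

end RightRes

theorem pow_augIdeal_le {m n : ℕ} (h : m ≤ n) : augIdeal 𝒜 ^ n ≤ augIdeal 𝒜 ^ m := by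
  induction n, h using Nat.le_induction with
  | base => exact le_rfl
  | succ n _ ih =>
    refine le_trans ?_ ih
    rw [Submodule.pow_succ, ← Ideal.smul_eq_mul]
    refine Submodule.smul_le.2 fun a ha c _ => ?_
    exact Ideal.IsTwoSided.mul_mem_of_left c ha

theorem mem_torsion_iff_exists {M : GrMod 𝒜} {x : M} :
    x ∈ torsion M ↔ ∃ n, ∀ a ∈ augIdeal 𝒜 ^ n, a • x = 0 :=
  ⟨fun ⟨n, h⟩ => ⟨n, h n le_rfl⟩, fun ⟨n, h⟩ => ⟨n, fun _ hm a ha => h a (pow_augIdeal_le hm ha)⟩⟩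

variable (b : TwistedBasis 𝒜 ψ) (hψ : IsPositive ψ)

include b hψ in
theorem smul_component_eq_zero {M : GrMod 𝒜} {n : ℕ} {x : M}
    (h : ∀ a ∈ augIdeal 𝒜 ^ n, a • x = 0) (g : G) :
    ∀ a ∈ augIdeal 𝒜 ^ n, a • M.component g x = 0 := by
  intro a ha
  have ha := b.mem_span_of_mem_augIdeal_pow hψ n a ‹_›
  clear * - ha h hψ
  induction ha using Submodule.span_induction with
  | mem x hx =>
    obtain ⟨s, hs, rfl⟩ := hx
    rw [← component_smul (b.mem s), h _ (b.X_mem_augIdeal_pow hψ n s hs), map_zero]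
  | zero => exact zero_smul _ _
  | add x y _ _ hx hy => rw [add_smul, hx, hy, add_zero]
  | smul r x _ hx => rw [smul_assoc, hx, smul_zero]

include b hψ in
theorem pow_augIdeal_isHomogeneous (n : ℕ) :
    IsHomogeneous (M := selfModule 𝒜) (augIdeal 𝒜 ^ n) := by
  have : augIdeal 𝒜 ^ n = Submodule.span A (b.X '' TwistedBasis.depth S n) := by
    refine le_antisymm (fun a ha => ?_) (Submodule.span_le.2 ?_)
    · exact Submodule.span_le_restrictScalars k A _ (b.mem_span_of_mem_augIdeal_pow hψ n a ha)
    · rintro _ ⟨s, hs, rfl⟩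
      exact b.X_mem_augIdeal_pow hψ n s hs
  refine (congrArg (IsHomogeneous (M := selfModule 𝒜)) this).mpr
    (isHomogeneous_span (M := selfModule 𝒜) ?_)
  rintro _ ⟨s, -, rfl⟩
  exact ⟨ψ s, b.mem s⟩

include b hψ in
-- The components of a torsion element are killed by the same power of 𝔪, so the vanishing can be
-- tested on homogeneous elements.
theorem InjRes.subsingleton_localCohomology_iff {N : GrMod 𝒜} (Q : InjRes N) (i : ℕ) :
    Subsingleton (Q.localCohomology i) ↔ Q.toRightRes.TorsionExact (augIdeal 𝒜) i := by
  rw [Submodule.Quotient.subsingleton_iff, Submodule.submoduleOf_eq_top]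
  constructor
  · intro H g x hx n hn hδ
    have := H (show x ∈ Q.cocycles i from ⟨mem_torsion_iff_exists.2 ⟨n, hn⟩, hδ⟩)
    cases i with
    | zero =>
      have h0 : x = 0 := this
      exact ⟨0, zero_mem _, ⟨0, fun a _ => smul_zero a⟩, fun _ => rfl,
        (map_zero _).trans h0.symm⟩
    | succ i =>
      obtain ⟨w, hw, e⟩ := this
      obtain ⟨m, hm⟩ := mem_torsion_iff_exists.1 hw
      refine ⟨(Q.I i).component g w, component_mem _ _ _,
        ⟨m, smul_component_eq_zero b hψ hm g⟩, fun h => by omega, ?_⟩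
      refine ((Q.d_hom i).component g w).symm.trans ?_
      rw [e]
      exact component_of_mem hx
  · rintro H x ⟨hx, hδ⟩
    obtain ⟨n, hn⟩ := mem_torsion_iff_exists.1 hx
    rw [← sum_component x (finite_component_support x).toFinset (by simp)]
    refine sum_mem fun g _ => ?_
    obtain ⟨w, hw, hm, h0, e⟩ := H g ((Q.I i).component g x) (component_mem _ _ _) n
      (smul_component_eq_zero b hψ hn g)
      (((Q.d_hom i).component g x).symm.trans ((congrArg _ hδ).trans (map_zero _)))
    cases i with
    | zero =>
      have h1 : w = 0 := h0 rfl
      rw [h1] at e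
      exact e.symm.trans (map_zero _)
    | succ i => exact ⟨w, mem_torsion_iff_exists.2 hm, e⟩

include b hψ in
theorem exists_of_torsionExact {N : GrMod 𝒜} (Q : InjRes N) {i : ℕ}
    (H : Q.toRightRes.TorsionExact (augIdeal 𝒜) i) {n : ℕ} {x : Q.I i}
    (hx : ∀ a ∈ augIdeal 𝒜 ^ n, a • x = 0) (hd : Q.d i x = 0) :
    ∃ w : Q.Y i, (∃ m, ∀ a ∈ augIdeal 𝒜 ^ m, a • w = 0) ∧ (i = 0 → w = 0) ∧ Q.δ i w = x := by
  rw [← Q.subsingleton_localCohomology_iff b hψ, Submodule.Quotient.subsingleton_iff,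
    Submodule.submoduleOf_eq_top] at H
  have := H (show x ∈ Q.cocycles i from ⟨mem_torsion_iff_exists.2 ⟨n, hx⟩, hd⟩)
  cases i with
  | zero =>
    have h0 : x = 0 := this
    exact ⟨0, ⟨0, fun a _ => smul_zero a⟩, fun _ => rfl, (map_zero _).trans h0.symm⟩
  | succ i =>
    obtain ⟨w, hw, e⟩ := this
    exact ⟨w, mem_torsion_iff_exists.1 hw, fun h => by omega, e⟩

end Comparison

/-! ### Local cohomology under coarsening. -/

section RegradingLocal

variable {G : Type u} [AddCommGroup G] [DecidableEq G] {H : Type x} [AddCommGroup H] [DecidableEq H]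
variable {k : Type v} [Field k]
variable {A : Type w} [Ring A] [Algebra k A] {𝒜 : G → Submodule k A} [GradedAlgebra 𝒜]
variable {ℬ : H → Submodule k A} [GradedAlgebra ℬ]
variable {S : Type u'} [AddCommMonoid S] {ψ : S →+ G} {φ : G →+ H}

open GrMod

variable (b : TwistedBasis 𝒜 ψ) (hr : IsRegrading φ 𝒜 ℬ)

include b in
-- Injectivity of the terms of `Q` is not claimed after regrading; acyclicity for finitely generated
-- terms suffices. The map splits into finitely many fine components: those of degree `e` with `φ e
-- ≠ 0` vanish, and the others extend by injectivity of the shifted resolution.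
theorem RightRes.IsAcyclicFor.regrade {N : GrMod 𝒜} (Q : InjRes N) {M : GrMod 𝒜} (R : ProjRes M)
    [hfin : ∀ n, Module.Finite A (R.P n)] :
    (Q.toRightRes.regrade hr).IsAcyclicFor (R.toLeftRes.regrade hr) := by
  intro a c f hf h
  obtain ⟨f, rfl⟩ : ∃ f' : R.P a →ₗ[A] Q.I c, f' = f := ⟨f, rfl⟩
  obtain ⟨s, F, hs, hF⟩ := exists_homComponents b f
  have key : ∀ e, ∃ h : R.X a →ₗ[A] Q.I c,
      (∀ g, ∀ m ∈ (R.X a).deg g, h m ∈ ((Q.I c).regrade hr).deg (φ g)) ∧ h ∘ₗ R.δ a = F e := by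
    intro e
    by_cases he : φ e = 0
    · obtain ⟨h, hh, e'⟩ := (Q.shift e).isAcyclicFor R.toLeftRes a c (F e)
        (fun g m hm => by
          have : F e m ∈ (Q.I c).deg (g + e) := by
            rw [hF e g m hm]
            exact component_mem _ _ _
          exact this)
        (linearMap_ext_homogeneous fun g m hm => by
          refine (hF e g _ (R.toLeftRes.δ_hom (a + 1) g m hm)).trans ?_
          exact (congrArg _ (LinearMap.congr_fun h m)).trans (map_zero _))
      refine ⟨h, fun g m hm => ?_, e'⟩
      have h1 : h m ∈ (Q.I c).deg (g + e) := hh g m hm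
      have := mem_regrade hr h1
      rwa [map_add, he, add_zero] at this
    · refine ⟨0, fun g m hm => zero_mem _, linearMap_ext_homogeneous fun g m hm => ?_⟩
      refine Eq.trans ?_ (hF e g m hm).symm
      refine (hf _ _ (mem_regrade hr hm) (g + e) ?_).symm
      rw [map_add]
      simpa using he
  choose h hh e using key
  refine ⟨∑ e ∈ s, h e, isHom_of_regrade hr _ fun g m hm => ?_, ?_⟩
  · refine (congrArg (· ∈ _) (LinearMap.sum_apply s h m)).mpr ?_
    exact sum_mem fun e _ => hh e g m hm
  · refine LinearMap.ext fun x => ?_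
    refine (LinearMap.sum_apply s h _).trans ?_
    refine Eq.trans ?_ (LinearMap.congr_fun hs x)
    refine Eq.trans ?_ (LinearMap.sum_apply s F x).symm
    exact Finset.sum_congr rfl fun j _ => LinearMap.congr_fun (e j) x

variable (hle : ∀ g, 𝒜 g ≤ ℬ (φ g)) (hψ : IsPositive (φ.comp ψ))

/-- The module `A / 𝔪ⁿ`, generated in degree `g`. -/
def TwistedBasis.truncation (hψ : IsPositive ψ) (n : ℕ) (g : G) : GrMod 𝒜 :=
  ((selfModule 𝒜).quot (augIdeal 𝒜 ^ n) (pow_augIdeal_isHomogeneous b hψ n)).shift (-g)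

/-- The generator of `A / 𝔪ⁿ`. -/
def TwistedBasis.truncationOne (hψ : IsPositive ψ) (n : ℕ) (g : G) : b.truncation hψ n g :=
  (Submodule.Quotient.mk (1 : A) : A ⧸ augIdeal 𝒜 ^ n)

section

variable {b} {hψ' : IsPositive ψ} {n : ℕ} {g : G}

theorem TwistedBasis.mk_truncation (m : b.truncation hψ' n g) :
    ∃ a : A, a • b.truncationOne hψ' n g = m ∧
      ∀ j, m ∈ (b.truncation hψ' n g).deg j → ∃ a ∈ 𝒜 (j - g), a • b.truncationOne hψ' n g = m := by
  have key : ∀ a : A, a • b.truncationOne hψ' n g = (Submodule.Quotient.mk a : A ⧸ augIdeal 𝒜 ^ n) :=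
    fun a => congrArg (Submodule.Quotient.mk (p := augIdeal 𝒜 ^ n)) (mul_one a)
  obtain ⟨a, rfl⟩ := Submodule.Quotient.mk_surjective (augIdeal 𝒜 ^ n) m
  refine ⟨a, key a, ?_⟩
  rintro j ⟨a', ha', e⟩
  refine ⟨a', ?_, (key a').trans e⟩
  rw [sub_eq_add_neg]
  exact ha'

theorem TwistedBasis.truncation_hom_ext {Y : Type*} [AddCommGroup Y] [Module A Y]
    {f f' : b.truncation hψ' n g →ₗ[A] Y}
    (h : f (b.truncationOne hψ' n g) = f' (b.truncationOne hψ' n g)) : f = f' := by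
  refine LinearMap.ext fun m => ?_
  obtain ⟨a, rfl, -⟩ := TwistedBasis.mk_truncation m
  rw [map_smul, map_smul, h]

theorem TwistedBasis.smul_truncationOne {a : A} (ha : a ∈ augIdeal 𝒜 ^ n) :
    a • b.truncationOne hψ' n g = 0 :=
  (congrArg (Submodule.Quotient.mk (p := augIdeal 𝒜 ^ n)) (mul_one a)).trans
    ((Submodule.Quotient.mk_eq_zero _).2 ha)

theorem TwistedBasis.truncationOne_mem :
    b.truncationOne hψ' n g ∈ (b.truncation hψ' n g).deg g := by
  refine ⟨(1 : A), ?_, rfl⟩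
  change (1 : A) ∈ 𝒜 (g + -g)
  rw [add_neg_cancel]
  exact SetLike.GradedOne.one_mem

theorem TwistedBasis.exists_truncation_hom {Y : GrMod ℬ} {x : Y} (hx : x ∈ Y.deg (φ g))
    (h : ∀ a ∈ augIdeal 𝒜 ^ n, a • x = 0) :
    ∃ f : (b.truncation hψ' n g).regrade hr →ₗ[A] Y, IsHom f ∧
      f (b.truncationOne hψ' n g) = x := by
  obtain ⟨f, hf⟩ : ∃ f : b.truncation hψ' n g →ₗ[A] Y, f (b.truncationOne hψ' n g) = x :=
    ⟨(augIdeal 𝒜 ^ n).liftQ (LinearMap.toSpanSingleton A Y x) h, one_smul A x⟩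
  refine ⟨f, isHom_of_regrade hr _ fun j m hm => ?_, hf⟩
  obtain ⟨a, ha, rfl⟩ := (TwistedBasis.mk_truncation m).choose_spec.2 j hm
  have h1 : f (a • b.truncationOne hψ' n g) = a • x := by rw [map_smul, hf]
  refine (congrArg (· ∈ Y.deg (φ j)) h1).mpr ?_
  have := Y.smul_mem (hr.le _ ha) hx
  rwa [← map_add, sub_add_cancel] at this

end

/-- Maps out of A/𝔪^n generated in degree `g` correspond to elements of degree `φ g` killed by 𝔪^n;
this translates cohomology of torsion elements into Ext. The module is a variable `X` with an
equation so that its construction stays opaque in later unification. -/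
theorem TwistedBasis.exists_truncation_generator (hψ' : IsPositive ψ) (n : ℕ) (g : G)
    (X : GrMod ℬ) (hX : X = (b.truncation hψ' n g).regrade hr) : ∃ t : X, t ∈ X.deg (φ g) ∧
      (∀ (Y : GrMod ℬ) (f : X →ₗ[A] Y), ∀ a ∈ augIdeal 𝒜 ^ n, a • f t = 0) ∧
      (∀ (Y : GrMod ℬ) (f f' : X →ₗ[A] Y), f t = f' t → f = f') ∧
      (∀ (Y : GrMod ℬ), ∀ x ∈ Y.deg (φ g), (∀ a ∈ augIdeal 𝒜 ^ n, a • x = 0) →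
        ∃ f : X →ₗ[A] Y, IsHom f ∧ f t = x) := by
  subst hX
  have h0 := mem_regrade hr
    (TwistedBasis.truncationOne_mem (b := b) (hψ' := hψ') (n := n) (g := g))
  have h1 : ∀ (Y : GrMod ℬ) (f : b.truncation hψ' n g →ₗ[A] Y), ∀ a ∈ augIdeal 𝒜 ^ n,
      a • f (b.truncationOne hψ' n g) = 0 := fun Y f a ha => by
    rw [← map_smul, TwistedBasis.smul_truncationOne ha, map_zero]
  have h2 : ∀ (Y : GrMod ℬ) (f f' : b.truncation hψ' n g →ₗ[A] Y),
      f (b.truncationOne hψ' n g) = f' (b.truncationOne hψ' n g) → f = f' :=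
    fun Y f f' h => TwistedBasis.truncation_hom_ext h
  have h3 := fun Y : GrMod ℬ => fun x : Y => TwistedBasis.exists_truncation_hom (b := b)
    (hψ' := hψ') (n := n) (g := g) hr (x := x)
  exact ⟨b.truncationOne hψ' n g, h0, h1, h2, h3⟩

variable [IsNoetherianRing A]

/-- Comparison of torsion cocycles along a regrading. -/
theorem RightRes.torsion_comparison {E F : RightRes ℬ} (hψ' : IsPositive ψ) (i n : ℕ) (g : G)
    (hE : E.IsAcyclicFor ((b.truncation hψ' n g).projRes.toLeftRes.regrade hr))
    (hF : F.IsAcyclicFor ((b.truncation hψ' n g).projRes.toLeftRes.regrade hr))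
    (u : ∀ n, E.Y n →ₗ[A] F.Y n)
    (hu : ∀ n, IsHom (u n)) (comm : ∀ n, u (n + 1) ∘ₗ E.δ n = F.δ n ∘ₗ u n)
    (v : F.Y 0 →ₗ[A] E.Y 0) (hv : IsHom v) (huv : u 0 ∘ₗ v = LinearMap.id)
    (hvu : v ∘ₗ u 0 = LinearMap.id) :
    (∀ x ∈ (E.Y (i + 1)).deg (φ g), (∀ a ∈ augIdeal 𝒜 ^ n, a • x = 0) → E.δ (i + 1) x = 0 →
      ∀ w ∈ (F.Y i).deg (φ g), (∀ a ∈ augIdeal 𝒜 ^ n, a • w = 0) → (i = 0 → w = 0) →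
      F.δ i w = u (i + 1) x → ∃ w ∈ (E.Y i).deg (φ g),
        (∀ a ∈ augIdeal 𝒜 ^ n, a • w = 0) ∧ (i = 0 → w = 0) ∧ E.δ i w = x) ∧
    (∀ y ∈ (F.Y (i + 1)).deg (φ g), (∀ a ∈ augIdeal 𝒜 ^ n, a • y = 0) → F.δ (i + 1) y = 0 →
      ∃ x : E.Y (i + 1), (∀ a ∈ augIdeal 𝒜 ^ n, a • x = 0) ∧ E.δ (i + 1) x = 0 ∧
      ∃ w ∈ (F.Y i).deg (φ g), (∀ a ∈ augIdeal 𝒜 ^ n, a • w = 0) ∧ (i = 0 → w = 0) ∧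
      F.δ i w = y - u (i + 1) x) := by
  obtain ⟨h1, h2⟩ := cohomology_comparison _ (fun m => ((b.truncation hψ' n g).projRes.projective
    m).regrade hr) hE hF u hu comm v hv huv hvu i
  obtain ⟨L, hL⟩ : ∃ L, L = (b.truncation hψ' n g).projRes.toLeftRes.regrade hr := ⟨_, rfl⟩
  obtain ⟨t, ht, hker, hext, hex⟩ := TwistedBasis.exists_truncation_generator b hr hψ' n g (L.X 0)
    (by rw [hL]; rfl)
  rw [← hL] at h1 h2
  constructor
  · intro x hx hxn hd w hw hwn h0 e
    obtain ⟨f, hf, rfl⟩ := hex _ x hx hxn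
    obtain ⟨f', hf', rfl⟩ := hex _ w hw hwn
    obtain ⟨p, hp, hp0, rfl⟩ := h1 f ⟨hf, hext _ _ _ hd⟩
      ⟨f', hf', fun hi => hext _ _ _ (h0 hi), hext _ _ _ e⟩
    exact ⟨p t, hp _ _ ht, hker _ p, fun hi => LinearMap.congr_fun (hp0 hi) t, rfl⟩
  · intro y hy hyn hd
    obtain ⟨f, hf, rfl⟩ := hex _ y hy hyn
    obtain ⟨p, ⟨hp, hp'⟩, q, hq, hq0, eq⟩ := h2 f ⟨hf, hext _ _ _ hd⟩
    exact ⟨p t, hker _ p, LinearMap.congr_fun hp' t, q t, hq _ _ ht, hker _ q,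
      fun hi => LinearMap.congr_fun (hq0 hi) t, LinearMap.congr_fun eq t⟩

include hψ in
-- Local cohomology is approximated by Ext^i(A/𝔪^n, -), where the regraded fine injective resolution
-- and a coarse injective resolution give the same result by `RightRes.torsion_comparison`.
theorem localCohomologyVanishes_regrade_iff (hφ : Function.Surjective φ) (N : GrMod 𝒜) (i : ℕ) :
    LocalCohomologyVanishes (N.regrade (b.isRegrading hle)) i ↔ LocalCohomologyVanishes N i := by
  set hr := b.isRegrading hle
  have key : ∀ (Q : InjRes N) (J : InjRes (N.regrade hr)),
      Subsingleton (J.localCohomology i) ↔ Subsingleton (Q.localCohomology i) := by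
    intro Q J
    rw [Q.subsingleton_localCohomology_iff b hψ.of_comp,
      J.subsingleton_localCohomology_iff (b.regrade hle) hψ, ← augIdeal_regrade b hle hψ]
    obtain ⟨u, hu, hu0, comm⟩ := RightRes.exists_chainMap (E := Q.toRightRes.regrade hr)
      (F := J.toRightRes) J.injective (LinearMap.id : N.regrade hr →ₗ[A] N.regrade hr) IsHom.id
    have C := fun n g => RightRes.torsion_comparison b hr hψ.of_comp i n g
      (by
        have : Module.Finite A (b.truncation hψ.of_comp n g) :=
          inferInstanceAs (Module.Finite A (A ⧸ augIdeal 𝒜 ^ n))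
        have := fun m => projRes_finite (b.truncation hψ.of_comp n g) m
        exact RightRes.IsAcyclicFor.regrade b hr Q _) (J.isAcyclicFor _) u hu comm
      (LinearMap.id : N.regrade hr →ₗ[A] N.regrade hr) IsHom.id
      ((LinearMap.comp_id _).trans hu0) ((LinearMap.id_comp _).trans hu0)
    constructor
    · intro HJ g x hx n hn hd
      have hx' : x ∈ ((Q.I i).regrade hr).deg (φ g) := mem_regrade hr hx
      obtain ⟨w, hw, ⟨m, hm⟩, h0, e⟩ := HJ (φ g) (u (i + 1) x) (hu _ _ _ hx') n
        (fun a ha => by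
          refine (map_smul (u (i + 1)) a x).symm.trans ?_
          exact (congrArg (u (i + 1)) (hn a ha)).trans (map_zero _))
        ((LinearMap.congr_fun (comm (i + 1)) x).symm.trans
          ((congrArg (u (i + 2)) hd).trans (map_zero _)))
      -- The primitive `w` may need a higher power of 𝔪 than `x`, so the comparison is made for the
      -- larger of the two exponents.
      obtain ⟨w', hw', hm', h0', e'⟩ := (C (max n m) g).1 x hx'
        (fun a ha => hn a (pow_augIdeal_le (le_max_left _ _) ha)) hd w hw
        (fun a ha => hm a (pow_augIdeal_le (le_max_right _ _) ha)) h0 e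
      refine ⟨(Q.Y i).component g w', component_mem _ _ _,
        ⟨max n m, smul_component_eq_zero b hψ.of_comp hm' g⟩, fun hi => ?_, ?_⟩
      · rw [h0' hi]
        exact map_zero _
      · refine ((Q.toRightRes.δ_hom i).component g w').symm.trans ?_
        refine (congrArg ((Q.I i).component g) e').trans ?_
        exact component_of_mem hx
    · intro HQ h y hy n hn hd
      -- Surjectivity of `φ` enters here: a coarse degree is tested by a truncation generated in a
      -- fine degree above it.
      obtain ⟨g, rfl⟩ := hφ h
      obtain ⟨x, hxn, hxd, w, hw, hwn, h0, e⟩ := (C n g).2 y hy hn hd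
      obtain ⟨z, ⟨m, hm⟩, hz0, hz⟩ := exists_of_torsionExact b hψ.of_comp Q HQ hxn hxd
      have huz : ∀ a ∈ augIdeal 𝒜 ^ m, a • u i z = 0 := fun a ha => by
        refine (map_smul (u i) a z).symm.trans ?_
        exact (congrArg (u i) (hm a ha)).trans (map_zero _)
      have e' : J.δ i (u i z) = u (i + 1) x :=
        (LinearMap.congr_fun (comm i) z).symm.trans (congrArg (u (i + 1)) hz)
      have h1 : augIdeal 𝒜 = augIdeal ℬ := augIdeal_regrade b hle hψ
      refine ⟨(J.Y i).component (φ g) (w + u i z), component_mem _ _ _, ⟨max n m, ?_⟩,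
        fun hi => ?_, ?_⟩
      · rw [h1]
        refine smul_component_eq_zero (b.regrade hle) hψ (fun a ha => ?_) _
        rw [← h1] at ha
        refine (smul_add _ _ _).trans ?_
        exact (congrArg₂ (· + ·) (hwn a (pow_augIdeal_le (le_max_left _ _) ha))
          (huz a (pow_augIdeal_le (le_max_right _ _) ha))).trans (add_zero _)
      · have h2 : u i z = 0 := (congrArg (u i) (hz0 hi)).trans (map_zero _)
        rw [h0 hi, h2, add_zero]
        exact map_zero _
      · refine ((J.toRightRes.δ_hom i).component (φ g) (w + u i z)).symm.trans ?_
        refine Eq.trans (congrArg _ ?_) (component_of_mem hy)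
        refine (map_add (J.δ i) w (u i z)).trans ?_
        exact (congrArg₂ (fun p q : J.I i => p + q) e e').trans (sub_add_cancel _ _)
  exact ⟨fun ⟨J, hJ⟩ => ⟨N.injRes, (key _ J).1 hJ⟩,
    fun ⟨Q, hQ⟩ => ⟨(N.regrade hr).injRes, (key Q _).2 hQ⟩⟩

end RegradingLocal

/-! ### Finitely generated commutative monoids. -/

section AffineMonoids

variable {S : Type u'} [AddCommMonoid S] [hS : AddMonoid.FG S]

/-- Dickson's lemma: vectors of exponents with respect to finitely many generators are
well-quasi-ordered. -/
theorem AddMonoid.FG.exists_add_eq_of_seq (f : ℕ → S) : ∃ m n, m < n ∧ ∃ u, u + f m = f n := by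
  classical
  obtain ⟨T, hT⟩ := AddMonoid.fg_def.1 hS
  have : ∀ s : S, ∃ a : T → ℕ, ∑ i, a i • (i : S) = s := by
    intro s
    have := AddSubmonoid.mem_top s
    rw [← hT] at this
    obtain ⟨a, ha⟩ := AddSubmonoid.mem_closure_finset'.1 this
    exact ⟨a, ha.symm⟩
  choose a ha using this
  have hwqo : WellQuasiOrdered ((· ≤ ·) : (T → ℕ) → (T → ℕ) → Prop) := wellQuasiOrdered_le
  obtain ⟨m, n, hmn, h⟩ := hwqo fun n => a (f n)
  refine ⟨m, n, hmn, ∑ i : T, (a (f n) i - a (f m) i) • (i : S), ?_⟩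
  refine (congrArg _ (ha (f m)).symm).trans (Eq.trans ?_ (ha (f n)))
  rw [← Finset.sum_add_distrib]
  refine Finset.sum_congr rfl fun i _ => ?_
  rw [← add_smul, Nat.sub_add_cancel (h i)]

variable (S) in
/-- The multiples of some element are cofinal. -/
theorem AddMonoid.FG.exists_cofinal : ∃ t : S, ∀ s : S, ∃ (n : ℕ) (s' : S), s + s' = n • t := by
  classical
  obtain ⟨T, hT⟩ := AddMonoid.fg_def.1 hS
  -- The sum of all generators works: each generator is completed to it by the remaining ones.
  refine ⟨∑ i ∈ T, i, fun s => ?_⟩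
  have := AddSubmonoid.mem_top s
  rw [← hT] at this
  induction this using AddSubmonoid.closure_induction with
  | mem x hx => exact ⟨1, ∑ i ∈ T.erase x, i, by
    rw [one_smul]
    exact Finset.add_sum_erase T id hx⟩
  | zero => exact ⟨0, 0, by simp⟩
  | add x y _ _ hx hy =>
    obtain ⟨n, x', hx⟩ := hx
    obtain ⟨m, y', hy⟩ := hy
    exact ⟨n + m, x' + y', by rw [add_add_add_comm, hx, hy, add_smul]⟩

end AffineMonoids

/-! ### Noetherianity by leading exponents. -/

section Noetherian

variable {G : Type u} [AddCommGroup G] [DecidableEq G]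
variable {k : Type v} [Field k]
variable {A : Type w} [Ring A] [Algebra k A] {𝒜 : G → Submodule k A} [GradedAlgebra 𝒜]
variable {S : Type u'} [AddCommMonoid S] {ψ : S →+ G}
variable {Γ : Type*} [AddCommMonoid Γ] [LinearOrder Γ] [IsOrderedCancelAddMonoid Γ]

namespace TwistedBasis

variable (b : TwistedBasis 𝒜 ψ) (κ : S →+ Γ)

/-- `s` is the leading exponent of `a`. -/
def IsLead (a : A) (s : S) : Prop := b.X.repr a s ≠ 0 ∧ ∀ t, b.X.repr a t ≠ 0 → κ t ≤ κ s

theorem exists_isLead {a : A} (ha : a ≠ 0) : ∃ s, b.IsLead κ a s := by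
  have : (b.X.repr a).support.Nonempty := by simpa using ha
  obtain ⟨s, hs, h⟩ := Finset.exists_max_image _ κ this
  exact ⟨s, by simpa using hs, fun t ht => h t (by simpa using ht)⟩

variable {κ} (hκ : Function.Injective κ)

include hκ in
theorem repr_X_mul_add (u t : S) (a : A) :
    b.X.repr (b.X u * a) (u + t) = (b.α u t : k) * b.X.repr a t := by
  have : (Finsupp.lapply (u + t) ∘ₗ b.X.repr.toLinearMap) ∘ₗ LinearMap.mulLeft k (b.X u) =
      (b.α u t : k) • (Finsupp.lapply t ∘ₗ b.X.repr.toLinearMap) := by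
    refine b.X.ext fun s => ?_
    have hinj : u + s = u + t ↔ s = t := by
      rw [← hκ.eq_iff, map_add, map_add, add_right_inj, hκ.eq_iff]
    by_cases h : s = t
    · subst h
      simp [b.mul]
    · simp [b.mul, hinj, h]
  exact LinearMap.congr_fun this a

theorem exists_of_repr_X_mul_ne_zero {u v : S} {a : A} (h : b.X.repr (b.X u * a) v ≠ 0) :
    ∃ t, u + t = v ∧ b.X.repr a t ≠ 0 := by
  contrapose! h
  have h1 : b.X u * a = ∑ t ∈ (b.X.repr a).support, b.X.repr a t • (b.X u * b.X t) := by
    conv_lhs => rw [← b.X.linearCombination_repr a]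
    rw [Finsupp.linearCombination_apply, Finsupp.sum, Finset.mul_sum]
    exact Finset.sum_congr rfl fun t _ => mul_smul_comm _ _ _
  rw [h1, map_sum, Finsupp.finsetSum_apply]
  refine Finset.sum_eq_zero fun t ht => ?_
  have : u + t ≠ v := fun h' => (Finsupp.mem_support_iff.1 ht) (h t h')
  rw [map_smul, b.mul, map_smul, b.X.repr_self]
  simp [this]

include hκ in
theorem IsLead.X_mul {a : A} {s : S} (h : b.IsLead κ a s) (u : S) :
    b.IsLead κ (b.X u * a) (u + s) := by
  refine ⟨?_, fun v hv => ?_⟩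
  · rw [b.repr_X_mul_add hκ]
    exact mul_ne_zero (Units.ne_zero _) h.1
  · obtain ⟨t, rfl, ht⟩ := b.exists_of_repr_X_mul_ne_zero hv
    rw [map_add, map_add]
    exact add_le_add_right (h.2 t ht) _

include b hκ in
-- A Gröbner basis argument for left ideals. Division shows that a strictly larger ideal has a new
-- leading exponent. In a strictly ascending chain Dickson's lemma writes a later new exponent as
-- `u` plus an earlier one, and multiplying by X^u produces it one ideal too early.
theorem isNoetherianRing [AddMonoid.FG S] (hpos : ∀ s, 0 ≤ κ s) : IsNoetherianRing A := by
  have wf : WellFounded (InvImage (· < ·) κ) := by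
    have : IsStrictOrder S (InvImage (· < ·) κ) :=
      { irrefl := fun a => lt_irrefl (κ a), trans := fun a b c => lt_trans (a := κ a) }
    rw [RelEmbedding.wellFounded_iff_isEmpty]
    refine ⟨fun f => ?_⟩
    obtain ⟨m, n, hmn, u, h⟩ := AddMonoid.FG.exists_add_eq_of_seq f
    have h1 : κ (f n) < κ (f m) := f.map_rel_iff.2 hmn
    rw [← h, map_add] at h1
    exact (le_add_of_nonneg_left (hpos u)).not_gt h1
  have key : ∀ I J : Submodule A A, I < J →
      ∃ s, (∃ a ∈ J, b.IsLead κ a s) ∧ ¬ ∃ a ∈ I, b.IsLead κ a s := by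
    intro I J hIJ
    by_contra! hcon
    refine hIJ.not_ge fun a ha => ?_
    have : ∀ s, ∀ a ∈ J, b.IsLead κ a s → a ∈ I := by
      intro s
      induction s using wf.induction with
      | h s ih =>
        intro a ha hs
        obtain ⟨a', ha', hs'⟩ := hcon s ⟨a, ha, hs⟩
        -- Subtracting `r • a'` cancels the leading term of `a`, and what remains has a smaller
        -- leading exponent.
        set r := b.X.repr a s * (b.X.repr a' s)⁻¹
        have hra : r • a' ∈ I := I.smul_of_tower_mem r ha'
        suffices a - r • a' ∈ I by
          have := add_mem this hra
          rwa [sub_add_cancel] at this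
        by_cases h0 : a - r • a' = 0
        · rw [h0]
          exact zero_mem _
        obtain ⟨t, ht⟩ := b.exists_isLead κ h0
        refine ih t ?_ _ (sub_mem ha (hIJ.le hra)) ht
        refine lt_of_le_of_ne ?_ fun h => ?_
        · by_contra! hlt
          apply ht.1
          have h1 : b.X.repr a t = 0 := by
            by_contra h
            exact (hs.2 t h).not_gt hlt
          have h2 : b.X.repr a' t = 0 := by
            by_contra h
            exact (hs'.2 t h).not_gt hlt
          simp [h1, h2]
        · obtain rfl := hκ h
          apply ht.1
          simp [r, hs'.1]
    by_cases h0 : a = 0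
    · rw [h0]
      exact zero_mem _
    · obtain ⟨s, hs⟩ := b.exists_isLead κ h0
      exact this s a ha hs
  rw [isNoetherianRing_iff, isNoetherian_iff, RelEmbedding.wellFounded_iff_isEmpty]
  refine ⟨fun f => ?_⟩
  have hf : StrictMono f := fun m n h => f.map_rel_iff.2 h
  choose s hs hs' using fun n => key (f n) (f (n + 1)) (hf n.lt_succ_self)
  obtain ⟨m, n, hmn, u, h⟩ := AddMonoid.FG.exists_add_eq_of_seq s
  obtain ⟨a, ha, hlead⟩ := hs m
  refine hs' n ⟨b.X u * a, ?_, h ▸ hlead.X_mul b hκ u⟩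
  exact (f n).smul_mem _ (hf.monotone hmn ha)

end TwistedBasis

end Noetherian

/-! ### Trivializing the cocycle on the degree group. -/

section ExistsTwist

variable {G : Type u} [AddCommGroup G] [DecidableEq G]
variable {k : Type v} [Field k]
variable {A : Type w} [Ring A] [Algebra k A] {𝒜 : G → Submodule k A} [GradedAlgebra 𝒜]
variable {B : Type w} [Ring B] [Algebra k B] {ℬ : G → Submodule k B} [GradedAlgebra ℬ]
variable {S : Type u'} [AddCommMonoid S] {ψ : S →+ G}

theorem TwistedBasis.α_cocycle (b : TwistedBasis 𝒜 ψ) (s t u : S) :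
    b.α s t * b.α (s + t) u = b.α t u * b.α s (t + u) := by
  have h := mul_assoc (b.X s) (b.X t) (b.X u)
  rw [b.mul, b.mul, smul_mul_assoc, mul_smul_comm, b.mul, b.mul, smul_smul, smul_smul,
    add_assoc] at h
  exact Units.ext (smul_left_injective k (b.X.ne_zero _) h)

/-- A commutative monoid that embeds into a group acts on that group in such a way that every
cocycle becomes a coboundary. -/
theorem exists_trivialization [AddMonoid.FG S] {C : Type*} [CommGroup C] (hψ : Function.Injective ψ)
    (α : S → S → C) (hα : ∀ s t u, α s t * α (s + t) u = α t u * α s (t + u)) :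
    ∃ c : S → G → C, ∀ s t g, c s (ψ t + g) * c t g = α s t * c (s + t) g := by
  classical
  obtain ⟨t₀, ht₀⟩ := AddMonoid.FG.exists_cofinal S
  let K : AddSubgroup G := AddSubgroup.closure (Set.range ψ)
  -- A base point in each coset of the group generated by `S`; it is unchanged under translation by
  -- `S`.
  let r : G → G := fun g => ((QuotientAddGroup.mk g : G ⧸ K).out)
  have hr : ∀ s g, r (ψ s + g) = r g := by
    intro s g
    refine congrArg Quotient.out ((QuotientAddGroup.eq (s := K)).2 ?_)
    rw [neg_add_rev, add_assoc, add_comm (-ψ s) g, ← add_assoc, neg_add_cancel, zero_add]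
    exact neg_mem (AddSubgroup.subset_closure ⟨s, rfl⟩)
  have hdiff : ∀ x ∈ K, ∃ s t, x = ψ s - ψ t := by
    intro x hx
    induction hx using AddSubgroup.closure_induction with
    | mem x hx =>
      obtain ⟨s, rfl⟩ := hx
      exact ⟨s, 0, by simp⟩
    | zero => exact ⟨0, 0, by simp⟩
    | add x y _ _ hx hy =>
      obtain ⟨s, t, rfl⟩ := hx
      obtain ⟨s', t', rfl⟩ := hy
      exact ⟨s + s', t + t', by rw [map_add, map_add, add_sub_add_comm]⟩
    | neg x _ hx =>
      obtain ⟨s, t, rfl⟩ := hx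
      exact ⟨t, s, neg_sub _ _⟩
  -- Translating by `N • ψ t₀` brings `g` into the orbit of its base point, with the unique
  -- coordinate `u` in `S`. Cofinality of the multiples of `t₀` provides such an `N` for every `g`.
  let P : ℕ → G → S → Prop := fun N g u => g + N • ψ t₀ = r g + ψ u
  have uniq : ∀ N g u u', P N g u → P N g u' → u = u' := fun N g u u' h h' =>
    hψ (add_left_cancel (h.symm.trans h'))
  have cover : ∀ g, ∃ N u, P N g u := by
    intro g
    have hg : -r g + g ∈ K := (QuotientAddGroup.eq (s := K)).1 (Quotient.out_eq' _)
    obtain ⟨s, t, hst⟩ := hdiff _ hg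
    obtain ⟨N, t', ht'⟩ := ht₀ t
    refine ⟨N, s + t', ?_⟩
    change g + N • ψ t₀ = _
    rw [← map_nsmul, ← ht', map_add, map_add]
    have : g = r g + (ψ s - ψ t) := by rw [← hst, add_neg_cancel_left]
    conv_lhs => rw [this]
    abel
  let T : ℕ → G → Prop := fun N g => ∃ u, P N g u
  let U : ℕ → G → S := fun N g => if h : T N g then h.choose else 0
  have hU : ∀ {N g u}, P N g u → U N g = u := by
    intro N g u h
    have hT : T N g := ⟨u, h⟩
    refine uniq N g _ _ ?_ h
    change P N g (if h : T N g then h.choose else 0)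
    rw [dif_pos hT]
    exact hT.choose_spec
  have P_add : ∀ {N g u} s, P N g u → P N (ψ s + g) (s + u) := by
    intro N g u s h
    change ψ s + g + N • ψ t₀ = r (ψ s + g) + ψ (s + u)
    rw [hr, add_assoc, show g + N • ψ t₀ = r g + ψ u from h, map_add]
    abel
  have P_succ : ∀ {N g u}, P N g u → P (N + 1) g (u + t₀) := by
    intro N g u h
    change g + (N + 1) • ψ t₀ = r g + ψ (u + t₀)
    rw [add_smul, one_smul, ← add_assoc, show g + N • ψ t₀ = r g + ψ u from h, map_add, add_assoc]
  have P_le : ∀ {N M g}, N ≤ M → T N g → T M g := by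
    intro N M g h hT
    induction M, h using Nat.le_induction with
    | base => exact hT
    | succ M _ ih => exact ⟨_, P_succ ih.choose_spec⟩
  -- On the orbit, α(s, u) already solves the equation, by the cocycle identity. Increasing `N` by
  -- one multiplies it by the coboundary of α(u, t₀); the product `F` removes these factors, so the
  -- corrected value `c` stabilises.
  let F : ℕ → G → C := fun N g => ∏ j ∈ Finset.range N, if T j g then (α (U j g) t₀)⁻¹ else 1
  let c : ℕ → S → G → C := fun N s g => α s (U N g) * F N (ψ s + g) * (F N g)⁻¹
  have c_succ : ∀ N s g, T N g → c (N + 1) s g = c N s g := by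
    rintro N s g ⟨u, hu⟩
    have h1 : T N g := ⟨u, hu⟩
    have h2 : T N (ψ s + g) := ⟨_, P_add s hu⟩
    change α s (U (N + 1) g) * F (N + 1) (ψ s + g) * (F (N + 1) g)⁻¹ = _
    change _ * (∏ j ∈ Finset.range (N + 1), _) * (∏ j ∈ Finset.range (N + 1), _)⁻¹ = _
    rw [Finset.prod_range_succ, Finset.prod_range_succ, if_pos h1, if_pos h2, hU hu,
      hU (P_add s hu), hU (P_succ hu)]
    change α s (u + t₀) * (F N (ψ s + g) * _) * (F N g * _)⁻¹ = α s (U N g) * _ * _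
    rw [hU hu]
    have h3 : α s (u + t₀) = α s u * α (s + u) t₀ * (α u t₀)⁻¹ := by
      rw [hα, mul_comm (α u t₀), mul_inv_cancel_right]
    rw [h3, mul_inv, inv_inv]
    have : ∀ a b c d e : C, a * b * c⁻¹ * (d * b⁻¹) * (e⁻¹ * c) = a * d * e⁻¹ := by
      intro a b c d e
      apply Additive.ofMul.injective
      simp only [ofMul_mul, ofMul_inv]
      abel
    exact this _ _ _ _ _
  have c_le : ∀ {N M s g}, N ≤ M → T N g → c M s g = c N s g := by
    intro N M s g h hT
    induction M, h using Nat.le_induction with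
    | base => rfl
    | succ M h ih => rw [c_succ M s g (P_le h hT), ih]
  choose n hn using cover
  refine ⟨fun s g => c (n g) s g, fun s t g => ?_⟩
  -- The stages chosen for `g` and `ψ t + g` may differ; all three scalars are evaluated at a common
  -- later one.
  let N := max (n g) (n (ψ t + g))
  have h1 : T N g := P_le (le_max_left _ _) (hn g)
  change c (n (ψ t + g)) s (ψ t + g) * c (n g) t g = α s t * c (n g) (s + t) g
  rw [← c_le (le_max_right (n g) (n (ψ t + g))) (hn (ψ t + g)), ← c_le (le_max_left _ _) (hn g),
    ← c_le (le_max_left _ _) (hn g)]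
  change c N s (ψ t + g) * c N t g = α s t * c N (s + t) g
  obtain ⟨u, hu⟩ := h1
  change α s (U N (ψ t + g)) * F N (ψ s + (ψ t + g)) * (F N (ψ t + g))⁻¹ *
    (α t (U N g) * F N (ψ t + g) * (F N g)⁻¹) =
    α s t * (α (s + t) (U N g) * F N (ψ (s + t) + g) * (F N g)⁻¹)
  rw [hU hu, hU (P_add t hu), map_add, add_assoc]
  have : ∀ a b c d e : C, a * b * c⁻¹ * (d * c * e) = d * a * (b * e) := by
    intro a b c d e
    apply Additive.ofMul.injective
    simp only [ofMul_mul, ofMul_inv]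
    abel
  rw [this, ← hα]
  simp only [mul_assoc]

/-- The quotient of the two cocycles is again a cocycle and can be trivialized. -/
theorem exists_isTwist [AddMonoid.FG S] (hψ : Function.Injective ψ) (bB : TwistedBasis ℬ ψ)
    (bA : TwistedBasis 𝒜 ψ) : ∃ c, IsTwist bB bA c := by
  obtain ⟨c, hc⟩ := exists_trivialization hψ (fun s t => bB.α s t * (bA.α s t)⁻¹) fun s t u => by
    rw [mul_mul_mul_comm, bB.α_cocycle, ← mul_inv, bA.α_cocycle, mul_mul_mul_comm, mul_inv]
  refine ⟨c, fun s t g => ?_⟩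
  rw [hc, mul_right_comm, inv_mul_cancel_right]

end ExistsTwist

/-! ### Invariants of the fine grading agree. -/

section TwistInvariance

variable {G : Type u} [AddCommGroup G] [DecidableEq G]
variable {k : Type v} [Field k]
variable {A : Type w} [Ring A] [Algebra k A] {𝒜 : G → Submodule k A} [GradedAlgebra 𝒜]
variable {B : Type w} [Ring B] [Algebra k B] {ℬ : G → Submodule k B} [GradedAlgebra ℬ]
variable {S : Type u'} [AddCommMonoid S] {ψ : S →+ G}
variable {bB : TwistedBasis ℬ ψ} {bA : TwistedBasis 𝒜 ψ} {c : S → G → kˣ}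

open GrMod

namespace IsTwist

theorem localCohomologyVanishes_self_iff (hψ : IsPositive ψ) (hc : IsTwist bB bA c) (i : ℕ) :
    LocalCohomologyVanishes (selfModule ℬ) i ↔ LocalCohomologyVanishes (selfModule 𝒜) i := by
  have := (TwistEquiv.self hc 0).localCohomologyVanishes_iff hψ hc (i := i)
  rwa [shift_zero, shift_zero] at this

theorem extZero_trivial_iff (hψ : IsPositive ψ) (hc : IsTwist bB bA c) (i : ℕ) (g : G) :
    ExtZero i (trivialModule ℬ) ((selfModule ℬ).shift g) ↔
      ExtZero i (trivialModule 𝒜) ((selfModule 𝒜).shift g) := by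
  have := TwistEquiv.extZero_iff hc (TwistEquiv.trivial hψ hc 0) (TwistEquiv.self hc g) (i := i)
  rwa [shift_zero, shift_zero] at this

theorem extOneDim_trivial_iff (hψ : IsPositive ψ) (hc : IsTwist bB bA c) (i : ℕ) (g : G) :
    ExtOneDim i (trivialModule ℬ) ((selfModule ℬ).shift g) ↔
      ExtOneDim i (trivialModule 𝒜) ((selfModule 𝒜).shift g) := by
  have := TwistEquiv.extOneDim_iff hc (TwistEquiv.trivial hψ hc 0) (TwistEquiv.self hc g) (i := i)
  rwa [shift_zero, shift_zero] at this

theorem isGorensteinExt_iff (hψ : IsPositive ψ) (hc : IsTwist bB bA c) (n : ℕ) (l : G) :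
    IsGorensteinExt ℬ n l ↔ IsGorensteinExt 𝒜 n l := by
  constructor
  · rintro ⟨h1, h2, h3⟩
    exact ⟨fun i hi g => (hc.extZero_trivial_iff hψ i g).1 (h1 i hi g),
      fun g hg => (hc.extZero_trivial_iff hψ n g).1 (h2 g hg),
      (hc.extOneDim_trivial_iff hψ n _).1 h3⟩
  · rintro ⟨h1, h2, h3⟩
    exact ⟨fun i hi g => (hc.extZero_trivial_iff hψ i g).2 (h1 i hi g),
      fun g hg => (hc.extZero_trivial_iff hψ n g).2 (h2 g hg),
      (hc.extOneDim_trivial_iff hψ n _).2 h3⟩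

theorem grProjDim_trivial_eq (hψ : IsPositive ψ) (hc : IsTwist bB bA c) :
    grProjDim (trivialModule ℬ) = grProjDim (trivialModule 𝒜) := by
  have := TwistEquiv.grProjDim_eq hc (TwistEquiv.trivial hψ hc 0)
  rwa [shift_zero, shift_zero] at this

end IsTwist

end TwistInvariance

/-! ### The coarsely graded algebra as a regraded module. -/

section RegradingInvariants

variable {G : Type u} [AddCommGroup G] [DecidableEq G] {H : Type x} [AddCommGroup H] [DecidableEq H]
variable {k : Type v} [Field k]
variable {A : Type w} [Ring A] [Algebra k A] {𝒜 : G → Submodule k A} [GradedAlgebra 𝒜]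
variable {ℬ : H → Submodule k A} [GradedAlgebra ℬ]
variable {S : Type u'} [AddCommMonoid S] {ψ : S →+ G} {φ : G →+ H}

open GrMod

/-- Regrading the algebra as a module over itself. -/
def TwistedBasis.regradeSelf (b : TwistedBasis 𝒜 ψ) (hle : ∀ g, 𝒜 g ≤ ℬ (φ g)) :
    TwistEquiv (b.regrade hle) (b.regrade hle) (fun _ _ => 1) (selfModule ℬ)
      ((selfModule 𝒜).regrade (b.isRegrading hle)) where
  e :=
    { toFun := fun a => a
      invFun := fun a => a
      map_add' := fun _ _ => rfl
      map_smul' := fun _ _ => rfl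
      left_inv := fun _ => rfl
      right_inv := fun _ => rfl }
  mem_deg h a := by
    change (∀ g, φ g ≠ h → (selfModule 𝒜).component g a = 0) ↔ (show A from a) ∈ ℬ h
    refine ⟨fun H => ?_, fun ha => (b.isRegrading hle).component_eq_zero h a ha⟩
    have h1 := sum_component (M := selfModule 𝒜) a
      (finite_component_support (M := selfModule 𝒜) a).toFinset (by simp)
    refine (congrArg (fun a : A => a ∈ ℬ h) h1).mp ?_
    refine Submodule.sum_mem (ℬ h) fun g _ => ?_
    by_cases hg : φ g = h
    · rw [← hg]
      exact hle g (component_mem (selfModule 𝒜) g a)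
    · exact (congrArg (fun a : A => a ∈ ℬ h) (H g hg)).mpr (zero_mem _)
  X_smul s g y hy := by
    rw [Units.val_one, one_smul]
    rfl

/-- The coarse algebra and the regraded fine algebra have the same underlying module; their gradings
are identified through the trivial twist. -/
theorem TwistedBasis.localCohomologyVanishes_self_regrade_iff [IsNoetherianRing A]
    (b : TwistedBasis 𝒜 ψ) (hle : ∀ g, 𝒜 g ≤ ℬ (φ g)) (hψ : IsPositive (φ.comp ψ))
    (hφ : Function.Surjective φ) (i : ℕ) :
    LocalCohomologyVanishes (selfModule ℬ) i ↔ LocalCohomologyVanishes (selfModule 𝒜) i :=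
  ((b.regradeSelf hle).localCohomologyVanishes_iff hψ fun s t g => by simp).trans
    (localCohomologyVanishes_regrade_iff b hle hψ hφ _ i)

end RegradingInvariants

/-! ### The regularity conditions, through the fine grading. -/

section Comparison

variable {G : Type u} [AddCommGroup G] [DecidableEq G] {H : Type x} [AddCommGroup H] [DecidableEq H]
variable {k : Type v} [Field k]
variable {A : Type w} [Ring A] [Algebra k A] {𝒜 : G → Submodule k A} [GradedAlgebra 𝒜]
variable {𝒜' : H → Submodule k A} [GradedAlgebra 𝒜']
variable {B : Type w} [Ring B] [Algebra k B] {ℬ : G → Submodule k B} [GradedAlgebra ℬ]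
variable {ℬ' : H → Submodule k B} [GradedAlgebra ℬ']
variable {S : Type u'} [AddCommMonoid S] {ψ : S →+ G} {φ : G →+ H}

/-- Regularity conditions for graded algebras with twisted bases indexed by the same monoid. -/
theorem TwistedBasis.regularity_iff [AddMonoid.FG S]
    [IsNoetherianRing A] [IsNoetherianRing B] [IsNoetherianRing Aᵐᵒᵖ] [IsNoetherianRing Bᵐᵒᵖ]
    (bA : TwistedBasis 𝒜 ψ) (bB : TwistedBasis ℬ ψ) (hA : ∀ g, 𝒜 g ≤ 𝒜' (φ g))
    (hB : ∀ g, ℬ g ≤ ℬ' (φ g)) (hψ : Function.Injective ψ) (hφ : Function.Surjective φ)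
    (hpos : IsPositive (φ.comp ψ)) :
    (IsASCohenMacaulay 𝒜' ↔ IsASCohenMacaulay ℬ') ∧ (IsASGorenstein 𝒜' ↔ IsASGorenstein ℬ') ∧
      (IsASRegular 𝒜' ↔ IsASRegular ℬ') := by
  obtain ⟨c, hc⟩ := exists_isTwist hψ bA bB
  -- The opposite algebras have the transposed cocycles, so they are compared by a twist of their
  -- own.
  obtain ⟨c', hc'⟩ := exists_isTwist hψ bA.op bB.op
  have hA' : ∀ g, opGrading 𝒜 g ≤ opGrading 𝒜' (φ g) := fun g => Submodule.comap_mono (hA g)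
  have hB' : ∀ g, opGrading ℬ g ≤ opGrading ℬ' (φ g) := fun g => Submodule.comap_mono (hB g)
  have hpos' := hpos.of_comp
  have cm : IsASCohenMacaulay 𝒜' ↔ IsASCohenMacaulay ℬ' := by
    refine exists_congr fun n => forall₂_congr fun i _ => and_congr ?_ ?_
    · rw [bA.localCohomologyVanishes_self_regrade_iff hA hpos hφ,
        bB.localCohomologyVanishes_self_regrade_iff hB hpos hφ]
      exact hc.localCohomologyVanishes_self_iff hpos' i
    · rw [bA.op.localCohomologyVanishes_self_regrade_iff hA' hpos hφ,
        bB.op.localCohomologyVanishes_self_regrade_iff hB' hpos hφ]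
      exact hc'.localCohomologyVanishes_self_iff hpos' i
  have gor : IsASGorenstein 𝒜' ↔ IsASGorenstein ℬ' := by
    refine exists_congr fun n => exists_congr fun l => and_congr ?_ ?_
    · rw [isLeftASGorensteinWith_iff (bA.regrade hA) hpos,
        isLeftASGorensteinWith_iff (bB.regrade hB) hpos, isGorensteinExt_regrade_iff bA hA hpos,
        isGorensteinExt_regrade_iff bB hB hpos]
      simp only [hc.isGorensteinExt_iff hpos']
    · rw [isLeftASGorensteinWith_iff (bA.op.regrade hA') hpos,
        isLeftASGorensteinWith_iff (bB.op.regrade hB') hpos,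
        isGorensteinExt_regrade_iff bA.op hA' hpos, isGorensteinExt_regrade_iff bB.op hB' hpos]
      simp only [hc'.isGorensteinExt_iff hpos']
  refine ⟨cm, gor, and_congr gor ?_⟩
  have h1 : grGlobalDim 𝒜' = grGlobalDim ℬ' := by
    rw [GrMod.grGlobalDim_eq (bA.regrade hA) hpos, GrMod.grGlobalDim_eq (bB.regrade hB) hpos,
      grProjDim_trivial_regrade bA hA hpos, grProjDim_trivial_regrade bB hB hpos,
      hc.grProjDim_trivial_eq hpos']
  have h2 : grGlobalDim (opGrading 𝒜') = grGlobalDim (opGrading ℬ') := by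
    rw [GrMod.grGlobalDim_eq (bA.op.regrade hA') hpos, GrMod.grGlobalDim_eq (bB.op.regrade hB') hpos,
      grProjDim_trivial_regrade bA.op hA' hpos, grProjDim_trivial_regrade bB.op hB' hpos,
      hc'.grProjDim_trivial_eq hpos']
  rw [h1, h2]

end Comparison

/-! ### The two semigroup algebras as instances. -/

section SemigroupAlgebras

variable {G : Type u} [AddCommGroup G] [DecidableEq G] {k : Type v} [Field k]
variable {S : Type u'} [AddCommMonoid S]

/-- The basis of a twisted semigroup algebra. -/
def TwistedSemigroupAlgebra.twistedBasis (α : NormalizedCocycle S k) (ψ : S →+ G) :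
    TwistedBasis (TwistedSemigroupAlgebra.gradeBy α ψ) ψ where
  X := ⟨(LinearEquiv.refl k (S →₀ k) : TwistedSemigroupAlgebra α ≃ₗ[k] S →₀ k)⟩
  α := α.toFun
  mul := TwistedSemigroupAlgebra.mulLin_X
  one := rfl
  mem := TwistedSemigroupAlgebra.X_mem_gradeBy ψ

/-- The basis of a semigroup algebra. -/
def AddMonoidAlgebra.twistedBasis (ψ : S →+ G) :
    TwistedBasis (AddMonoidAlgebra.gradeBy k ψ) ψ where
  X := AddMonoidAlgebra.basis S k
  α _ _ := 1
  mul s t := by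
    rw [AddMonoidAlgebra.basis_apply, AddMonoidAlgebra.basis_apply, AddMonoidAlgebra.basis_apply,
      AddMonoidAlgebra.single_mul_single, Units.val_one, one_smul, one_mul]
  one := rfl
  mem s := AddMonoidAlgebra.single_mem_gradeBy _ s 1

theorem TwistedSemigroupAlgebra.gradeBy_le {H : Type*} [AddCommGroup H]
    (α : NormalizedCocycle S k) (ψ : S →+ G) (φ : G →+ H) (g : G) :
    TwistedSemigroupAlgebra.gradeBy α ψ g ≤ TwistedSemigroupAlgebra.gradeBy α (φ.comp ψ) (φ g) := by
  refine Submodule.span_mono ?_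
  rintro _ ⟨s, rfl, rfl⟩
  exact ⟨s, rfl, rfl⟩

theorem AddMonoidAlgebra.gradeBy_le {H : Type*} [AddCommGroup H] (ψ : S →+ G) (φ : G →+ H) (g : G) :
    AddMonoidAlgebra.gradeBy k ψ g ≤ AddMonoidAlgebra.gradeBy k (φ.comp ψ) (φ g) :=
  fun a ha s hs => congrArg φ (ha s hs)

end SemigroupAlgebras

/-! ### Positivity and Noetherianity from the embedding into the lattice. -/

section Lattice

variable {k : Type v} [Field k] {n : ℕ} {A : Type w} [Ring A] [Algebra k A]
variable {𝒜 : (Fin (n + 1) → ℤ) → Submodule k A} [GradedAlgebra 𝒜]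
variable {S : Type u'} [AddCommMonoid S] {ι : S →+ (Fin (n + 1) → ℤ)}

theorem totalDegree_surjective : Function.Surjective (totalDegree n) := fun m =>
  ⟨Pi.single 0 m, by
    change ∑ i, (Pi.single 0 m : Fin (n + 1) → ℤ) i = m
    simp⟩

theorem isPositive_totalDegree_comp (hι : Function.Injective ι) (hpos : ∀ s i, 0 ≤ ι s i) :
    IsPositive ((totalDegree n).comp ι) := by
  refine ⟨AddMonoidHom.id ℤ, fun s hs => ?_⟩
  change 0 < ∑ i, ι s i
  refine (Finset.sum_nonneg fun i _ => hpos s i).lt_of_ne fun h => hs (hι ?_)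
  rw [map_zero]
  funext i
  exact (Finset.sum_eq_zero_iff_of_nonneg fun i _ => hpos s i).1 h.symm i (Finset.mem_univ i)

/-- The lexicographic order on exponents is compatible with addition, and nonnegative vectors are
nonnegative in it. -/
theorem TwistedBasis.isNoetherianRing_of_lattice [AddMonoid.FG S] (b : TwistedBasis 𝒜 ι)
    (hι : Function.Injective ι) (hpos : ∀ s i, 0 ≤ ι s i) : IsNoetherianRing A := by
  let κ : S →+ Lex (Fin (n + 1) → ℤ) :=
    { toFun := fun s => toLex (ι s)
      map_zero' := by rw [map_zero]; rfl
      map_add' := fun s t => by rw [map_add]; rfl }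
  refine b.isNoetherianRing (κ := κ) (fun s t h => hι (toLex.injective h)) fun s => ?_
  exact Pi.toLex_monotone (fun i => hpos s i : (0 : Fin (n + 1) → ℤ) ≤ ι s)

end Lattice

end

theorem mainTheorem2 {k : Type*} [Field k] {S : Type*} [AddCommMonoid S] [AddMonoid.FG S]
    (n : ℕ) (ι : S →+ (Fin (n + 1) → ℤ)) (hι : Function.Injective ι)
    (hpos : ∀ (s : S) (i : Fin (n + 1)), 0 ≤ ι s i) (α : NormalizedCocycle S k) :
    -- the regularity conditions for the `ℤ^{n+1}`-gradings
    ((IsASCohenMacaulay (TwistedSemigroupAlgebra.gradeBy α ι) ↔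
        IsASCohenMacaulay (AddMonoidAlgebra.gradeBy k ι)) ∧
      (IsASGorenstein (TwistedSemigroupAlgebra.gradeBy α ι) ↔
        IsASGorenstein (AddMonoidAlgebra.gradeBy k ι)) ∧
      (IsASRegular (TwistedSemigroupAlgebra.gradeBy α ι) ↔
        IsASRegular (AddMonoidAlgebra.gradeBy k ι))) ∧
    -- the regularity conditions for the `ℤ`-gradings by total degree
    ((IsASCohenMacaulay (TwistedSemigroupAlgebra.gradeBy α ((totalDegree n).comp ι)) ↔
        IsASCohenMacaulay (AddMonoidAlgebra.gradeBy k ((totalDegree n).comp ι))) ∧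
      (IsASGorenstein (TwistedSemigroupAlgebra.gradeBy α ((totalDegree n).comp ι)) ↔
        IsASGorenstein (AddMonoidAlgebra.gradeBy k ((totalDegree n).comp ι))) ∧
      (IsASRegular (TwistedSemigroupAlgebra.gradeBy α ((totalDegree n).comp ι)) ↔
        IsASRegular (AddMonoidAlgebra.gradeBy k ((totalDegree n).comp ι)))) := by
  let b₁ := TwistedSemigroupAlgebra.twistedBasis α ι
  let b₂ := AddMonoidAlgebra.twistedBasis (k := k) ι
  have := b₁.isNoetherianRing_of_lattice hι hpos
  have := b₂.isNoetherianRing_of_lattice hι hpos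
  have := b₁.op.isNoetherianRing_of_lattice hι hpos
  have := b₂.op.isNoetherianRing_of_lattice hι hpos
  have h := isPositive_totalDegree_comp hι hpos
  -- The fine grading is the case of the identity regrading; positivity of the total degree serves
  -- both cases.
  exact ⟨b₁.regularity_iff b₂ (φ := AddMonoidHom.id _) (fun _ => le_rfl) (fun _ => le_rfl) hι
      Function.surjective_id h.of_comp,
    b₁.regularity_iff b₂ (TwistedSemigroupAlgebra.gradeBy_le α ι (totalDegree n))
      (AddMonoidAlgebra.gradeBy_le ι (totalDegree n)) hι totalDegree_surjective h⟩
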